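/- Notation. For a Schwartz function $f$ on $\mathbb R^N$ let $\widehat f(\xi)=\int_{\mathbb R^N} f(x)e^{-2\pi i\langle x,\xi\rangle}\,dx$; this extends to tempered distributions, with inverse $F\mapsto F^\vee$. For $1<u<\infty$, $s>0$ and $F\in L^u(\mathbb R^N)$ let $$\|F\|_{L^u_s(\mathbb R^N)}:=\big\|\big[(1+4\pi^2|\cdot|^2)^{s/2}\widehat F\,\big]^\vee\big\|_{L^u(\mathbb R^N)},$$ understood as $\infty$ if the tempered distribution $[(1+4\pi^2|\cdot|^2)^{s/2}\widehat F\,]^\vee$ is not an $L^u$ function. Let $n\ge 1$, and let $\Theta$ be a Schwartz function on $\mathbb R^{2n}$ whose Fourier transform is supported in $\{\xi\in\mathbb R^{2n}:1/2\le|\xi|\le 2\}$. For a bounded measurable function $m:\mathbb R^{2n}\to\mathbb C$ put $$\mathcal A_s^u[m]:=\sup_{k\in\mathbb Z}\big\|m(2^k\,\cdot\,)\,\widehat\Theta\big\|_{L^u_s(\mathbb R^{2n})},$$ and for Schwartz functions $f_1,f_2$ on $\mathbb R^n$ and $x\in\mathbb R^n$ put $$T_m(f_1,f_2)(x):=\int_{\mathbb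 R^{n}\times\mathbb R^n} m(\xi_1,\xi_2)\,\widehat{f_1}(\xi_1)\,\widehat{f_2}(\xi_2)\,e^{2\pi i\langle x,\xi_1+\xi_2\rangle}\,d\xi_1\,d\xi_2 .$$ Theorem. Let $1<p_1,p_2<\infty$, $\frac1p=\frac1{p_1}+\frac1{p_2}$, $1<u<\infty$, $0<s<\infty$, and write $\frac1{u'}:=1-\frac1u$ and $\frac1{p'}:=1-\frac1p$ (which is negative when $p<1$). Suppose that there is a constant $C<\infty$ such that $$\|T_m(f_1,f_2)\|_{L^p(\mathbb R^n)}\le C\,\mathcal A_s^u[m]\,\|f_1\|_{L^{p_1}(\mathbb R^n)}\|f_2\|_{L^{p_2}(\mathbb R^n)}$$ for all bounded measurable $m$ on $\mathbb R^{2n}$ with $\mathcal A_s^u[m]<\infty$ and all Schwartz functions $f_1,f_2$ on $\mathbb R^n$. Then $$\frac sn>\max\Big\{\frac2u,\ \frac1p-\frac1{u'}\Big\}$$ and $$\frac sn\ \ge\ \max\Big\{\frac12-\frac1{p'},0\Big\}+\sum_{i=1}^2\max\Big\{\frac12-\frac1{p_i},0\Big\}.$$ -/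

import Mathlib

open MeasureTheory FourierTransform TemperedDistribution
open scoped SchwartzMap ENNReal NNReal

noncomputable section

namespace BilinearMultiplier

/-- Euclidean space `ℝⁿ`. -/
abbrev Rn (n : ℕ) : Type := EuclideanSpace ℝ (Fin n)

/-- The Euclidean space `ℝⁿ × ℝⁿ = ℝ²ⁿ` of pairs `(ξ₁, ξ₂)`, with norm
`(|ξ₁|² + |ξ₂|²)^(1/2)` and Lebesgue measure. -/
abbrev R2n (n : ℕ) : Type := WithLp 2 (Rn n × Rn n)

/-- The bilinear Fourier multiplier operator
`T_m(f₁,f₂)(x) = ∫ m(ξ₁,ξ₂) f₁^(ξ₁) f₂^(ξ₂) exp(2πi⟨x, ξ₁+ξ₂⟩) d(ξ₁,ξ₂)` on Schwartz functions.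
The integral converges absolutely for bounded measurable `m`. -/
def bilinearOp {n : ℕ} (m : R2n n → ℂ) (f₁ f₂ : 𝓢(Rn n, ℂ)) (x : Rn n) : ℂ :=
  ∫ ξ : R2n n, m ξ * (𝓕 f₁) ξ.fst * (𝓕 f₂) ξ.snd *
    Complex.exp (2 * Real.pi * Complex.I * (inner ℝ x (ξ.fst + ξ.snd) : ℝ))

section Sobolev

variable {E : Type*} [NormedAddCommGroup E] [InnerProductSpace ℝ E]

/-- The symbol `(1 + 4π²|ξ|²)^(s/2)`. -/
def besselSymbol (s : ℝ) (ξ : E) : ℂ :=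
  (((1 + 4 * Real.pi ^ 2 * ‖ξ‖ ^ 2) ^ (s / 2) : ℝ) : ℂ)

/-- The symbol has temperate growth, so that it acts on tempered distributions. -/
theorem besselSymbol_hasTemperateGrowth (s : ℝ) :
    (besselSymbol s : E → ℂ).HasTemperateGrowth := by
  have h1 := Function.hasTemperateGrowth_one_add_norm_sq_rpow E (s / 2)
  have h2 : (fun x : E => ((2 * Real.pi) • ContinuousLinearMap.id ℝ E) x).HasTemperateGrowth :=
    ContinuousLinearMap.hasTemperateGrowth _
  have h3 := (Complex.ofRealCLM.hasTemperateGrowth).comp (h1.comp h2)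
  convert h3 using 1
  ext x
  simp only [besselSymbol, Function.comp, Complex.ofRealCLM_apply, smul_apply,
    ContinuousLinearMap.id_apply, norm_smul, Real.norm_eq_abs, mul_pow, sq_abs]
  norm_num

variable [FiniteDimensional ℝ E] [MeasurableSpace E] [BorelSpace E]

/-- The Sobolev norm `‖F‖_{L^u_s} = ‖[(1 + 4π²|·|²)^(s/2) F^]^∨‖_{L^u}` for `s ≥ 0`, `u ≥ 1`.
The Fourier transforms are those of tempered distributions; the norm is `∞` unless `F ∈ L^u` and
the tempered distribution `[(1 + 4π²|·|²)^(s/2) F^]^∨` is given by a (then unique) `L^u` function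
`g`, in which case it is `‖g‖_{L^u}`. -/
def sobolevENorm (s u : ℝ) (hu : 1 ≤ u) (F : E → ℂ) : ℝ≥0∞ :=
  haveI : Fact (1 ≤ ENNReal.ofReal u) := ⟨ENNReal.one_le_ofReal.2 hu⟩
  ⨅ (hF : MemLp F (ENNReal.ofReal u) (volume : Measure E))
    (g : Lp ℂ (ENNReal.ofReal u) (volume : Measure E))
    (_ : fourierMultiplierCLM ℂ (besselSymbol s) (Lp.toTemperedDistribution (hF.toLp F)) =
      Lp.toTemperedDistribution g), ‖g‖ₑ

/-- `A_s^u[m] = sup_{k ∈ ℤ} ‖m(2^k ·) Θ^‖_{L^u_s}`. -/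
def hormanderENorm (Θ : 𝓢(E, ℂ)) (s u : ℝ) (hu : 1 ≤ u) (m : E → ℂ) : ℝ≥0∞ :=
  ⨆ k : ℤ, sobolevENorm s u hu (fun ξ => m ((2 : ℝ) ^ k • ξ) * (𝓕 Θ) ξ)

end Sobolev

end BilinearMultiplier

end

/-! Each condition is forced by a one-parameter family of smooth multipliers supported in a fixed
annulus, whose Hörmander norm is bounded above while `T_m(f₁,f₂)` is computed exactly for suitable
`f₁, f₂`. Comparing powers of the parameter (`le_of_forall_mul_rpow_le`) gives the inequality.

Condition `s/n > 2/u`: if `s ≤ 2n/u`, the space `L^u_s` on `ℝ²ⁿ` does not control point values, not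
even at the endpoint. The average `N⁻¹ ∑_{j<N} φ(2^j(ξ - ξ₀))`, cut off by `χ`, equals one near `ξ₀`
but has norm `O(N^(1/u - 1))`. For `f₁, f₂` with frequencies close enough to the components of `ξ₀`,
the operator is the pointwise product, and by scaling Hölder's inequality for this product is sharp
up to a constant. Since `u > 1`, letting `N → ∞` is a contradiction.

Condition `s/n > 1/p - 1/u'`: the bumps now concentrate on the subspace `ξ₁ + ξ₂ = e` of codimension
`n`, with coefficients `2^(jn(1 - 1/p))`. If the condition fails, the norm is `O(N^(1/u))`, while
the output is a modulated sum of `N` dyadic dilates, normalised in `L^p`, of one nonnegative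
profile, so its norm is at least `c N^(1/p)`. This is absurd for `p < u`; for `p ≥ u` the first
condition is stronger.

The last condition: `m = exp(iν(θ|ξ₁+ξ₂|² - θ₁|ξ₁|² - θ₂|ξ₂|²)) χ` has norm `O(ν^s)`. The phases of
`f₁, f₂` cancel the last two terms. Switching each quadratic phase on exactly when dispersion helps
makes the inputs small in `L^(p_i)` for `p_i > 2`, and the output large in `L^p` for `p < 2`.

The upper bounds need Bessel potentials of fractional order. `norm_besselPot_le_weight` shows that
for a function living at scale `1/ν` near a thin set they cost `ν^s` and keep polynomial decay away
from the set. It rests on `subordination` to the heat flow and on `heat_weight_le`;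
`dyadic_sum_rpow_le` then sums the dyadic scales. -/

open MeasureTheory FourierTransform TemperedDistribution
open scoped SchwartzMap ENNReal NNReal

noncomputable section

namespace BilinearMultiplier

/-! ### Bessel potentials and the heat flow on Schwartz functions -/

section Bessel

variable {E : Type*} [NormedAddCommGroup E] [InnerProductSpace ℝ E]
  [FiniteDimensional ℝ E] [MeasurableSpace E] [BorelSpace E]

/-- The Bessel potential `(1 - Δ)^(s/2)` on Schwartz functions. -/
def besselPot (s : ℝ) (F : 𝓢(E, ℂ)) : 𝓢(E, ℂ) :=
  SchwartzMap.fourierMultiplierCLM ℂ (besselSymbol s) F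

theorem besselPot_sum {ι : Type*} (s : ℝ) (S : Finset ι) (F : ι → 𝓢(E, ℂ)) :
    besselPot s (∑ i ∈ S, F i) = ∑ i ∈ S, besselPot s (F i) := map_sum _ _ _

theorem besselPot_smul (s : ℝ) (c : ℂ) (F : 𝓢(E, ℂ)) :
    besselPot s (c • F) = c • besselPot s F := map_smul _ _ _

/-- The function `besselPot s F` is a competitor in the infimum. From here on all Sobolev bounds
concern Schwartz functions, without distributions. -/
theorem sobolevENorm_le (s u : ℝ) (hu : 1 ≤ u) (F : 𝓢(E, ℂ)) :
    sobolevENorm s u hu F ≤ eLpNorm (besselPot s F) (ENNReal.ofReal u) volume := by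
  have : Fact (1 ≤ ENNReal.ofReal u) := ⟨ENNReal.one_le_ofReal.2 hu⟩
  have hF : MemLp F (ENNReal.ofReal u) (volume : Measure E) := F.memLp _ _
  refine (iInf_le_of_le hF (iInf_le_of_le ((besselPot s F).toLp (ENNReal.ofReal u) volume)
    (iInf_le_of_le ?_ ?_)))
  · have h1 : hF.toLp F = F.toLp (ENNReal.ofReal u) volume := rfl
    rw [h1, Lp.toTemperedDistribution_toLp_eq, Lp.toTemperedDistribution_toLp_eq]
    exact fourierMultiplierCLM_toTemperedDistributionCLM_eq (besselSymbol_hasTemperateGrowth s) F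
  · rw [SchwartzMap.toLp, Lp.enorm_toLp]

theorem fourier_besselPot_apply (s : ℝ) (F : 𝓢(E, ℂ)) (ξ : E) :
    𝓕 (besselPot s F) ξ = besselSymbol s ξ * 𝓕 F ξ := by
  rw [besselPot, SchwartzMap.fourierMultiplierCLM_apply, FourierTransform.fourier_fourierInv_eq,
    SchwartzMap.smulLeftCLM_apply_apply (besselSymbol_hasTemperateGrowth s), smul_eq_mul]

theorem apply_eq_integral_fourier (F : 𝓢(E, ℂ)) (x : E) :
    F x = ∫ ξ, Complex.exp (↑(2 * Real.pi * inner ℝ ξ x) * Complex.I) * 𝓕 F ξ := by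
  have h : 𝓕⁻ (𝓕 F) = F := FourierTransform.fourierInv_fourier_eq F
  conv_lhs => rw [← h, SchwartzMap.fourierInv_coe, Real.fourierInv_eq']
  rfl

theorem besselPot_apply (s : ℝ) (F : 𝓢(E, ℂ)) (x : E) :
    besselPot s F x = ∫ ξ, Complex.exp (↑(2 * Real.pi * inner ℝ ξ x) * Complex.I) *
      (besselSymbol s ξ * 𝓕 F ξ) := by
  simp_rw [apply_eq_integral_fourier (besselPot s F), fourier_besselPot_apply]

open Laplacian in
/-- The operator `1 - Δ` on Schwartz functions. -/
def oneSubLaplacian (F : 𝓢(E, ℂ)) : 𝓢(E, ℂ) := F - Δ F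

theorem besselSymbol_two {E : Type*} [NormedAddCommGroup E] (ξ : E) : besselSymbol 2 ξ = ((1 + 4 * Real.pi ^ 2 * ‖ξ‖ ^ 2 : ℝ) : ℂ) := by
  rw [besselSymbol, div_self two_ne_zero, Real.rpow_one]

open Laplacian in
theorem oneSubLaplacian_eq (F : 𝓢(E, ℂ)) : oneSubLaplacian F = besselPot 2 F := by
  have h : 𝓕 (oneSubLaplacian F) = 𝓕 (besselPot 2 F) := by
    ext ξ
    rw [fourier_besselPot_apply, oneSubLaplacian, SchwartzMap.laplacian_eq_fourierMultiplierCLM,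
      ← SchwartzMap.fourierMultiplierCLM_ofReal ℂ (by fun_prop), sub_eq_add_neg, ← neg_one_smul ℂ,
      FourierTransform.fourier_add, FourierTransform.fourier_smul, FourierTransform.fourier_smul, SchwartzMap.fourierMultiplierCLM_apply,
      FourierTransform.fourier_fourierInv_eq, add_apply, smul_apply, smul_apply,
      SchwartzMap.smulLeftCLM_apply_apply (by fun_prop), besselSymbol_two]
    simp
    ring
  have h2 (G : 𝓢(E, ℂ)) : 𝓕⁻ (𝓕 G) = G := FourierTransform.fourierInv_fourier_eq G
  rw [← h2 (oneSubLaplacian F), h, h2]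

theorem besselSymbol_add {E : Type*} [NormedAddCommGroup E] (s t : ℝ) (ξ : E) :
    besselSymbol (s + t) ξ = besselSymbol s ξ * besselSymbol t ξ := by
  rw [besselSymbol, besselSymbol, besselSymbol, ← Complex.ofReal_mul,
    ← Real.rpow_add (by positivity), add_div]

theorem besselPot_add (s t : ℝ) (F : 𝓢(E, ℂ)) :
    besselPot (s + t) F = besselPot s (besselPot t F) := by
  ext x
  simp_rw [besselPot_apply, fourier_besselPot_apply, besselSymbol_add, mul_assoc]

theorem besselPot_add_two (s : ℝ) (F : 𝓢(E, ℂ)) :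
    besselPot (s + 2) F = besselPot s (oneSubLaplacian F) := by
  rw [besselPot_add, oneSubLaplacian_eq]

/-- The heat flow `exp(-t(1 - Δ))`, written as a Gaussian average. -/
def heat (t : ℝ) (G : E → ℂ) (x : E) : ℂ :=
  Real.exp (-t) * ∫ z : E, (((4 * Real.pi) ^ (-(Module.finrank ℝ E / 2 : ℝ)) *
    Real.exp (-(1 / 4) * ‖z‖ ^ 2) : ℝ) : ℂ) * G (x - √t • z)

/-- The multiplication formula `∫ ĝ G = ∫ g Ĝ` for a modulated Gaussian `g`, whose transform is the
heat kernel centred at `x`. -/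
theorem integral_gaussian_fourier {t : ℝ} (ht : 0 < t) (G : 𝓢(E, ℂ)) (x : E) :
    ∫ ξ, Complex.exp (-((4 * Real.pi ^ 2 * t : ℝ) : ℂ) * ‖ξ‖ ^ 2 +
      2 * Real.pi * Complex.I * (inner ℝ x ξ : ℝ)) * 𝓕 G ξ =
    ∫ y, (((4 * Real.pi * t) ^ (-(Module.finrank ℝ E / 2 : ℝ)) *
      Real.exp (-(1 / 4) * (‖x - y‖ ^ 2 / t)) : ℝ) : ℂ) * G y := by
  set g : E → ℂ := fun ξ => Complex.exp (-((4 * Real.pi ^ 2 * t : ℝ) : ℂ) * ‖ξ‖ ^ 2 +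
      2 * Real.pi * Complex.I * (inner ℝ x ξ : ℝ)) with hg
  have hb : 0 < (((4 * Real.pi ^ 2 * t : ℝ) : ℂ)).re := by
    rw [Complex.ofReal_re]; positivity
  have hgi : Integrable g := GaussianFourier.integrable_cexp_neg_mul_sq_norm_add hb _ x
  have h : ∫ ξ, 𝓕 g ξ * G ξ = ∫ ξ, g ξ * 𝓕 (G : E → ℂ) ξ := by
    simpa using! VectorFourier.integral_bilin_fourierIntegral_eq_flip
      (ContinuousLinearMap.mul ℂ ℂ) (L := innerₗ E)
      Real.continuous_fourierChar continuous_inner hgi G.integrable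
  rw [SchwartzMap.fourier_coe, ← h]
  congr 1
  ext y
  congr 1
  rw [hg, fourier_gaussian_innerProductSpace' hb, Complex.ofReal_mul ((4 * Real.pi * t) ^ _)]
  congr 1
  · have h1 : (Real.pi : ℂ) / ((4 * Real.pi ^ 2 * t : ℝ) : ℂ) = (((4 * Real.pi * t)⁻¹ : ℝ) : ℂ) := by
      rw [← Complex.ofReal_div]
      congr 1
      have := Real.pi_pos.ne'
      field_simp
    have h2 : (Module.finrank ℝ E / 2 : ℂ) = ((Module.finrank ℝ E / 2 : ℝ) : ℂ) := by
      push_cast; rfl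
    rw [h1, h2, ← Complex.ofReal_cpow (by positivity), Real.inv_rpow (by positivity),
      Real.rpow_neg (by positivity)]
  · rw [Complex.ofReal_exp]
    congr 1
    push_cast
    have := Real.pi_pos.ne'
    have h3 : (Real.pi : ℂ) ≠ 0 := by exact_mod_cast this
    have h4 : (t : ℂ) ≠ 0 := by exact_mod_cast ht.ne'
    field_simp

/-- Substituting `y = x - √t z` turns the average into convolution with the heat kernel, hence into
the symbol `exp(-t(1 + 4π²|ξ|²))`. -/
theorem heat_eq_integral_fourier {t : ℝ} (ht : 0 < t) (G : 𝓢(E, ℂ)) (x : E) :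
    heat t G x = ∫ ξ, Complex.exp (↑(2 * Real.pi * inner ℝ ξ x) * Complex.I) *
      ((Real.exp (-t * (1 + 4 * Real.pi ^ 2 * ‖ξ‖ ^ 2)) : ℝ) * 𝓕 G ξ) := by
  have h1 := integral_gaussian_fourier ht G x
  have h2 : ∀ ξ : E, Complex.exp (↑(2 * Real.pi * inner ℝ ξ x) * Complex.I) *
      ((Real.exp (-t * (1 + 4 * Real.pi ^ 2 * ‖ξ‖ ^ 2)) : ℝ) * 𝓕 G ξ) =
      Real.exp (-t) * (Complex.exp (-((4 * Real.pi ^ 2 * t : ℝ) : ℂ) * ‖ξ‖ ^ 2 +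
      2 * Real.pi * Complex.I * (inner ℝ x ξ : ℝ)) * 𝓕 G ξ) := by
    intro ξ
    rw [← mul_assoc, ← mul_assoc, Complex.ofReal_exp, Complex.ofReal_exp, ← Complex.exp_add,
      ← Complex.exp_add, real_inner_comm]
    congr 2
    push_cast
    ring
  simp_rw [h2]
  rw [integral_const_mul, h1, heat]
  congr 1
  set K : E → ℂ := fun y => (((4 * Real.pi) ^ (-(Module.finrank ℝ E / 2 : ℝ)) *
      Real.exp (-(1 / 4) * (‖y‖ ^ 2 / t)) : ℝ) : ℂ) * G (x - y) with hK
  have h3 : ∀ z : E, (((4 * Real.pi) ^ (-(Module.finrank ℝ E / 2 : ℝ)) *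
    Real.exp (-(1 / 4) * ‖z‖ ^ 2) : ℝ) : ℂ) * G (x - √t • z) = K (√t • z) := by
    intro z
    simp only [hK, norm_smul, Real.norm_eq_abs, mul_pow, sq_abs, Real.sq_sqrt ht.le]
    rw [mul_div_cancel_left₀ _ ht.ne']
  simp_rw [h3]
  rw [Measure.integral_comp_smul volume K, ← integral_sub_left_eq_self _ _ x, ← integral_smul]
  congr 1
  ext y
  simp only [hK, sub_sub_cancel]
  rw [Complex.real_smul, ← mul_assoc, ← Complex.ofReal_mul]
  congr 2
  rw [← mul_assoc]
  congr 1
  rw [Real.mul_rpow (by positivity) ht.le, mul_comm]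
  congr 1
  rw [abs_of_pos (by positivity), Real.rpow_neg ht.le, Real.sqrt_eq_rpow, ← Real.rpow_natCast,
    ← Real.rpow_mul ht.le]
  congr 2
  ring

end Bessel

/-! ### Fractional powers of `1 - Δ` from the heat flow -/

section Subordination

theorem one_sub_exp_neg_nonneg {y : ℝ} (hy : 0 ≤ y) : 0 ≤ 1 - Real.exp (-y) := by
  rw [sub_nonneg, Real.exp_le_one_iff]
  linarith

theorem one_sub_exp_neg_le (y : ℝ) : 1 - Real.exp (-y) ≤ y := by
  linarith [Real.add_one_le_exp (-y)]

/-- Near zero `1 - exp(-tμ) ≤ tμ` leaves `t^(-α)`, integrable since `α < 1`; at infinity `t^(-α-1)`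
is integrable since `α > 0`. -/
theorem integrableOn_rpow_mul_one_sub_exp {α μ : ℝ} (h0 : 0 < α) (h1 : α < 1) (hμ : 0 < μ) :
    IntegrableOn (fun t : ℝ => t ^ (-α - 1) * (1 - Real.exp (-(t * μ)))) (Set.Ioi 0) := by
  have hm : Measurable (fun t : ℝ => t ^ (-α - 1) * (1 - Real.exp (-(t * μ)))) := by fun_prop
  rw [← Set.Ioc_union_Ioi_eq_Ioi zero_le_one]
  refine IntegrableOn.union ?_ ?_
  · have hi : IntegrableOn (fun t : ℝ => t ^ (-α) * μ) (Set.Ioc 0 1) := by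
      have := (intervalIntegral.intervalIntegrable_rpow' (a := 0) (b := 1) (r := -α)
        (by linarith)).mul_const μ
      rwa [intervalIntegrable_iff_integrableOn_Ioc_of_le zero_le_one] at this
    refine Integrable.mono' hi hm.aestronglyMeasurable ?_
    refine (ae_restrict_iff' measurableSet_Ioc).2 (Filter.Eventually.of_forall fun t ht => ?_)
    have h2 := one_sub_exp_neg_nonneg (mul_pos ht.1 hμ).le
    rw [Real.norm_of_nonneg (mul_nonneg (Real.rpow_nonneg ht.1.le _) h2)]
    calc t ^ (-α - 1) * (1 - Real.exp (-(t * μ))) ≤ t ^ (-α - 1) * (t * μ) := by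
          gcongr
          · exact Real.rpow_nonneg ht.1.le _
          · exact one_sub_exp_neg_le _
      _ = t ^ (-α) * μ := by
          rw [← mul_assoc, Real.rpow_sub_one ht.1.ne', div_mul_cancel₀ _ ht.1.ne']
  · have hi : IntegrableOn (fun t : ℝ => t ^ (-α - 1)) (Set.Ioi 1) :=
      integrableOn_Ioi_rpow_of_lt (by linarith) one_pos
    refine Integrable.mono' hi hm.aestronglyMeasurable ?_
    refine (ae_restrict_iff' measurableSet_Ioi).2 (Filter.Eventually.of_forall fun t ht => ?_)
    have ht0 : 0 < t := one_pos.trans ht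
    have h2 := one_sub_exp_neg_nonneg (mul_pos ht0 hμ).le
    rw [Real.norm_of_nonneg (mul_nonneg (Real.rpow_nonneg ht0.le _) h2)]
    refine mul_le_of_le_one_right (Real.rpow_nonneg ht0.le _) ?_
    linarith [Real.exp_pos (-(t * μ))]

/-- The constant `∫₀^∞ t^(-α-1) (1 - e^(-t)) dt`. -/
def subordinationConst (α : ℝ) : ℝ := ∫ t in Set.Ioi (0 : ℝ), t ^ (-α - 1) * (1 - Real.exp (-t))

theorem subordinationConst_pos {α : ℝ} (h0 : 0 < α) (h1 : α < 1) : 0 < subordinationConst α := by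
  have hi := integrableOn_rpow_mul_one_sub_exp h0 h1 one_pos
  simp only [mul_one] at hi
  rw [subordinationConst, setIntegral_pos_iff_support_of_nonneg_ae _ hi]
  · have : Function.support (fun t : ℝ => t ^ (-α - 1) * (1 - Real.exp (-t))) ∩ Set.Ioi 0 =
        Set.Ioi 0 := by
      refine Set.inter_eq_right.2 fun t (ht : 0 < t) => ?_
      have : Real.exp (-t) < 1 := by
        rw [Real.exp_lt_one_iff]
        linarith
      exact (mul_pos (Real.rpow_pos_of_pos ht _) (by linarith)).ne'
    rw [this]
    simp
  · refine (ae_restrict_iff' measurableSet_Ioi).2 (Filter.Eventually.of_forall fun t ht => ?_)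
    exact mul_nonneg (Real.rpow_nonneg (le_of_lt ht) _) (one_sub_exp_neg_nonneg (le_of_lt ht))

theorem integral_rpow_mul_one_sub_exp (α : ℝ) {μ : ℝ} (hμ : 0 < μ) :
    ∫ t in Set.Ioi (0 : ℝ), t ^ (-α - 1) * (1 - Real.exp (-(t * μ))) =
      μ ^ α * subordinationConst α := by
  have h := integral_comp_mul_right_Ioi
    (fun y : ℝ => y ^ (-α - 1) * (1 - Real.exp (-y))) 0 hμ
  rw [zero_mul, smul_eq_mul] at h
  change _ = μ⁻¹ * subordinationConst α at h
  have h2 : ∫ t in Set.Ioi (0 : ℝ), (t * μ) ^ (-α - 1) * (1 - Real.exp (-(t * μ))) =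
      μ ^ (-α - 1) * ∫ t in Set.Ioi (0 : ℝ), t ^ (-α - 1) * (1 - Real.exp (-(t * μ))) := by
    rw [← integral_const_mul]
    refine setIntegral_congr_fun measurableSet_Ioi fun t (ht : 0 < t) => ?_
    rw [Real.mul_rpow ht.le hμ.le]
    ring
  rw [h2] at h
  have h3 : μ ^ α * (μ * μ ^ (-α - 1)) = 1 := by
    rw [Real.rpow_sub_one hμ.ne', mul_div_cancel₀ _ hμ.ne', ← Real.rpow_add hμ, add_neg_cancel,
      Real.rpow_zero]
  calc _ = (μ ^ α * (μ * μ ^ (-α - 1))) *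
        ∫ t in Set.Ioi (0 : ℝ), t ^ (-α - 1) * (1 - Real.exp (-(t * μ))) := by rw [h3, one_mul]
    _ = μ ^ α * μ * (μ ^ (-α - 1) *
        ∫ t in Set.Ioi (0 : ℝ), t ^ (-α - 1) * (1 - Real.exp (-(t * μ)))) := by ring
    _ = μ ^ α * subordinationConst α := by
        rw [h]
        field_simp

variable {E : Type*} [NormedAddCommGroup E] [InnerProductSpace ℝ E]
  [FiniteDimensional ℝ E] [MeasurableSpace E] [BorelSpace E]

theorem norm_exp_real_mul_I (r : ℝ) : ‖Complex.exp ((r : ℂ) * Complex.I)‖ = 1 :=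
  Complex.norm_exp_ofReal_mul_I r

theorem sub_heat_eq {t : ℝ} (ht : 0 < t) (G : 𝓢(E, ℂ)) (x : E) :
    G x - heat t G x = ∫ ξ, Complex.exp (↑(2 * Real.pi * inner ℝ ξ x) * Complex.I) *
      (((1 - Real.exp (-(t * (1 + 4 * Real.pi ^ 2 * ‖ξ‖ ^ 2))) : ℝ) : ℂ) * 𝓕 G ξ) := by
  have hG : Integrable (fun ξ => 𝓕 G ξ) := (𝓕 G).integrable
  rw [heat_eq_integral_fourier ht, apply_eq_integral_fourier G x, ← integral_sub]
  · congr 1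
    ext ξ
    push_cast
    ring_nf
  · refine hG.norm.mono' (by fun_prop) (Filter.Eventually.of_forall fun ξ => ?_)
    rw [norm_mul, norm_exp_real_mul_I, one_mul]
  · refine hG.norm.mono' (by fun_prop) (Filter.Eventually.of_forall fun ξ => ?_)
    rw [norm_mul, norm_exp_real_mul_I, one_mul, norm_mul]
    refine mul_le_of_le_one_left (norm_nonneg _) ?_
    rw [Complex.norm_real, Real.norm_eq_abs, Real.abs_exp, Real.exp_le_one_iff]
    have : 0 ≤ t * (1 + 4 * Real.pi ^ 2 * ‖ξ‖ ^ 2) := by positivity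
    linarith

/-- Duhamel: `G - exp(-tL) G = ∫₀ᵗ exp(-τL) L G dτ` with `L = 1 - Δ`, checked on the Fourier side.
-/
theorem norm_sub_heat_le {t B : ℝ} (ht : 0 < t) (G : 𝓢(E, ℂ)) (x : E)
    (hB : ∀ τ, 0 < τ → ‖heat τ (oneSubLaplacian G) x‖ ≤ B) :
    ‖G x - heat t G x‖ ≤ t * B := by
  set e : E → ℂ := fun ξ => Complex.exp (↑(2 * Real.pi * inner ℝ ξ x) * Complex.I) with he
  set μ : E → ℝ := fun ξ => 1 + 4 * Real.pi ^ 2 * ‖ξ‖ ^ 2 with hμ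
  have hμpos : ∀ ξ, 0 < μ ξ := fun ξ => by positivity
  have hLG : ∀ ξ, 𝓕 (oneSubLaplacian G) ξ = (μ ξ : ℂ) * 𝓕 G ξ := fun ξ => by
    rw [oneSubLaplacian_eq, fourier_besselPot_apply, besselSymbol_two]
  have hi : Integrable (fun ξ => 𝓕 (oneSubLaplacian G) ξ) := (𝓕 (oneSubLaplacian G)).integrable
  set K : ℝ → E → ℂ := fun τ ξ => e ξ * ((Real.exp (-τ * μ ξ) : ℝ) * 𝓕 (oneSubLaplacian G) ξ)
    with hK
  have hprod : Integrable (Function.uncurry K)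
      ((volume.restrict (Set.Ioc 0 t)).prod (volume : Measure E)) := by
    have h1 : Integrable (fun _ : ℝ => (1 : ℂ)) (volume.restrict (Set.Ioc 0 t)) :=
      integrable_const _
    refine (h1.mul_prod hi).norm.mono' ?_ ?_
    · have : Continuous (Function.uncurry K) := by
        simp only [hK, he, hμ, Function.uncurry_def]
        fun_prop
      exact this.aestronglyMeasurable
    · rw [Measure.ae_prod_iff_ae_ae]
      · refine (ae_restrict_iff' measurableSet_Ioc).2 (Filter.Eventually.of_forall fun τ hτ => ?_)
        refine Filter.Eventually.of_forall fun ξ => ?_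
        simp only [hK, Function.uncurry_apply_pair, one_mul]
        rw [norm_mul, he, norm_exp_real_mul_I, one_mul, norm_mul]
        refine mul_le_of_le_one_left (norm_nonneg _) ?_
        rw [Complex.norm_real, Real.norm_eq_abs, Real.abs_exp, Real.exp_le_one_iff]
        have := mul_pos hτ.1 (hμpos ξ)
        linarith
      · refine measurableSet_le ?_ ?_
        · have : Continuous (Function.uncurry K) := by
            simp only [hK, he, hμ, Function.uncurry_def]
            fun_prop
          fun_prop
        · fun_prop
  have hswap := integral_integral_swap (f := K) hprod
  have h1 : G x - heat t G x = ∫ τ in Set.Ioc 0 t, ∫ ξ, K τ ξ := by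
    rw [hswap, sub_heat_eq ht]
    congr 1
    ext ξ
    have h3 : ∀ τ : ℝ, K τ ξ = (e ξ * 𝓕 G ξ) * ((μ ξ * Real.exp (-(μ ξ * τ)) : ℝ) : ℂ) := by
      intro τ
      simp only [hK]
      rw [hLG]
      push_cast
      ring_nf
    simp_rw [h3]
    rw [integral_const_mul, integral_complex_ofReal,
      ← intervalIntegral.integral_of_le ht.le]
    have h4 : ∫ τ in (0 : ℝ)..t, μ ξ * Real.exp (-(μ ξ * τ)) = 1 - Real.exp (-(t * μ ξ)) := by
      have hd : ∀ τ ∈ Set.uIcc 0 t, HasDerivAt (fun τ : ℝ => -Real.exp (-(μ ξ * τ)))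
          (μ ξ * Real.exp (-(μ ξ * τ))) τ := by
        intro τ _
        have h5 : HasDerivAt (fun τ : ℝ => -(μ ξ * τ)) (-(μ ξ)) τ := by
          have h6 := (hasDerivAt_id τ).const_mul (-(μ ξ))
          simp only [id_eq, mul_one, neg_mul] at h6
          exact h6
        have h7 := h5.exp.neg
        rw [mul_neg, neg_neg, mul_comm] at h7
        exact h7
      rw [intervalIntegral.integral_eq_sub_of_hasDerivAt hd
        (Continuous.intervalIntegrable (by fun_prop) _ _)]
      simp [mul_comm t]
      ring
    rw [h4]
    simp only [he, hμ]
    ring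
  rw [h1, ← intervalIntegral.integral_of_le ht.le]
  have h2 : ∀ τ ∈ Set.uIoc 0 t, ‖∫ ξ, K τ ξ‖ ≤ B := by
    intro τ hτ
    rw [Set.uIoc_of_le ht.le] at hτ
    have := hB τ hτ.1
    rwa [heat_eq_integral_fourier hτ.1] at this
  have h3 := intervalIntegral.norm_integral_le_of_norm_le_const h2
  rwa [sub_zero, abs_of_pos ht, mul_comm] at h3

/-- At each frequency this is `κ μ^α = ∫ t^(-α-1)(1 - exp(-tμ)) dt` with `μ = 1 + 4π²|ξ|²`; Fubini
moves it to the function. -/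
theorem subordination {α : ℝ} (h0 : 0 < α) (h1 : α < 1) (G : 𝓢(E, ℂ)) (x : E) :
    (subordinationConst α : ℂ) * besselPot (2 * α) G x =
      ∫ t in Set.Ioi (0 : ℝ), ((t ^ (-α - 1) : ℝ) : ℂ) * (G x - heat t G x) := by
  set e : E → ℂ := fun ξ => Complex.exp (↑(2 * Real.pi * inner ℝ ξ x) * Complex.I) with he
  set μ : E → ℝ := fun ξ => 1 + 4 * Real.pi ^ 2 * ‖ξ‖ ^ 2 with hμ
  have hμpos : ∀ ξ, 0 < μ ξ := fun ξ => by positivity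
  have hsym : ∀ ξ, besselSymbol (2 * α) ξ = ((μ ξ ^ α : ℝ) : ℂ) := fun ξ => by
    rw [besselSymbol, mul_div_cancel_left₀ _ two_ne_zero]
  set K : ℝ → E → ℂ := fun t ξ =>
    (e ξ * 𝓕 G ξ) * ((t ^ (-α - 1) * (1 - Real.exp (-(t * μ ξ))) : ℝ) : ℂ) with hK
  have hKm : Measurable (Function.uncurry K) := by
    have h2 : Measurable (fun p : ℝ × E => e p.2 * 𝓕 G p.2) := by
      have : Continuous (fun p : ℝ × E => e p.2 * 𝓕 G p.2) := by fun_prop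
      exact this.measurable
    have h3 : Measurable (fun p : ℝ × E => μ p.2) := by
      have : Continuous (fun p : ℝ × E => μ p.2) := by fun_prop
      exact this.measurable
    refine h2.mul (Complex.measurable_ofReal.comp ?_)
    exact (measurable_fst.pow_const _).mul
      (measurable_const.sub (Real.measurable_exp.comp (measurable_fst.mul h3).neg))
  have hb : Integrable (fun ξ => 𝓕 (besselPot (2 * α) G) ξ) := (𝓕 (besselPot (2 * α) G)).integrable
  have hprod : Integrable (Function.uncurry K)
      ((volume.restrict (Set.Ioi 0)).prod (volume : Measure E)) := by
    -- Integrating the modulus in `t` first reproduces a multiple of the modulus of the transform of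
    -- `besselPot (2 * α) G`, a Schwartz function.
    rw [integrable_prod_iff' hKm.aestronglyMeasurable]
    refine ⟨Filter.Eventually.of_forall fun ξ => ?_, ?_⟩
    · exact ((integrableOn_rpow_mul_one_sub_exp h0 h1 (hμpos ξ)).ofReal (𝕜 := ℂ)).const_mul
        (e ξ * 𝓕 G ξ)
    · have : (fun ξ => ∫ t in Set.Ioi (0 : ℝ), ‖Function.uncurry K (t, ξ)‖) =
          fun ξ => subordinationConst α * ‖𝓕 (besselPot (2 * α) G) ξ‖ := by
        ext ξ
        have h3 : ∀ t ∈ Set.Ioi (0 : ℝ), ‖Function.uncurry K (t, ξ)‖ =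
            ‖𝓕 G ξ‖ * (t ^ (-α - 1) * (1 - Real.exp (-(t * μ ξ)))) := by
          intro t ht
          simp only [hK, Function.uncurry_apply_pair]
          rw [norm_mul, norm_mul, he, norm_exp_real_mul_I, one_mul, Complex.norm_real,
            Real.norm_of_nonneg]
          exact mul_nonneg (Real.rpow_nonneg (le_of_lt ht) _)
            (one_sub_exp_neg_nonneg (mul_pos ht (hμpos ξ)).le)
        rw [setIntegral_congr_fun measurableSet_Ioi h3, integral_const_mul,
          integral_rpow_mul_one_sub_exp α (hμpos ξ), fourier_besselPot_apply, hsym, norm_mul,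
          Complex.norm_real, Real.norm_of_nonneg (Real.rpow_nonneg (hμpos ξ).le _)]
        ring
      rw [this]
      exact hb.norm.const_mul _
  have hswap := integral_integral_swap (f := K) hprod
  have h2 : ∀ t ∈ Set.Ioi (0 : ℝ), ((t ^ (-α - 1) : ℝ) : ℂ) * (G x - heat t G x) =
      ∫ ξ, K t ξ := by
    intro t ht
    rw [sub_heat_eq ht, ← integral_const_mul]
    congr 1
    ext ξ
    simp only [hK, he, hμ]
    push_cast
    ring
  rw [setIntegral_congr_fun measurableSet_Ioi h2, hswap, besselPot_apply, ← integral_const_mul]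
  congr 1
  ext ξ
  simp only [hK]
  rw [integral_const_mul, integral_complex_ofReal, integral_rpow_mul_one_sub_exp α (hμpos ξ), hsym]
  simp only [he]
  push_cast
  ring

/-- Interpolation between orders `0` and `2`, at a single point. -/
theorem norm_besselPot_le {α : ℝ} (h0 : 0 < α) (h1 : α < 1) :
    ∃ C : ℝ, 0 < C ∧ ∀ (G : 𝓢(E, ℂ)) (x : E) (B₀ B₁ T : ℝ), 0 < T → ‖G x‖ ≤ B₀ →
      (∀ t, 0 < t → ‖heat t G x‖ ≤ B₀) → (∀ t, 0 < t → ‖heat t (oneSubLaplacian G) x‖ ≤ B₁) →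
      ‖besselPot (2 * α) G x‖ ≤ C * (T ^ (-α) * B₀ + T ^ (1 - α) * B₁) := by
  have hκ := subordinationConst_pos h0 h1
  refine ⟨(subordinationConst α)⁻¹ * (2 / α + 1 / (1 - α)), by
    have : 0 < 1 - α := by linarith
    positivity, fun G x B₀ B₁ T hT hG hG0 hG1 => ?_⟩
  have hB₀ : 0 ≤ B₀ := (norm_nonneg _).trans hG
  have hB₁ : 0 ≤ B₁ := (norm_nonneg _).trans (hG1 1 one_pos)
  have hα1 : 0 < 1 - α := by linarith
  set D : ℝ → ℂ := fun t => ((t ^ (-α - 1) : ℝ) : ℂ) * (G x - heat t G x) with hD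
  -- For `t ≤ T` the Duhamel bound `t B₁` applies, for `t > T` the trivial bound `2 B₀`; the two
  -- pieces integrate to the two terms of the claim.
  set g : ℝ → ℝ := fun t => if t ≤ T then t ^ (-α) * B₁ else t ^ (-α - 1) * (2 * B₀) with hg
  have hi1 : IntegrableOn (fun t : ℝ => t ^ (-α) * B₁) (Set.Ioc 0 T) := by
    have := (intervalIntegral.intervalIntegrable_rpow' (a := 0) (b := T) (r := -α)
        (by linarith)).mul_const B₁
    rwa [intervalIntegrable_iff_integrableOn_Ioc_of_le hT.le] at this
  have hi2 : IntegrableOn (fun t : ℝ => t ^ (-α - 1) * (2 * B₀)) (Set.Ioi T) :=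
    (integrableOn_Ioi_rpow_of_lt (by linarith) hT).mul_const _
  have he1 : Set.EqOn g (fun t : ℝ => t ^ (-α) * B₁) (Set.Ioc 0 T) := fun t ht => if_pos ht.2
  have he2 : Set.EqOn g (fun t : ℝ => t ^ (-α - 1) * (2 * B₀)) (Set.Ioi T) :=
    fun t ht => if_neg (not_le.2 ht)
  have hg1 : IntegrableOn g (Set.Ioc 0 T) := hi1.congr_fun he1.symm measurableSet_Ioc
  have hg2 : IntegrableOn g (Set.Ioi T) := hi2.congr_fun he2.symm measurableSet_Ioi
  have hgi : IntegrableOn g (Set.Ioi 0) := by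
    rw [← Set.Ioc_union_Ioi_eq_Ioi hT.le]
    exact hg1.union hg2
  have hgint : ∫ t in Set.Ioi 0, g t = T ^ (1 - α) / (1 - α) * B₁ + T ^ (-α) / α * (2 * B₀) := by
    rw [← Set.Ioc_union_Ioi_eq_Ioi hT.le,
      setIntegral_union (Set.Ioc_disjoint_Ioi le_rfl) measurableSet_Ioi hg1 hg2,
      setIntegral_congr_fun measurableSet_Ioc he1, setIntegral_congr_fun measurableSet_Ioi he2,
      integral_mul_const, integral_mul_const, integral_Ioi_rpow_of_lt (by linarith) hT,
      ← intervalIntegral.integral_of_le hT.le, integral_rpow (Or.inl (by linarith)),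
      Real.zero_rpow (by linarith)]
    have h3 : -α - 1 + 1 = -α := by ring
    have h4 : -α + 1 = 1 - α := by ring
    rw [h3, h4, sub_zero, neg_div_neg_eq]
  have hle : ‖∫ t in Set.Ioi (0 : ℝ), D t‖ ≤ ∫ t in Set.Ioi 0, g t := by
    refine norm_integral_le_of_norm_le hgi ?_
    refine (ae_restrict_iff' measurableSet_Ioi).2
      (Filter.Eventually.of_forall fun t (ht : 0 < t) => ?_)
    simp only [hD]
    rw [norm_mul, Complex.norm_real, Real.norm_of_nonneg (Real.rpow_nonneg ht.le _)]
    by_cases htT : t ≤ T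
    · rw [hg]
      simp only [if_pos htT]
      calc t ^ (-α - 1) * ‖G x - heat t G x‖ ≤ t ^ (-α - 1) * (t * B₁) := by
            gcongr
            exact norm_sub_heat_le ht G x hG1
        _ = t ^ (-α) * B₁ := by
            rw [← mul_assoc, Real.rpow_sub_one ht.ne', div_mul_cancel₀ _ ht.ne']
    · rw [hg]
      simp only [if_neg htT]
      gcongr
      calc ‖G x - heat t G x‖ ≤ ‖G x‖ + ‖heat t G x‖ := norm_sub_le _ _
        _ ≤ 2 * B₀ := by linarith [hG0 t ht]
  have hs := subordination h0 h1 G x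
  have hn : subordinationConst α * ‖besselPot (2 * α) G x‖ ≤
      T ^ (1 - α) / (1 - α) * B₁ + T ^ (-α) / α * (2 * B₀) := by
    rw [← hgint]
    refine le_trans (le_of_eq ?_) hle
    rw [← hs, norm_mul, Complex.norm_real, Real.norm_of_nonneg hκ.le]
  have hT0 : 0 ≤ T ^ (-α) * B₀ := by positivity
  have hT1 : 0 ≤ T ^ (1 - α) * B₁ := by positivity
  rw [mul_assoc, ← div_eq_inv_mul, le_div_iff₀ hκ, mul_comm]
  refine hn.trans ?_
  have h5 : T ^ (1 - α) / (1 - α) * B₁ + T ^ (-α) / α * (2 * B₀) =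
      (1 / (1 - α)) * (T ^ (1 - α) * B₁) + (2 / α) * (T ^ (-α) * B₀) := by
    field_simp
  rw [h5]
  have h6 : 0 ≤ (1 / (1 - α)) * (T ^ (-α) * B₀) := by positivity
  have h7 : 0 ≤ (2 / α) * (T ^ (1 - α) * B₁) := by positivity
  nlinarith

end Subordination

/-! ### Weighted pointwise bounds for Bessel potentials -/

section Weights

variable {E : Type*} [NormedAddCommGroup E] [InnerProductSpace ℝ E]
  [FiniteDimensional ℝ E] [MeasurableSpace E] [BorelSpace E]

/-- A distance-like function `ρ` whose sublevel sets have codimension `l`: the part of a ball of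
radius `τ` where `ρ ≲ 1 / ν` has relative measure at most `(ν τ)^(-l)`. -/
structure IsThin (ρ : E → ℝ) (l : ℝ) : Prop where
  nonneg : ∀ x, 0 ≤ ρ x
  lip : ∀ x y, ρ x ≤ ρ y + ‖x - y‖
  codim_nonneg : 0 ≤ l
  thin : ∃ M C : ℝ, (Module.finrank ℝ E : ℝ) < M ∧ ∀ (x : E) (τ ν : ℝ), 0 < τ → 0 ≤ ν → 1 ≤ ν * τ →
    ∫ z, (1 + ‖z‖) ^ (-M) * (1 + ν * ρ (x - τ • z)) ^ (-(l + 1)) ≤ C * (ν * τ) ^ (-l)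

/-- The weight `(1 + ν ρ)^(-a) (1 + |x|)^(-b)`. -/
def weight (ρ : E → ℝ) (a b ν : ℝ) (x : E) : ℝ := (1 + ν * ρ x) ^ (-a) * (1 + ‖x‖) ^ (-b)

theorem IsThin.continuous {ρ : E → ℝ} {l : ℝ} (h : IsThin ρ l) : Continuous ρ := by
  have : LipschitzWith 1 ρ := by
    refine LipschitzWith.of_dist_le_mul fun x y => ?_
    rw [NNReal.coe_one, one_mul, Real.dist_eq, dist_eq_norm, abs_sub_le_iff]
    have h1 := h.lip x y
    have h2 := h.lip y x
    rw [norm_sub_rev] at h2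
    constructor <;> linarith
  exact this.continuous

theorem IsThin.one_add_pos {ρ : E → ℝ} {l : ℝ} (h : IsThin ρ l) {ν : ℝ} (hν : 0 ≤ ν) (x : E) :
    1 ≤ 1 + ν * ρ x := by
  have := mul_nonneg hν (h.nonneg x)
  linarith

theorem IsThin.integrable {ρ : E → ℝ} {l M : ℝ} (h : IsThin ρ l)
    (hM : (Module.finrank ℝ E : ℝ) < M) {ν a : ℝ} (hν : 0 ≤ ν) (ha : 0 ≤ a) (x : E) (τ : ℝ) :
    Integrable fun z => (1 + ‖z‖) ^ (-M) * (1 + ν * ρ (x - τ • z)) ^ (-a) := by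
  have h1 : Integrable fun z : E => (1 + ‖z‖) ^ (-M) := integrable_one_add_norm hM
  refine h1.mono' ?_ (Filter.Eventually.of_forall fun z => ?_)
  · refine Continuous.aestronglyMeasurable ?_
    have hc := h.continuous
    refine Continuous.mul ?_ ?_
    · exact Continuous.rpow_const (by fun_prop) fun z => Or.inl (by positivity)
    · refine Continuous.rpow_const (by fun_prop) fun z => Or.inl ?_
      linarith [h.one_add_pos hν (x - τ • z)]
  · have h2 := h.one_add_pos hν (x - τ • z)
    rw [Real.norm_of_nonneg (by positivity)]
    exact mul_le_of_le_one_right (by positivity) (Real.rpow_le_one_of_one_le_of_nonpos h2 (by linarith))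

/-- When `ντ ≤ 1` the set is invisible at scale `τ` and the integral is merely bounded, which the
maximum records. -/
theorem IsThin.exists_integral_le {ρ : E → ℝ} {l : ℝ} (h : IsThin ρ l) :
    ∃ M C : ℝ, (Module.finrank ℝ E : ℝ) < M ∧ 0 < C ∧ ∀ (x : E) (τ ν : ℝ), 0 < τ → 0 ≤ ν →
    ∫ z, (1 + ‖z‖) ^ (-M) * (1 + ν * ρ (x - τ • z)) ^ (-(l + 1)) ≤ C * (max 1 (ν * τ)) ^ (-l) := by
  obtain ⟨M, C, hM, hC⟩ := h.thin
  have hl := h.codim_nonneg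
  refine ⟨M, max C ((∫ z : E, (1 + ‖z‖) ^ (-M)) + 1), hM, ?_, fun x τ ν hτ hν => ?_⟩
  · have : 0 ≤ ∫ z : E, (1 + ‖z‖) ^ (-M) := integral_nonneg fun z => by positivity
    exact lt_max_of_lt_right (by linarith)
  · rcases le_total 1 (ν * τ) with h1 | h1
    · rw [max_eq_right h1]
      refine (hC x τ ν hτ hν h1).trans ?_
      gcongr
      exact le_max_left _ _
    · rw [max_eq_left h1, Real.one_rpow, mul_one]
      refine le_trans ?_ (le_max_right _ _)
      have h2 : ∫ z, (1 + ‖z‖) ^ (-M) * (1 + ν * ρ (x - τ • z)) ^ (-(l + 1)) ≤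
          ∫ z : E, (1 + ‖z‖) ^ (-M) := by
        refine integral_mono (h.integrable hM hν (by linarith) x τ) (integrable_one_add_norm hM)
          fun z => ?_
        refine mul_le_of_le_one_right (by positivity)
          (Real.rpow_le_one_of_one_le_of_nonpos (h.one_add_pos hν _) (by linarith))
      linarith

/-- Use `(1 + r)^K ≤ exp(Kr)` and complete the square. -/
theorem exp_mul_one_add_rpow_le {c K r : ℝ} (hc : 0 < c) (hK : 0 ≤ K) (hr : 0 ≤ r) :
    Real.exp (-c * r ^ 2) * (1 + r) ^ K ≤ Real.exp (K ^ 2 / (4 * c)) := by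
  have h1 : (1 + r) ^ K ≤ Real.exp (K * r) := by
    rw [mul_comm K, Real.exp_mul]
    refine Real.rpow_le_rpow (by positivity) ?_ hK
    linarith [Real.add_one_le_exp r]
  calc Real.exp (-c * r ^ 2) * (1 + r) ^ K ≤ Real.exp (-c * r ^ 2) * Real.exp (K * r) := by gcongr
    _ = Real.exp (-c * r ^ 2 + K * r) := (Real.exp_add _ _).symm
    _ ≤ Real.exp (K ^ 2 / (4 * c)) := by
        rw [Real.exp_le_exp, le_div_iff₀ (by positivity)]
        nlinarith [sq_nonneg (2 * c * r - K)]

theorem rpow_neg_le_of_le_mul {x y k a : ℝ} (hx : 0 < x) (hy : 0 < y) (hk : 0 < k) (ha : 0 ≤ a)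
    (h : x ≤ k * y) : y ^ (-a) ≤ k ^ a * x ^ (-a) := by
  have h1 : x ^ a ≤ k ^ a * y ^ a := by
    rw [← Real.mul_rpow hk.le hy.le]
    exact Real.rpow_le_rpow hx.le h ha
  rw [Real.rpow_neg hx.le, Real.rpow_neg hy.le, ← div_eq_mul_inv, inv_eq_one_div,
    div_le_div_iff₀ (by positivity) (by positivity)]
  linarith

/-- The exponent `2l + 1` splits as `l + (l + 1)`. Moving the power `-l` of `1 + νρ` from `x - √t z`
to `x` costs `max(1, ν√t)^l`, up to powers of `1 + |z|` that the Gaussian absorbs. Averaging the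
power `-(l + 1)` over `z` gains exactly `max(1, ν√t)^(-l)` by thinness, so the bound is uniform in
`t` and `ν`. -/
theorem heat_weight_le {ρ : E → ℝ} {l : ℝ} (h : IsThin ρ l) {b : ℝ} (hb : 0 ≤ b) :
    ∃ C : ℝ, 1 ≤ C ∧ ∀ (G : E → ℂ) (A ν t : ℝ), 0 ≤ A → 0 ≤ ν → 0 < t →
      (∀ y, ‖G y‖ ≤ A * weight ρ (2 * l + 1) b ν y) →
      ∀ x, ‖heat t G x‖ ≤ C * (A * weight ρ l b ν x) := by
  obtain ⟨M, C₀, hM, hC₀, hint⟩ := h.exists_integral_le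
  have hl := h.codim_nonneg
  have hM0 : 0 ≤ M := (Nat.cast_nonneg _).trans hM.le
  set c₀ : ℝ := (4 * Real.pi) ^ (-(Module.finrank ℝ E / 2 : ℝ)) with hc₀
  have hc₀p : 0 < c₀ := by positivity
  set C₁ : ℝ := Real.exp ((l + b + M) ^ 2 / (4 * (1 / 4))) with hC₁
  set C₂ : ℝ := Real.exp (b ^ 2 / (4 * 1)) with hC₂
  refine ⟨max 1 (C₂ * (c₀ * C₁ * C₀)), le_max_left _ _, fun G A ν t hA hν ht hG x => ?_⟩
  set σ := √t with hσ
  have hσp : 0 < σ := Real.sqrt_pos.2 ht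
  set κ := max 1 (ν * σ) with hκ
  have hκ1 : 1 ≤ κ := le_max_left _ _
  have hκp : 0 < κ := one_pos.trans_le hκ1
  have hρx := h.one_add_pos hν x
  have hpt : ∀ z : E, ‖(((4 * Real.pi) ^ (-(Module.finrank ℝ E / 2 : ℝ)) *
      Real.exp (-(1 / 4) * ‖z‖ ^ 2) : ℝ) : ℂ) * G (x - σ • z)‖ ≤
      (c₀ * C₁ * κ ^ l * (1 + σ) ^ b * (A * weight ρ l b ν x)) *
        ((1 + ‖z‖) ^ (-M) * (1 + ν * ρ (x - σ • z)) ^ (-(l + 1))) := by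
    intro z
    have hρz := h.one_add_pos hν (x - σ • z)
    rw [norm_mul, Complex.norm_real, Real.norm_of_nonneg (by positivity)]
    have hnz : ‖x‖ ≤ ‖x - σ • z‖ + σ * ‖z‖ := by
      have := norm_add_le (x - σ • z) (σ • z)
      rwa [sub_add_cancel, norm_smul, Real.norm_of_nonneg hσp.le] at this
    have hρ : ρ x ≤ ρ (x - σ • z) + σ * ‖z‖ := by
      have := h.lip x (x - σ • z)
      rwa [sub_sub_cancel, norm_smul, Real.norm_of_nonneg hσp.le] at this
    have h1 : (1 + ‖x - σ • z‖) ^ (-b) ≤ ((1 + σ) * (1 + ‖z‖)) ^ b * (1 + ‖x‖) ^ (-b) := by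
      refine rpow_neg_le_of_le_mul (by positivity) (by positivity) (by positivity) hb ?_
      have h2 : 0 ≤ σ * ‖z‖ * ‖x - σ • z‖ + σ + ‖z‖ + σ * ‖x - σ • z‖ + ‖z‖ * ‖x - σ • z‖ := by
        positivity
      nlinarith
    have h2 : (1 + ν * ρ (x - σ • z)) ^ (-l) ≤ (κ * (1 + ‖z‖)) ^ l * (1 + ν * ρ x) ^ (-l) := by
      refine rpow_neg_le_of_le_mul (by positivity) (by positivity) (by positivity) hl ?_
      have h3 : ν * ρ x ≤ ν * ρ (x - σ • z) + ν * σ * ‖z‖ := by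
        have := mul_le_mul_of_nonneg_left hρ hν
        linarith
      have h4 : ν * σ * ‖z‖ ≤ κ * ‖z‖ := by
        gcongr
        exact le_max_right _ _
      have h5 : 1 * (1 + ν * ρ (x - σ • z)) ≤ κ * (1 + ν * ρ (x - σ • z)) := by gcongr
      have h6 : 0 ≤ κ * ‖z‖ * (ν * ρ (x - σ • z)) :=
        mul_nonneg (by positivity) (mul_nonneg hν (h.nonneg _))
      nlinarith
    have h3 : Real.exp (-(1 / 4) * ‖z‖ ^ 2) * (1 + ‖z‖) ^ (l + b + M) ≤ C₁ :=
      exp_mul_one_add_rpow_le (by norm_num) (by positivity) (norm_nonneg z)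
    have hsplit : (1 + ν * ρ (x - σ • z)) ^ (-(2 * l + 1)) =
        (1 + ν * ρ (x - σ • z)) ^ (-l) * (1 + ν * ρ (x - σ • z)) ^ (-(l + 1)) := by
      rw [← Real.rpow_add (by positivity)]
      ring_nf
    have hM1 : (1 + ‖z‖) ^ (l + b + M) * (1 + ‖z‖) ^ (-M) = (1 + ‖z‖) ^ l * (1 + ‖z‖) ^ b := by
      rw [← Real.rpow_add (by positivity), ← Real.rpow_add (by positivity)]
      ring_nf
    set γ := Real.exp (-(1 / 4) * ‖z‖ ^ 2) with hγ
    set R := (1 + ν * ρ (x - σ • z)) ^ (-(l + 1)) with hR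
    have hRp : 0 ≤ R := by positivity
    calc c₀ * γ * ‖G (x - σ • z)‖
        ≤ c₀ * γ * (A * (((1 + ν * ρ (x - σ • z)) ^ (-l) * R) * (1 + ‖x - σ • z‖) ^ (-b))) := by
          refine mul_le_mul_of_nonneg_left ?_ (by positivity)
          have := hG (x - σ • z)
          rwa [weight, hsplit] at this
      _ ≤ c₀ * γ * (A * ((((κ * (1 + ‖z‖)) ^ l * (1 + ν * ρ x) ^ (-l)) * R) *
            (((1 + σ) * (1 + ‖z‖)) ^ b * (1 + ‖x‖) ^ (-b)))) := by gcongr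
      _ = (γ * ((1 + ‖z‖) ^ l * (1 + ‖z‖) ^ b)) *
            (c₀ * κ ^ l * (1 + σ) ^ b * (A * weight ρ l b ν x) * R) := by
          rw [Real.mul_rpow hκp.le (by positivity), Real.mul_rpow (by positivity) (by positivity),
            weight]
          ring
      _ = (γ * (1 + ‖z‖) ^ (l + b + M)) *
            (c₀ * κ ^ l * (1 + σ) ^ b * (A * weight ρ l b ν x) * ((1 + ‖z‖) ^ (-M) * R)) := by
          rw [← hM1]
          ring
      _ ≤ C₁ * (c₀ * κ ^ l * (1 + σ) ^ b * (A * weight ρ l b ν x) * ((1 + ‖z‖) ^ (-M) * R)) := by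
          refine mul_le_mul_of_nonneg_right h3 ?_
          rw [weight]
          positivity
      _ = _ := by ring
  have hW : 0 ≤ A * weight ρ l b ν x := by
    rw [weight]
    positivity
  have hI := norm_integral_le_of_norm_le
    ((h.integrable hM hν (by linarith : 0 ≤ l + 1) x σ).const_mul
      (c₀ * C₁ * κ ^ l * (1 + σ) ^ b * (A * weight ρ l b ν x)))
    (Filter.Eventually.of_forall hpt)
  rw [integral_const_mul] at hI
  -- The zeroth-order term of `1 - Δ` supplies `exp(-t) = exp(-σ²)`, which beats the loss `(1 +
  -- σ)^b` in the spatial decay.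
  have hexp : Real.exp (-t) * (1 + σ) ^ b ≤ C₂ := by
    have h3 := exp_mul_one_add_rpow_le one_pos hb hσp.le
    rwa [hσ, neg_one_mul, Real.sq_sqrt ht.le] at h3
  have hκl : κ ^ l * κ ^ (-l) = 1 := by
    rw [← Real.rpow_add hκp, add_neg_cancel, Real.rpow_zero]
  rw [heat, norm_mul, Complex.norm_real, Real.norm_of_nonneg (Real.exp_pos _).le]
  calc Real.exp (-t) * ‖∫ z : E, (((4 * Real.pi) ^ (-(Module.finrank ℝ E / 2 : ℝ)) *
      Real.exp (-(1 / 4) * ‖z‖ ^ 2) : ℝ) : ℂ) * G (x - √t • z)‖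
      ≤ Real.exp (-t) * ((c₀ * C₁ * κ ^ l * (1 + σ) ^ b * (A * weight ρ l b ν x)) *
        (C₀ * κ ^ (-l))) := by
        gcongr
        refine hI.trans ?_
        refine mul_le_mul_of_nonneg_left (hint x σ ν hσp hν) (by positivity)
    _ = (Real.exp (-t) * (1 + σ) ^ b) * ((c₀ * C₁ * C₀) * (κ ^ l * κ ^ (-l)) *
        (A * weight ρ l b ν x)) := by ring
    _ ≤ C₂ * ((c₀ * C₁ * C₀) * (A * weight ρ l b ν x)) := by
        rw [hκl, mul_one]
        gcongr
    _ = C₂ * (c₀ * C₁ * C₀) * (A * weight ρ l b ν x) := by ring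
    _ ≤ _ := by
        gcongr
        exact le_max_right _ _

set_option linter.unusedSectionVars false in
open Laplacian LineDeriv in
theorem norm_iteratedFDeriv_oneSubLaplacian_le (F : 𝓢(E, ℂ)) (q : ℕ) (x : E) :
    ‖iteratedFDeriv ℝ q (oneSubLaplacian F) x‖ ≤ ‖iteratedFDeriv ℝ q F x‖ +
      Module.finrank ℝ E * ‖iteratedFDeriv ℝ (q + 2) F x‖ := by
  have hD : ∀ (G : 𝓢(E, ℂ)) (v : E) (q : ℕ), ‖v‖ = 1 →
      ‖iteratedFDeriv ℝ q (∂_{v} G : 𝓢(E, ℂ)) x‖ ≤ ‖iteratedFDeriv ℝ (q + 1) G x‖ := by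
    intro G v q hv
    have h1 : ((∂_{v} G : 𝓢(E, ℂ)) : E → ℂ) = fun y => fderiv ℝ G y v := by
      ext y
      exact SchwartzMap.lineDerivOp_apply_eq_fderiv v G y
    rw [h1]
    have hs : ContDiff ℝ q (fderiv ℝ G) := (G.smooth (q + 1)).fderiv_right (by norm_cast)
    refine (norm_iteratedFDeriv_clm_apply_const hs.contDiffAt le_rfl).trans ?_
    rw [hv, one_mul, norm_iteratedFDeriv_fderiv]
  have hL : ((oneSubLaplacian F : 𝓢(E, ℂ)) : E → ℂ) =
      (F : E → ℂ) - ((Δ F : 𝓢(E, ℂ)) : E → ℂ) := rfl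
  rw [hL, iteratedFDeriv_sub_apply (F.smooth q).contDiffAt ((Δ F : 𝓢(E, ℂ)).smooth q).contDiffAt]
  refine (norm_sub_le _ _).trans ?_
  gcongr
  set b := stdOrthonormalBasis ℝ E with hbdef
  have h2 : ((Δ F : 𝓢(E, ℂ)) : E → ℂ) =
      fun y => ∑ i, ((∂_{b i} (∂_{b i} F : 𝓢(E, ℂ)) : 𝓢(E, ℂ)) : E → ℂ) y := by
    ext y
    rw [SchwartzMap.laplacian_eq_sum b, sum_apply]
  rw [h2, iteratedFDeriv_fun_sum_apply (fun i _ => (SchwartzMap.smooth _ q).contDiffAt)]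
  refine (norm_sum_le _ _).trans ?_
  refine (Finset.sum_le_sum (g := fun _ => ‖iteratedFDeriv ℝ (q + 2) F x‖) fun i _ => ?_).trans ?_
  · exact (hD _ _ _ (b.norm_eq_one i)).trans (hD _ _ _ (b.norm_eq_one i))
  · simp

theorem weight_nonneg {ρ : E → ℝ} {l : ℝ} (h : IsThin ρ l) (a b : ℝ) {ν : ℝ} (hν : 0 ≤ ν) (x : E) :
    0 ≤ weight ρ a b ν x := by
  have := h.one_add_pos hν x
  rw [weight]
  positivity

theorem weight_le_weight {ρ : E → ℝ} {l : ℝ} (h : IsThin ρ l) {a a' : ℝ} (haa : a ≤ a') (b : ℝ)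
    {ν : ℝ} (hν : 0 ≤ ν) (x : E) : weight ρ a' b ν x ≤ weight ρ a b ν x := by
  have := h.one_add_pos hν x
  rw [weight, weight]
  gcongr

/-- Pointwise bound for Bessel potentials of functions living at scale `1 / ν`. -/
theorem norm_besselPot_le_weight {ρ : E → ℝ} {l : ℝ} (h : IsThin ρ l) {b : ℝ} (hb : 0 ≤ b)
    {s : ℝ} (hs : 0 < s) (Q : ℕ → ℝ) (hQ : ∀ q, 0 ≤ Q q) :
    ∃ C : ℝ, 0 ≤ C ∧ ∀ (ν A : ℝ) (F : 𝓢(E, ℂ)), 1 ≤ ν → 0 ≤ A →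
      (∀ q x, ‖iteratedFDeriv ℝ q F x‖ ≤ A * (Q q * ν ^ q) * weight ρ (2 * l + 1) b ν x) →
      ∀ x, ‖besselPot s F x‖ ≤ C * A * ν ^ s * weight ρ l b ν x := by
  have hl := h.codim_nonneg
  obtain ⟨Ch, hCh, hheat⟩ := heat_weight_le h hb
  have hzero : ∀ (Q : ℕ → ℝ) (ν A : ℝ) (F : 𝓢(E, ℂ)),
      (∀ q x, ‖iteratedFDeriv ℝ q F x‖ ≤ A * (Q q * ν ^ q) * weight ρ (2 * l + 1) b ν x) →
      ∀ x, ‖F x‖ ≤ (A * Q 0) * weight ρ (2 * l + 1) b ν x := by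
    intro Q ν A F hF x
    have := hF 0 x
    rwa [norm_iteratedFDeriv_zero, pow_zero, mul_one] at this
  have hstep : ∀ (Q : ℕ → ℝ), (∀ q, 0 ≤ Q q) → ∀ (ν A : ℝ) (F : 𝓢(E, ℂ)), 1 ≤ ν → 0 ≤ A →
      (∀ q x, ‖iteratedFDeriv ℝ q F x‖ ≤ A * (Q q * ν ^ q) * weight ρ (2 * l + 1) b ν x) →
      ∀ q x, ‖iteratedFDeriv ℝ q (oneSubLaplacian F) x‖ ≤ (A * ν ^ 2) *
        ((Q q + Module.finrank ℝ E * Q (q + 2)) * ν ^ q) * weight ρ (2 * l + 1) b ν x := by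
    intro Q hQ ν A F hν hA hF q x
    have hw := weight_nonneg h (2 * l + 1) b (zero_le_one.trans hν) x
    refine (norm_iteratedFDeriv_oneSubLaplacian_le F q x).trans ?_
    have h1 : A * (Q q * ν ^ q) ≤ A * (Q q * ν ^ q) * ν ^ 2 :=
      le_mul_of_one_le_right (mul_nonneg hA (mul_nonneg (hQ q) (by positivity))) (one_le_pow₀ hν)
    calc ‖iteratedFDeriv ℝ q F x‖ + Module.finrank ℝ E * ‖iteratedFDeriv ℝ (q + 2) F x‖
        ≤ A * (Q q * ν ^ q) * ν ^ 2 * weight ρ (2 * l + 1) b ν x + Module.finrank ℝ E *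
          (A * (Q (q + 2) * ν ^ (q + 2)) * weight ρ (2 * l + 1) b ν x) := by
          gcongr
          · exact (hF q x).trans (mul_le_mul_of_nonneg_right h1 hw)
          · exact hF (q + 2) x
      _ = _ := by ring
  -- Induction on the number of factors `1 - Δ` to peel off. Each one costs `ν²` and preserves the
  -- form of the hypothesis with new constants `Q`, so `Q` is quantified inside the induction.
  have main : ∀ k : ℕ, ∀ s : ℝ, 0 < s → s ≤ 2 * (k + 1) → ∀ Q : ℕ → ℝ, (∀ q, 0 ≤ Q q) →
      ∃ C : ℝ, 0 ≤ C ∧ ∀ (ν A : ℝ) (F : 𝓢(E, ℂ)), 1 ≤ ν → 0 ≤ A →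
      (∀ q x, ‖iteratedFDeriv ℝ q F x‖ ≤ A * (Q q * ν ^ q) * weight ρ (2 * l + 1) b ν x) →
      ∀ x, ‖besselPot s F x‖ ≤ C * A * ν ^ s * weight ρ l b ν x := by
    intro k
    induction k with
    | zero =>
      intro s hs hs2 Q hQ
      set d : ℝ := ((Module.finrank ℝ E : ℕ) : ℝ) with hd
      rcases eq_or_lt_of_le hs2 with h2 | h2
      · have hs' : s = 2 := by simpa using h2
        refine ⟨Q 0 + d * Q 2, add_nonneg (hQ 0) (mul_nonneg (Nat.cast_nonneg _) (hQ 2)),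
          fun ν A F hν hA hF x => ?_⟩
        have hν0 := zero_le_one.trans hν
        have h3 := hzero _ ν _ _ (hstep Q hQ ν A F hν hA hF) x
        rw [hs', ← oneSubLaplacian_eq]
        refine h3.trans (le_trans (mul_le_mul_of_nonneg_left
          (weight_le_weight h (by linarith : l ≤ 2 * l + 1) b hν0 x) ?_) (le_of_eq ?_))
        · exact mul_nonneg (by positivity)
            (add_nonneg (hQ 0) (mul_nonneg (Nat.cast_nonneg _) (hQ 2)))
        · simp only [zero_add, Real.rpow_two]
          ring
      · have hα0 : 0 < s / 2 := by linarith
        have hα1 : s / 2 < 1 := by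
          norm_num at h2
          linarith
        obtain ⟨C, hC, hC'⟩ := norm_besselPot_le (E := E) hα0 hα1
        set Q1 : ℝ := Q 0 + d * Q 2 with hQ1
        have hQ1' : 0 ≤ Q1 := add_nonneg (hQ 0) (mul_nonneg (Nat.cast_nonneg _) (hQ 2))
        refine ⟨C * Ch * (Q 0 + Q1), mul_nonneg (by positivity) (add_nonneg (hQ 0) hQ1'),
          fun ν A F hν hA hF x => ?_⟩
        have hνp : 0 < ν := one_pos.trans_le hν
        have hw := weight_nonneg h l b hνp.le x
        have hA0 : 0 ≤ A * Q 0 := mul_nonneg hA (hQ 0)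
        have hA1 : 0 ≤ A * ν ^ 2 * Q1 := by positivity
        have hF0 := hzero Q ν A F hF
        have hF1 := hzero _ ν _ _ (hstep Q hQ ν A F hν hA hF)
        -- The bound `B₁` exceeds `B₀` by a factor of order `ν²`, so `T = ν⁻²` balances the two
        -- terms at `ν^s`.
        have h3 := hC' F x (Ch * (A * Q 0 * weight ρ l b ν x))
          (Ch * (A * ν ^ 2 * Q1 * weight ρ l b ν x)) (ν ^ (-2 : ℝ)) (by positivity) ?_
          (fun t ht => hheat F _ ν t hA0 hνp.le ht hF0 x)
          (fun t ht => hheat _ _ ν t hA1 hνp.le ht hF1 x)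
        · rw [mul_div_cancel₀ _ two_ne_zero] at h3
          refine h3.trans (le_of_eq ?_)
          rw [← Real.rpow_mul hνp.le, ← Real.rpow_mul hνp.le]
          have e1 : (-2 : ℝ) * -(s / 2) = s := by ring
          have e2 : (-2 : ℝ) * (1 - s / 2) = s - 2 := by ring
          have e3 : ν ^ (s - 2) * ν ^ 2 = ν ^ s := by
            rw [← Real.rpow_natCast, ← Real.rpow_add hνp]
            norm_num
          rw [e1, e2]
          calc _ = C * Ch * (ν ^ s * (A * Q 0 * weight ρ l b ν x) +
                (ν ^ (s - 2) * ν ^ 2) * (A * Q1 * weight ρ l b ν x)) := by ring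
            _ = _ := by
                rw [e3]
                ring
        · refine (hF0 x).trans ?_
          have h4 : A * Q 0 * weight ρ (2 * l + 1) b ν x ≤ A * Q 0 * weight ρ l b ν x :=
            mul_le_mul_of_nonneg_left (weight_le_weight h (by linarith) b hνp.le x) hA0
          exact h4.trans (le_mul_of_one_le_left (by positivity) hCh)
    | succ k ih =>
      intro s hs hs2 Q hQ
      rcases le_or_gt s (2 * (k + 1)) with h2 | h2
      · exact ih s hs h2 Q hQ
      · have hk : (0 : ℝ) ≤ k := Nat.cast_nonneg _
        push_cast at hs2
        obtain ⟨C, hC, hC'⟩ := ih (s - 2) (by linarith) (by linarith)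
          (fun q => Q q + Module.finrank ℝ E * Q (q + 2))
          (fun q => add_nonneg (hQ q) (mul_nonneg (Nat.cast_nonneg _) (hQ _)))
        refine ⟨C, hC, fun ν A F hν hA hF x => ?_⟩
        have hνp : 0 < ν := one_pos.trans_le hν
        have h3 := hC' ν (A * ν ^ 2) (oneSubLaplacian F) hν (by positivity)
          (hstep Q hQ ν A F hν hA hF) x
        rw [← besselPot_add_two, sub_add_cancel] at h3
        refine h3.trans (le_of_eq ?_)
        have e3 : ν ^ (s - 2) * ν ^ 2 = ν ^ s := by
          rw [← Real.rpow_natCast, ← Real.rpow_add hνp]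
          norm_num
        rw [← e3]
        ring
  obtain ⟨k, hk⟩ := exists_nat_ge s
  exact main k s hs (by linarith) Q hQ

end Weights

/-! ### Sobolev norms of lacunary sums and of oscillating functions -/

section Lacunary

theorem eLpNorm_le_of_norm_rpow_le {X : Type*} [MeasurableSpace X] {μ : Measure X} {u : ℝ}
    (hu : 0 < u) {f : X → ℂ} {g : X → ℝ} {B : ℝ} (hg : Integrable g μ)
    (h : ∀ x, ‖f x‖ ^ u ≤ g x) (hB : ∫ x, g x ∂μ ≤ B) :
    eLpNorm f (ENNReal.ofReal u) μ ≤ ENNReal.ofReal (B ^ (1 / u)) := by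
  have hg0 : ∀ x, 0 ≤ g x := fun x => (Real.rpow_nonneg (norm_nonneg _) _).trans (h x)
  have hB0 : 0 ≤ B := (integral_nonneg hg0).trans hB
  rw [eLpNorm_eq_lintegral_rpow_enorm_toReal (by simpa using hu) ENNReal.ofReal_ne_top,
    ENNReal.toReal_ofReal hu.le, ← ENNReal.ofReal_rpow_of_nonneg hB0 (by positivity)]
  refine ENNReal.rpow_le_rpow ?_ (by positivity)
  calc ∫⁻ x, ‖f x‖ₑ ^ u ∂μ ≤ ∫⁻ x, ENNReal.ofReal (g x) ∂μ := by
        refine lintegral_mono fun x => ?_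
        rw [← ofReal_norm, ENNReal.ofReal_rpow_of_nonneg (norm_nonneg _) hu.le]
        exact ENNReal.ofReal_le_ofReal (h x)
    _ = ENNReal.ofReal (∫ x, g x ∂μ) :=
        (ofReal_integral_eq_lintegral_ofReal hg (Filter.Eventually.of_forall hg0)).symm
    _ ≤ ENNReal.ofReal B := ENNReal.ofReal_le_ofReal hB

/-- The index `J` marks the scale `2^J ~ 1/r`, truncated at `N`; the sums below peak there. -/
theorem exists_dyadic_threshold (r : ℝ) (N : ℕ) :
    ∃ J ≤ N, (∀ j < J, (2 : ℝ) ^ j * r ≤ 1) ∧ (J = N ∨ 1 < (2 : ℝ) ^ J * r) := by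
  induction N with
  | zero => exact ⟨0, le_rfl, by simp, Or.inl rfl⟩
  | succ N ih =>
    obtain ⟨J, hJ, h1, h2⟩ := ih
    rcases h2 with h2 | h2
    · rcases le_or_gt ((2 : ℝ) ^ N * r) 1 with h3 | h3
      · refine ⟨N + 1, le_rfl, fun j hj => ?_, Or.inl rfl⟩
        rcases Nat.lt_succ_iff_lt_or_eq.1 hj with h4 | h4
        · exact h1 j (h2 ▸ h4)
        · exact h4 ▸ h3
      · exact ⟨N, Nat.le_succ N, fun j hj => h1 j (h2 ▸ hj), Or.inr h3⟩
    · exact ⟨J, hJ.trans (Nat.le_succ N), h1, Or.inr h2⟩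

/-- The left sum grows geometrically up to the scale `2^J ~ 1/r` and decays geometrically after it,
because `0 < l/u < l`. It is therefore comparable to its peak `2^(Jl/u)`, whose `u`-th power
`2^(Jl)` is controlled by a single term on the right. This replaces an `ℓ¹` sum by an `ℓ^u` sum and
yields `N^(1/u)` rather than `N` later. -/
theorem dyadic_sum_rpow_le {l u : ℝ} (hl : 0 < l) (hu : 1 < u) :
    ∃ C : ℝ, 0 ≤ C ∧ ∀ (r : ℝ) (N : ℕ), 0 ≤ r →
      (∑ j ∈ Finset.range N, ((2 : ℝ) ^ j) ^ (l / u) * (1 + 2 ^ j * r) ^ (-l)) ^ u ≤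
        C * (1 + ∑ j ∈ Finset.range N, ((2 : ℝ) ^ j) ^ l * (1 + 2 ^ j * r) ^ (-(l + 1))) := by
  have hu0 : 0 < u := by linarith
  set θ := l / u with hθ
  have hθ0 : 0 < θ := by positivity
  have hθl : θ < l := div_lt_self hl hu
  set q : ℝ := 2 ^ θ with hq
  set q' : ℝ := 2 ^ (θ - l) with hq'
  have hq1 : 1 < q := Real.one_lt_rpow one_lt_two hθ0
  have hq'0 : 0 < q' := by positivity
  have hq'1 : q' < 1 := Real.rpow_lt_one_of_one_lt_of_neg one_lt_two (by linarith)
  have hpow : ∀ (j : ℕ) (t : ℝ), ((2 : ℝ) ^ j) ^ t = ((2 : ℝ) ^ t) ^ j := by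
    intro j t
    rw [← Real.rpow_natCast, ← Real.rpow_natCast, ← Real.rpow_mul zero_le_two,
      ← Real.rpow_mul zero_le_two, mul_comm]
  set C₁ : ℝ := 1 / (q - 1) + 1 / (1 - q') with hC₁
  have hC₁0 : 0 ≤ C₁ := by
    have h1 : 0 < q - 1 := by linarith
    have h2 : 0 < 1 - q' := by linarith
    positivity
  refine ⟨C₁ ^ u * (2 ^ l * 2 ^ (l + 1)), by positivity, fun r N hr => ?_⟩
  obtain ⟨J, hJN, hJ1, hJ2⟩ := exists_dyadic_threshold r N
  have hpos : ∀ j : ℕ, 0 < 1 + (2 : ℝ) ^ j * r := fun j => by positivity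
  have hnear : ∑ j ∈ Finset.range J, ((2 : ℝ) ^ j) ^ θ * (1 + 2 ^ j * r) ^ (-l) ≤
      q ^ J / (q - 1) := by
    calc ∑ j ∈ Finset.range J, ((2 : ℝ) ^ j) ^ θ * (1 + 2 ^ j * r) ^ (-l)
        ≤ ∑ j ∈ Finset.range J, q ^ j := by
          refine Finset.sum_le_sum fun j _ => ?_
          rw [hpow]
          refine mul_le_of_le_one_right (by positivity)
            (Real.rpow_le_one_of_one_le_of_nonpos ?_ (by linarith))
          have : 0 ≤ (2 : ℝ) ^ j * r := by positivity
          linarith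
      _ = (q ^ J - 1) / (q - 1) := geom_sum_eq hq1.ne' J
      _ ≤ q ^ J / (q - 1) := by
          refine div_le_div_of_nonneg_right (by linarith) (by linarith)
  have hfar : ∑ j ∈ Finset.Ico J N, ((2 : ℝ) ^ j) ^ θ * (1 + 2 ^ j * r) ^ (-l) ≤
      q ^ J / (1 - q') := by
    rcases hJ2 with h2 | h2
    · rw [h2, Finset.Ico_self, Finset.sum_empty]
      have : 0 < 1 - q' := by linarith
      positivity
    · have hr0 : 0 < r := by
        by_contra h3
        have : r = 0 := le_antisymm (not_lt.1 h3) hr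
        rw [this, mul_zero] at h2
        linarith
      calc ∑ j ∈ Finset.Ico J N, ((2 : ℝ) ^ j) ^ θ * (1 + 2 ^ j * r) ^ (-l)
          ≤ ∑ j ∈ Finset.Ico J N, ((2 : ℝ) ^ J) ^ l * q' ^ j := by
            refine Finset.sum_le_sum fun j _ => ?_
            have h3 : (1 + (2 : ℝ) ^ j * r) ^ (-l) ≤ ((2 : ℝ) ^ J) ^ l * ((2 : ℝ) ^ j) ^ (-l) := by
              refine rpow_neg_le_of_le_mul (by positivity) (hpos j) (by positivity) hl.le ?_
              calc (2 : ℝ) ^ j ≤ 2 ^ j * (2 ^ J * r) := le_mul_of_one_le_right (by positivity) h2.le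
                _ ≤ 2 ^ J * (1 + 2 ^ j * r) := by
                    have : (0 : ℝ) < 2 ^ J := by positivity
                    linarith
            calc ((2 : ℝ) ^ j) ^ θ * (1 + 2 ^ j * r) ^ (-l)
                ≤ ((2 : ℝ) ^ j) ^ θ * (((2 : ℝ) ^ J) ^ l * ((2 : ℝ) ^ j) ^ (-l)) := by gcongr
              _ = ((2 : ℝ) ^ J) ^ l * q' ^ j := by
                  rw [hq', ← hpow, sub_eq_add_neg, Real.rpow_add (by positivity)]
                  ring
        _ = ((2 : ℝ) ^ J) ^ l * ∑ j ∈ Finset.Ico J N, q' ^ j := by rw [Finset.mul_sum]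
        _ ≤ ((2 : ℝ) ^ J) ^ l * (q' ^ J / (1 - q')) := by
            gcongr
            exact geom_sum_Ico_le_of_lt_one hq'0.le hq'1
        _ = q ^ J / (1 - q') := by
            rw [hpow, ← mul_div_assoc, ← mul_pow, hq', hq, ← Real.rpow_add two_pos]
            ring_nf
  have hsum : ∑ j ∈ Finset.range N, ((2 : ℝ) ^ j) ^ θ * (1 + 2 ^ j * r) ^ (-l) ≤ C₁ * q ^ J := by
    rw [Finset.range_eq_Ico, ← Finset.sum_Ico_consecutive _ (Nat.zero_le J) hJN,
      ← Finset.range_eq_Ico]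
    calc _ ≤ q ^ J / (q - 1) + q ^ J / (1 - q') := add_le_add hnear hfar
      _ = C₁ * q ^ J := by rw [hC₁]; ring
  have hterm : ∀ j, 0 ≤ ((2 : ℝ) ^ j) ^ l * (1 + 2 ^ j * r) ^ (-(l + 1)) := fun j => by
    have := hpos j
    positivity
  have hqJ : (q ^ J) ^ u = ((2 : ℝ) ^ l) ^ J := by
    rw [← Real.rpow_natCast, ← Real.rpow_natCast, hq, ← Real.rpow_mul zero_le_two,
      ← Real.rpow_mul zero_le_two, ← Real.rpow_mul zero_le_two]
    congr 1
    rw [hθ]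
    field_simp
  have hlast : ((2 : ℝ) ^ l) ^ J ≤ 2 ^ l * 2 ^ (l + 1) *
      (1 + ∑ j ∈ Finset.range N, ((2 : ℝ) ^ j) ^ l * (1 + 2 ^ j * r) ^ (-(l + 1))) := by
    have h2l : (1 : ℝ) ≤ 2 ^ l := Real.one_le_rpow one_le_two hl.le
    have h2l1 : (1 : ℝ) ≤ 2 ^ (l + 1) := Real.one_le_rpow one_le_two (by linarith)
    cases J with
    | zero =>
      have h3 := Finset.sum_nonneg fun j (_ : j ∈ Finset.range N) => hterm j
      rw [pow_zero]
      nlinarith [mul_le_mul h2l h2l1 zero_le_one (by positivity)]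
    | succ J =>
      -- Here `J` is the predecessor of the threshold, so `2^J r ≤ 1` and this one term dominates. A
      -- threshold equal to zero is covered by the summand `1`.
      have h3 : ((2 : ℝ) ^ J) ^ l * (1 + 2 ^ J * r) ^ (-(l + 1)) ≤
          ∑ j ∈ Finset.range N, ((2 : ℝ) ^ j) ^ l * (1 + 2 ^ j * r) ^ (-(l + 1)) :=
        Finset.single_le_sum (f := fun j => ((2 : ℝ) ^ j) ^ l * (1 + 2 ^ j * r) ^ (-(l + 1)))
          (fun j _ => hterm j) (Finset.mem_range.2 hJN)
      have h4 : (2 : ℝ) ^ (-(l + 1)) ≤ (1 + 2 ^ J * r) ^ (-(l + 1)) := by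
        refine Real.rpow_le_rpow_of_nonpos (hpos J) ?_ (by linarith)
        linarith [hJ1 J (Nat.lt_succ_self J)]
      have h5 : (2 : ℝ) ^ (l + 1) * 2 ^ (-(l + 1)) = 1 := by
        rw [← Real.rpow_add two_pos, add_neg_cancel, Real.rpow_zero]
      calc ((2 : ℝ) ^ l) ^ (J + 1) = 2 ^ l * (2 ^ (l + 1) * (((2 : ℝ) ^ J) ^ l * 2 ^ (-(l + 1)))) := by
            rw [hpow J, pow_succ]
            linear_combination (-((2 : ℝ) ^ l) ^ J * 2 ^ l) * h5
        _ ≤ 2 ^ l * (2 ^ (l + 1) * (((2 : ℝ) ^ J) ^ l * (1 + 2 ^ J * r) ^ (-(l + 1)))) := by gcongr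
        _ ≤ 2 ^ l * (2 ^ (l + 1) * (1 + ∑ j ∈ Finset.range N,
              ((2 : ℝ) ^ j) ^ l * (1 + 2 ^ j * r) ^ (-(l + 1)))) := by
            gcongr
            linarith
        _ = _ := by ring
  calc (∑ j ∈ Finset.range N, ((2 : ℝ) ^ j) ^ θ * (1 + 2 ^ j * r) ^ (-l)) ^ u
      ≤ (C₁ * q ^ J) ^ u := by
        refine Real.rpow_le_rpow (Finset.sum_nonneg fun j _ => ?_) hsum hu0.le
        have := hpos j
        positivity
    _ = C₁ ^ u * ((2 : ℝ) ^ l) ^ J := by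
        rw [Real.mul_rpow hC₁0 (by positivity), hqJ]
    _ ≤ _ := by
        rw [mul_assoc]
        gcongr

variable {E : Type*} [NormedAddCommGroup E] [InnerProductSpace ℝ E]
  [FiniteDimensional ℝ E] [MeasurableSpace E] [BorelSpace E]

/-- `L^u` bound for the Bessel potential of a lacunary sum. -/
theorem eLpNorm_besselPot_lacunary_le {ρ : E → ℝ} {l : ℝ} (h : IsThin ρ l) (hl : 0 < l)
    {u : ℝ} (hu : 1 < u) {s : ℝ} (hs : 0 < s) : ∃ b : ℝ, 0 ≤ b ∧ ∀ (Q : ℕ → ℝ), (∀ q, 0 ≤ Q q) →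
    ∃ C : ℝ, 0 ≤ C ∧ ∀ (N : ℕ) (A : ℝ) (c : ℕ → ℂ) (F : ℕ → 𝓢(E, ℂ)), 1 ≤ N → 0 ≤ A →
      (∀ j, ‖c j‖ * ((2 : ℝ) ^ j) ^ s ≤ A * ((2 : ℝ) ^ j) ^ (l / u)) →
      (∀ j q x, ‖iteratedFDeriv ℝ q (F j) x‖ ≤
        Q q * ((2 : ℝ) ^ j) ^ q * weight ρ (2 * l + 1) b (2 ^ j) x) →
      eLpNorm (besselPot s (∑ j ∈ Finset.range N, c j • F j)) (ENNReal.ofReal u) volume ≤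
        ENNReal.ofReal (C * A * (N : ℝ) ^ (1 / u)) := by
  have hu0 : 0 < u := by linarith
  obtain ⟨M, C₀, hM, hC₀, hint⟩ := h.exists_integral_le
  have hM0 : 0 < M := (Nat.cast_nonneg _).trans_lt hM
  obtain ⟨C₂, hC₂, hdy⟩ := dyadic_sum_rpow_le hl hu
  -- After taking the `u`-th power the spatial decay becomes `(1 + |x|)^(-M)`, the weight in the
  -- thinness integral.
  refine ⟨M / u, by positivity, fun Q hQ => ?_⟩
  obtain ⟨C₁, hC₁, hpt⟩ := norm_besselPot_le_weight h (b := M / u) (by positivity) hs Q hQ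
  set I₀ : ℝ := ∫ x : E, (1 + ‖x‖) ^ (-M) with hI₀
  have hI₀0 : 0 ≤ I₀ := integral_nonneg fun x => by positivity
  refine ⟨C₁ * (C₂ * (I₀ + C₀)) ^ (1 / u), by positivity, fun N A c F hN hA hc hF => ?_⟩
  set t : ℕ → E → ℝ := fun j x =>
    ((2 : ℝ) ^ j) ^ l * ((1 + ‖x‖) ^ (-M) * (1 + 2 ^ j * ρ x) ^ (-(l + 1))) with ht
  have hti : ∀ j, Integrable (t j) ∧ ∫ x, t j x ≤ C₀ := by
    intro j
    have h2 : (0 : ℝ) < 2 ^ j := by positivity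
    have h1 := h.integrable hM h2.le (by linarith : 0 ≤ l + 1) 0 (-1)
    -- Thinness at scale one around the origin: each normalised dyadic piece has integral bounded
    -- independently of `j`.
    have h3 := hint 0 1 (2 ^ j) one_pos h2.le
    have h4 : ∫ z : E, (1 + ‖z‖) ^ (-M) * (1 + 2 ^ j * ρ (0 - (1 : ℝ) • z)) ^ (-(l + 1)) =
        ∫ z : E, (1 + ‖z‖) ^ (-M) * (1 + 2 ^ j * ρ z) ^ (-(l + 1)) := by
      rw [← integral_neg_eq_self]
      simp
    have hmax : max 1 ((2 : ℝ) ^ j * 1) = 2 ^ j := by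
      rw [mul_one]
      exact max_eq_right (one_le_pow₀ one_le_two)
    rw [h4, hmax] at h3
    simp only [neg_smul, one_smul, zero_sub, neg_neg] at h1
    refine ⟨h1.const_mul _, ?_⟩
    simp only [ht]
    rw [integral_const_mul]
    calc _ ≤ ((2 : ℝ) ^ j) ^ l * (C₀ * ((2 : ℝ) ^ j) ^ (-l)) := by gcongr
      _ = C₀ * (((2 : ℝ) ^ j) ^ l * ((2 : ℝ) ^ j) ^ (-l)) := by ring
      _ = C₀ := by rw [← Real.rpow_add h2, add_neg_cancel, Real.rpow_zero, mul_one]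
  have hi0 : Integrable fun x : E => (1 + ‖x‖) ^ (-M) := integrable_one_add_norm hM
  have hgi : Integrable fun x => (C₁ * A) ^ u * C₂ *
      ((1 + ‖x‖) ^ (-M) + ∑ j ∈ Finset.range N, t j x) :=
    (hi0.add (integrable_finsetSum _ fun j _ => (hti j).1)).const_mul _
  have hfin : C₁ * (C₂ * (I₀ + C₀)) ^ (1 / u) * A * (N : ℝ) ^ (1 / u) =
      ((C₁ * A) ^ u * C₂ * (I₀ + C₀) * N) ^ (1 / u) := by
    have e : ∀ X : ℝ, 0 ≤ X → ((C₁ * A) ^ u * X * N) ^ (1 / u) =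
        C₁ * A * X ^ (1 / u) * (N : ℝ) ^ (1 / u) := by
      intro X hX
      rw [Real.mul_rpow (by positivity) (by positivity), Real.mul_rpow (by positivity) hX,
        ← Real.rpow_mul (by positivity), mul_one_div_cancel hu0.ne', Real.rpow_one]
    rw [mul_assoc _ C₂, e _ (by positivity)]
    ring
  rw [hfin]
  refine eLpNorm_le_of_norm_rpow_le hu0 hgi (fun x => ?_) ?_
  · have hρ := h.nonneg x
    have hw : ∀ j : ℕ, 0 ≤ weight ρ l (M / u) (2 ^ j) x := fun j =>
      weight_nonneg h _ _ (by positivity) x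
    have h1 : ‖besselPot s (∑ j ∈ Finset.range N, c j • F j) x‖ ≤ (C₁ * A) *
        (∑ j ∈ Finset.range N, ((2 : ℝ) ^ j) ^ (l / u) * (1 + 2 ^ j * ρ x) ^ (-l)) *
          (1 + ‖x‖) ^ (-(M / u)) := by
      rw [besselPot_sum, sum_apply, Finset.mul_sum, Finset.sum_mul]
      refine (norm_sum_le _ _).trans (Finset.sum_le_sum fun j _ => ?_)
      have hν : (1 : ℝ) ≤ 2 ^ j := one_le_pow₀ one_le_two
      have h2 := hpt (2 ^ j) 1 (F j) hν zero_le_one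
        (fun q x => by rw [one_mul]; exact hF j q x) x
      rw [besselPot_smul, smul_apply, norm_smul]
      calc ‖c j‖ * ‖besselPot s (F j) x‖
          ≤ ‖c j‖ * (C₁ * 1 * ((2 : ℝ) ^ j) ^ s * weight ρ l (M / u) (2 ^ j) x) := by gcongr
        _ = C₁ * (‖c j‖ * ((2 : ℝ) ^ j) ^ s) * weight ρ l (M / u) (2 ^ j) x := by ring
        _ ≤ C₁ * (A * ((2 : ℝ) ^ j) ^ (l / u)) * weight ρ l (M / u) (2 ^ j) x := by
            exact mul_le_mul_of_nonneg_right (mul_le_mul_of_nonneg_left (hc j) hC₁) (hw j)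
        _ = _ := by
            rw [weight]
            ring
    have hS : 0 ≤ ∑ j ∈ Finset.range N, ((2 : ℝ) ^ j) ^ (l / u) * (1 + 2 ^ j * ρ x) ^ (-l) :=
      Finset.sum_nonneg fun j _ => by positivity
    calc ‖besselPot s (∑ j ∈ Finset.range N, c j • F j) x‖ ^ u
        ≤ ((C₁ * A) * (∑ j ∈ Finset.range N, ((2 : ℝ) ^ j) ^ (l / u) * (1 + 2 ^ j * ρ x) ^ (-l)) *
          (1 + ‖x‖) ^ (-(M / u))) ^ u := Real.rpow_le_rpow (norm_nonneg _) h1 hu0.le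
      _ = (C₁ * A) ^ u * (∑ j ∈ Finset.range N, ((2 : ℝ) ^ j) ^ (l / u) *
          (1 + 2 ^ j * ρ x) ^ (-l)) ^ u * (1 + ‖x‖) ^ (-M) := by
          rw [Real.mul_rpow (by positivity) (by positivity), Real.mul_rpow (by positivity) hS,
            ← Real.rpow_mul (by positivity), neg_mul, div_mul_cancel₀ _ hu0.ne']
      _ ≤ (C₁ * A) ^ u * (C₂ * (1 + ∑ j ∈ Finset.range N, ((2 : ℝ) ^ j) ^ l *
          (1 + 2 ^ j * ρ x) ^ (-(l + 1)))) * (1 + ‖x‖) ^ (-M) := by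
          gcongr
          exact hdy (ρ x) N hρ
      _ = (C₁ * A) ^ u * C₂ * ((1 + ‖x‖) ^ (-M) + ∑ j ∈ Finset.range N, t j x) := by
          have : ∑ j ∈ Finset.range N, t j x = (1 + ‖x‖) ^ (-M) *
              ∑ j ∈ Finset.range N, ((2 : ℝ) ^ j) ^ l * (1 + 2 ^ j * ρ x) ^ (-(l + 1)) := by
            rw [Finset.mul_sum]
            refine Finset.sum_congr rfl fun j _ => ?_
            simp only [ht]
            ring
          rw [this]
          ring
  · rw [integral_const_mul, integral_add hi0 (integrable_finsetSum _ fun j _ => (hti j).1),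
      integral_finsetSum _ fun j _ => (hti j).1, mul_assoc _ (I₀ + C₀)]
    refine mul_le_mul_of_nonneg_left ?_ (by positivity)
    have h1 : ∑ j ∈ Finset.range N, ∫ x, t j x ≤ N * C₀ := by
      refine (Finset.sum_le_sum fun j _ => (hti j).2).trans (le_of_eq ?_)
      simp
    have h2 : (1 : ℝ) ≤ N := by exact_mod_cast hN
    nlinarith

/-- Codimension zero means no concentration: the weight reduces to `(1 + |x|)^(-b)`, as needed for
functions that oscillate everywhere. -/
theorem isThin_zero : IsThin (fun _ : E => (0 : ℝ)) 0 where
  nonneg _ := le_rfl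
  lip x y := by simp
  codim_nonneg := le_rfl
  thin := ⟨Module.finrank ℝ E + 1, ∫ z : E, (1 + ‖z‖) ^ (-(Module.finrank ℝ E + 1 : ℝ)), by simp,
    fun x τ ν _ _ _ => by simp⟩

/-- `L^u` bound for the Bessel potential of a function oscillating at frequency `ν`. -/
theorem eLpNorm_besselPot_oscillating_le {u : ℝ} (hu : 1 < u) {s : ℝ} (hs : 0 < s) :
    ∃ b : ℝ, 0 ≤ b ∧ ∀ (Q : ℕ → ℝ), (∀ q, 0 ≤ Q q) →
    ∃ C : ℝ, 0 ≤ C ∧ ∀ (ν : ℝ) (F : 𝓢(E, ℂ)), 1 ≤ ν →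
      (∀ q x, ‖iteratedFDeriv ℝ q F x‖ ≤ Q q * ν ^ q * (1 + ‖x‖) ^ (-b)) →
      eLpNorm (besselPot s F) (ENNReal.ofReal u) volume ≤ ENNReal.ofReal (C * ν ^ s) := by
  have hu0 : 0 < u := by linarith
  set M : ℝ := Module.finrank ℝ E + 1 with hM
  have hM0 : 0 < M := by positivity
  refine ⟨M / u, by positivity, fun Q hQ => ?_⟩
  obtain ⟨C₁, hC₁, hpt⟩ := norm_besselPot_le_weight (isThin_zero (E := E)) (b := M / u)
    (by positivity) hs Q hQ
  have hi0 : Integrable fun x : E => (1 + ‖x‖) ^ (-M) := integrable_one_add_norm (by simp [hM])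
  set I₀ : ℝ := ∫ x : E, (1 + ‖x‖) ^ (-M) with hI₀
  have hI₀0 : 0 ≤ I₀ := integral_nonneg fun x => by positivity
  refine ⟨C₁ * I₀ ^ (1 / u), by positivity, fun ν F hν hF => ?_⟩
  have hν0 : 0 < ν := by linarith
  have hfin : C₁ * I₀ ^ (1 / u) * ν ^ s = ((C₁ * ν ^ s) ^ u * I₀) ^ (1 / u) := by
    rw [Real.mul_rpow (by positivity) (by positivity), ← Real.rpow_mul (by positivity),
      mul_one_div_cancel hu0.ne', Real.rpow_one]
    ring
  rw [hfin]
  refine eLpNorm_le_of_norm_rpow_le hu0 (hi0.const_mul ((C₁ * ν ^ s) ^ u)) (fun x => ?_)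
    (integral_const_mul _ _).le
  have h1 := hpt ν 1 F hν zero_le_one (fun q x => by
    simpa [weight] using hF q x) x
  simp only [weight, mul_zero, add_zero, Real.one_rpow, one_mul, mul_one] at h1
  refine (Real.rpow_le_rpow (norm_nonneg _) h1 hu0.le).trans (le_of_eq ?_)
  rw [Real.mul_rpow (by positivity) (by positivity), ← Real.rpow_mul (by positivity), neg_mul,
    div_mul_cancel₀ _ hu0.ne']

end Lacunary

/-! ### Derivative bounds for concentrated and oscillating functions -/

section Families

variable {E V : Type*} [NormedAddCommGroup E] [InnerProductSpace ℝ E]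
  [NormedAddCommGroup V] [InnerProductSpace ℝ V]

theorem exists_norm_iteratedFDeriv_le (f : 𝓢(E, ℂ)) (a : ℝ) (q : ℕ) :
    ∃ C : ℝ, 0 ≤ C ∧ ∀ i ≤ q, ∀ x, ‖iteratedFDeriv ℝ i f x‖ ≤ C * (1 + ‖x‖) ^ (-a) := by
  obtain ⟨k, hk⟩ := exists_nat_ge a
  set C := 2 ^ (k, q).1 * (Finset.Iic (k, q)).sup (fun m => SchwartzMap.seminorm ℝ m.1 m.2) f with hC
  refine ⟨C, by positivity, fun i hi x => ?_⟩
  have h1 := SchwartzMap.one_add_le_sup_seminorm_apply (𝕜 := ℝ) (m := (k, q)) le_rfl hi f x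
  have h2 : (1 + ‖x‖) ^ (-(k : ℝ)) ≤ (1 + ‖x‖) ^ (-a) := by
    refine Real.rpow_le_rpow_of_exponent_le ?_ (by linarith)
    linarith [norm_nonneg x]
  refine le_trans ?_ (mul_le_mul_of_nonneg_left h2 (by positivity))
  rw [Real.rpow_neg (by positivity), Real.rpow_natCast, ← div_eq_mul_inv, le_div_iff₀ (by positivity),
    mul_comm]
  exact h1

theorem norm_iteratedFDeriv_comp_affine_le {g : V → ℂ} (hg : ContDiff ℝ (⊤ : ℕ∞) g) (A : E →L[ℝ] V)
    (a : V) {ν : ℝ} (hν : 0 ≤ ν) (i : ℕ) (x : E) :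
    ‖iteratedFDeriv ℝ i (fun y => g (ν • (A y - a))) x‖ ≤
      ‖iteratedFDeriv ℝ i g (ν • (A x - a))‖ * (ν * ‖A‖) ^ i := by
  have h1 : (fun y => g (ν • (A y - a))) = (fun z => g (z - ν • a)) ∘ (ν • A : E →L[ℝ] V) := by
    ext y
    simp [smul_sub]
  have h2 : ContDiff ℝ i (fun z => g (z - ν • a)) :=
    (hg.of_le (by exact_mod_cast le_top)).comp (contDiff_id.sub contDiff_const)
  rw [h1, ContinuousLinearMap.iteratedFDeriv_comp_right _ h2 x le_rfl, iteratedFDeriv_comp_sub]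
  refine (ContinuousMultilinearMap.norm_compContinuousLinearMap_le _ _).trans ?_
  rw [Finset.prod_const, Finset.card_univ, Fintype.card_fin, norm_smul, Real.norm_of_nonneg hν]
  simp [smul_sub]

theorem hasTemperateGrowth_comp_affine (g : 𝓢(V, ℂ)) (A : E →L[ℝ] V) (a : V) (ν : ℝ) :
    (fun y => g (ν • (A y - a))).HasTemperateGrowth := by
  have h1 : (fun y => ν • (A y - a)).HasTemperateGrowth :=
    (Function.HasTemperateGrowth.const ν).smul
      (A.hasTemperateGrowth.sub (Function.HasTemperateGrowth.const a))
  exact g.hasTemperateGrowth.comp h1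

/-- The Schwartz function `g (ν (A · - a)) h`. -/
def concentrated (g : 𝓢(V, ℂ)) (h : 𝓢(E, ℂ)) (A : E →L[ℝ] V) (a : V) (ν : ℝ) : 𝓢(E, ℂ) :=
  SchwartzMap.smulLeftCLM ℂ (fun y => g (ν • (A y - a))) h

theorem concentrated_apply (g : 𝓢(V, ℂ)) (h : 𝓢(E, ℂ)) (A : E →L[ℝ] V) (a : V) (ν : ℝ) (x : E) :
    concentrated g h A a ν x = g (ν • (A x - a)) * h x := by
  rw [concentrated, SchwartzMap.smulLeftCLM_apply_apply (hasTemperateGrowth_comp_affine g A a ν),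
    smul_eq_mul]

/-- Leibniz: a derivative falling on the rescaled factor costs `ν`, one falling on `h` costs a
constant, and `ν ≥ 1`. -/
theorem norm_iteratedFDeriv_concentrated_le (g : 𝓢(V, ℂ)) (h : 𝓢(E, ℂ)) (A : E →L[ℝ] V) (a : V)
    (α b : ℝ) : ∃ Q : ℕ → ℝ, (∀ q, 0 ≤ Q q) ∧ ∀ ν, 1 ≤ ν → ∀ q x,
      ‖iteratedFDeriv ℝ q (concentrated g h A a ν) x‖ ≤
        Q q * ν ^ q * ((1 + ν * ‖A x - a‖) ^ (-α) * (1 + ‖x‖) ^ (-b)) := by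
  choose G hG0 hG using exists_norm_iteratedFDeriv_le g α
  choose H hH0 hH using exists_norm_iteratedFDeriv_le h b
  refine ⟨fun q => ∑ i ∈ Finset.range (q + 1), (q.choose i : ℝ) * (G q * ‖A‖ ^ i) * H q,
    fun q => Finset.sum_nonneg fun i _ => ?_, fun ν hν q x => ?_⟩
  · have := hG0 q
    have := hH0 q
    positivity
  have hν0 : 0 ≤ ν := by linarith
  have h1 : (concentrated g h A a ν : E → ℂ) = fun y => (fun y => g (ν • (A y - a))) y * h y :=
    funext (concentrated_apply g h A a ν)
  rw [h1]
  have hc : ContDiff ℝ (⊤ : ℕ∞) (fun y => g (ν • (A y - a))) :=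
    (hasTemperateGrowth_comp_affine g A a ν).1
  refine (norm_iteratedFDeriv_mul_le (N := (⊤ : ℕ∞)) hc (h.smooth ⊤) x
    (by exact_mod_cast le_top)).trans ?_
  rw [Finset.sum_mul, Finset.sum_mul]
  refine Finset.sum_le_sum fun i hi => ?_
  have hiq : i ≤ q := Nat.lt_succ_iff.1 (Finset.mem_range.1 hi)
  have h2 : ‖iteratedFDeriv ℝ i (fun y => g (ν • (A y - a))) x‖ ≤
      (G q * (1 + ν * ‖A x - a‖) ^ (-α)) * (ν ^ q * ‖A‖ ^ i) := by
    refine (norm_iteratedFDeriv_comp_affine_le (g.smooth ⊤) A a hν0 i x).trans ?_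
    have h3 := hG q i hiq (ν • (A x - a))
    rw [norm_smul, Real.norm_of_nonneg hν0] at h3
    rw [mul_pow]
    have := hG0 q
    gcongr
  calc (q.choose i : ℝ) * ‖iteratedFDeriv ℝ i (fun y => g (ν • (A y - a))) x‖ *
        ‖iteratedFDeriv ℝ (q - i) h x‖
      ≤ (q.choose i : ℝ) * ((G q * (1 + ν * ‖A x - a‖) ^ (-α)) * (ν ^ q * ‖A‖ ^ i)) *
        (H q * (1 + ‖x‖) ^ (-b)) := by
        have := hG0 q
        gcongr
        exact hH q (q - i) (Nat.sub_le _ _) x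
    _ = _ := by ring

/-- The Schwartz function `exp(i ν Φ) h`. -/
def oscillating (Φ : E → ℝ) (h : 𝓢(E, ℂ)) (ν : ℝ) : 𝓢(E, ℂ) :=
  SchwartzMap.smulLeftCLM ℂ (fun y => Complex.exp ((ν * Φ y : ℝ) * Complex.I)) h

theorem norm_iteratedFDeriv_exp_mul_I (i : ℕ) (t : ℝ) :
    ‖iteratedFDeriv ℝ i (fun t : ℝ => Complex.exp (t * Complex.I)) t‖ = 1 := by
  have h1 : ∀ i : ℕ, iteratedDeriv i (fun t : ℝ => Complex.exp (t * Complex.I)) =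
      fun t : ℝ => Complex.I ^ i * Complex.exp (t * Complex.I) := by
    intro i
    induction i with
    | zero => simp
    | succ i ih =>
      rw [iteratedDeriv_succ, ih]
      ext t
      have h2 : HasDerivAt (fun t : ℝ => (t : ℂ) * Complex.I) Complex.I t := by
        simpa using (Complex.ofRealCLM.hasDerivAt (x := t)).mul_const Complex.I
      rw [(h2.cexp.const_mul _).deriv, pow_succ]
      ring
  rw [norm_iteratedFDeriv_eq_norm_iteratedDeriv, h1, norm_mul, norm_pow, Complex.norm_I, one_pow,
    one_mul, Complex.norm_exp_ofReal_mul_I]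

theorem hasTemperateGrowth_exp_mul_I :
    (fun t : ℝ => Complex.exp (t * Complex.I)).HasTemperateGrowth := by
  refine ⟨(Complex.ofRealCLM.contDiff.mul contDiff_const).cexp, fun i => ⟨0, 1, fun t => ?_⟩⟩
  rw [norm_iteratedFDeriv_exp_mul_I]
  simp

theorem hasTemperateGrowth_phase {Φ : E → ℝ} (hΦ : Φ.HasTemperateGrowth) (ν : ℝ) :
    (fun y => Complex.exp ((ν * Φ y : ℝ) * Complex.I)).HasTemperateGrowth :=
  hasTemperateGrowth_exp_mul_I.comp ((Function.HasTemperateGrowth.const ν).mul hΦ)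

theorem oscillating_apply {Φ : E → ℝ} (hΦ : Φ.HasTemperateGrowth) (h : 𝓢(E, ℂ)) (ν : ℝ) (x : E) :
    oscillating Φ h ν x = Complex.exp ((ν * Φ x : ℝ) * Complex.I) * h x := by
  rw [oscillating, SchwartzMap.smulLeftCLM_apply_apply (hasTemperateGrowth_phase hΦ ν), smul_eq_mul]

theorem norm_iteratedFDeriv_phase_le {Φ : E → ℝ} (hΦ : Φ.HasTemperateGrowth) (q : ℕ) :
    ∃ (C : ℝ) (k : ℕ), 0 ≤ C ∧ ∀ ν, 1 ≤ ν → ∀ i ≤ q, ∀ x,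
      ‖iteratedFDeriv ℝ i (fun y => Complex.exp ((ν * Φ y : ℝ) * Complex.I)) x‖ ≤
        C * ν ^ q * (1 + ‖x‖) ^ k := by
  obtain ⟨k, C, hC, hb⟩ := hΦ.norm_iteratedFDeriv_le_uniform q
  -- The bound for compositions wants the `j`-th derivative of the phase below `D^j`. Taking `C + 1`
  -- in place of `C` makes `D ≥ 1`, so `D ≤ D^j` suffices for `j ≥ 1`.
  refine ⟨q.factorial * (C + 1) ^ q, k * q, by positivity, fun ν hν i hi x => ?_⟩
  have hν0 : 0 ≤ ν := by linarith
  have hx1 : 1 ≤ 1 + ‖x‖ := by linarith [norm_nonneg x]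
  set D := ν * ((C + 1) * (1 + ‖x‖) ^ k) with hD
  have hD1 : 1 ≤ D := by
    have : (1 : ℝ) ≤ (1 + ‖x‖) ^ k := one_le_pow₀ hx1
    have h2 : 1 ≤ (C + 1) * (1 + ‖x‖) ^ k := by nlinarith
    nlinarith
  have hsm : ContDiff ℝ (⊤ : ℕ∞) (fun y => ν * Φ y) := contDiff_const.mul hΦ.1
  have h1 : ‖iteratedFDeriv ℝ i ((fun t : ℝ => Complex.exp (t * Complex.I)) ∘ fun y => ν * Φ y) x‖ ≤
      i.factorial * 1 * D ^ i := by
    refine norm_iteratedFDeriv_comp_le (N := (⊤ : ℕ∞)) hasTemperateGrowth_exp_mul_I.1 hsm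
      (by exact_mod_cast le_top) x (fun j _ => (norm_iteratedFDeriv_exp_mul_I j _).le)
      fun j hj hji => ?_
    have h2 : (fun y => ν * Φ y) = ν • Φ := rfl
    rw [h2, iteratedFDeriv_const_smul_apply
      ((hΦ.1.of_le (by exact_mod_cast le_top)).contDiffAt), norm_smul, Real.norm_of_nonneg hν0]
    calc ν * ‖iteratedFDeriv ℝ j Φ x‖ ≤ ν * (C * (1 + ‖x‖) ^ k) := by
          gcongr
          exact hb j (hji.trans hi) x
      _ ≤ D := by
          rw [hD]
          gcongr
          linarith
      _ ≤ D ^ j := le_self_pow₀ hD1 (by omega)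
  refine h1.trans ?_
  have h3 : (i.factorial : ℝ) ≤ q.factorial := by exact_mod_cast Nat.factorial_le hi
  have h4 : D ^ i ≤ D ^ q := pow_le_pow_right₀ hD1 hi
  calc (i.factorial : ℝ) * 1 * D ^ i ≤ q.factorial * 1 * D ^ q := by gcongr
    _ = _ := by
        rw [hD, mul_pow, mul_pow, ← pow_mul]
        ring

theorem norm_iteratedFDeriv_oscillating_le {Φ : E → ℝ} (hΦ : Φ.HasTemperateGrowth) (h : 𝓢(E, ℂ))
    (b : ℝ) : ∃ Q : ℕ → ℝ, (∀ q, 0 ≤ Q q) ∧ ∀ ν, 1 ≤ ν → ∀ q x,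
      ‖iteratedFDeriv ℝ q (oscillating Φ h ν) x‖ ≤ Q q * ν ^ q * (1 + ‖x‖) ^ (-b) := by
  choose G k hG0 hG using norm_iteratedFDeriv_phase_le hΦ
  -- The extra decay `k q` of `h` compensates the polynomial growth of the derivatives of the phase.
  choose H hH0 hH using fun q => exists_norm_iteratedFDeriv_le h (b + k q) q
  refine ⟨fun q => ∑ i ∈ Finset.range (q + 1), (q.choose i : ℝ) * G q * H q,
    fun q => Finset.sum_nonneg fun i _ => ?_, fun ν hν q x => ?_⟩
  · have := hG0 q
    have := hH0 q
    positivity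
  have hν0 : 0 ≤ ν := by linarith
  have h1 : (oscillating Φ h ν : E → ℂ) =
      fun y => (fun y => Complex.exp ((ν * Φ y : ℝ) * Complex.I)) y * h y :=
    funext (oscillating_apply hΦ h ν)
  rw [h1]
  refine (norm_iteratedFDeriv_mul_le (N := (⊤ : ℕ∞)) (hasTemperateGrowth_phase hΦ ν).1 (h.smooth ⊤) x
    (by exact_mod_cast le_top)).trans ?_
  rw [Finset.sum_mul, Finset.sum_mul]
  refine Finset.sum_le_sum fun i hi => ?_
  have hiq : i ≤ q := Nat.lt_succ_iff.1 (Finset.mem_range.1 hi)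
  have h5 : (1 + ‖x‖) ^ (-(b + k q)) = (1 + ‖x‖) ^ (-b) * ((1 + ‖x‖) ^ (k q))⁻¹ := by
    rw [neg_add, Real.rpow_add (by positivity), Real.rpow_neg (by positivity) (k q : ℝ),
      Real.rpow_natCast]
  calc (q.choose i : ℝ) * ‖iteratedFDeriv ℝ i
          (fun y => Complex.exp ((ν * Φ y : ℝ) * Complex.I)) x‖ * ‖iteratedFDeriv ℝ (q - i) h x‖
      ≤ (q.choose i : ℝ) * (G q * ν ^ q * (1 + ‖x‖) ^ (k q)) *
        (H q * (1 + ‖x‖) ^ (-(b + k q))) := by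
        have := hG0 q
        gcongr
        · exact hG q ν hν i hiq x
        · exact hH q (q - i) (Nat.sub_le _ _) x
    _ = _ := by
        rw [h5]
        field_simp

end Families

/-! ### The two thin sets: a point and the subspace `ξ₁ + ξ₂ = a` -/

section Thin

variable {V : Type*} [NormedAddCommGroup V] [InnerProductSpace ℝ V]
  [FiniteDimensional ℝ V] [MeasurableSpace V] [BorelSpace V]

theorem integral_one_add_mul_norm_sub {κ : ℝ} (hκ : 0 < κ) (v : V) (a : ℝ) :
    ∫ z : V, (1 + κ * ‖v - z‖) ^ (-a) =
      κ ^ (-(Module.finrank ℝ V : ℝ)) * ∫ z : V, (1 + ‖z‖) ^ (-a) := by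
  rw [integral_sub_left_eq_self (fun z : V => (1 + κ * ‖z‖) ^ (-a)) volume v]
  have h := Measure.integral_comp_smul volume (fun z : V => (1 + ‖z‖) ^ (-a)) κ
  simp only [norm_smul, Real.norm_of_nonneg hκ.le, smul_eq_mul] at h
  rw [h, abs_of_pos (by positivity), Real.rpow_neg hκ.le, Real.rpow_natCast]

theorem integrable_one_add_mul_norm_sub {κ : ℝ} (hκ : 0 < κ) (v : V) {a : ℝ}
    (ha : (Module.finrank ℝ V : ℝ) < a) : Integrable fun z : V => (1 + κ * ‖v - z‖) ^ (-a) := by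
  have h1 : Integrable fun z : V => (1 + ‖z‖) ^ (-a) := integrable_one_add_norm ha
  have h2 := (h1.comp_smul hκ.ne').comp_sub_left v
  simpa only [norm_smul, Real.norm_of_nonneg hκ.le] using h2

/-- A change of variables centred at `v` produces the factor `(ντ)^(-dim V)`; the weight `(1 +
|z|)^(-M)` is simply bounded by one. -/
theorem isThin_norm_sub (v : V) : IsThin (fun x => ‖x - v‖) (Module.finrank ℝ V) where
  nonneg x := norm_nonneg _
  lip x y := by
    have := norm_add_le (x - y) (y - v)
    rw [sub_add_sub_cancel] at this
    linarith
  codim_nonneg := Nat.cast_nonneg _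
  thin := by
    set d : ℝ := ((Module.finrank ℝ V : ℕ) : ℝ) with hd
    refine ⟨d + 1, ∫ z : V, (1 + ‖z‖) ^ (-(d + 1)), by linarith, fun x τ ν hτ hν hντ => ?_⟩
    have hκ : 0 < ν * τ := by linarith
    have h1 : ∀ z : V, ν * ‖x - τ • z - v‖ = ν * τ * ‖τ⁻¹ • (x - v) - z‖ := by
      intro z
      have : x - τ • z - v = τ • (τ⁻¹ • (x - v) - z) := by
        rw [smul_sub, smul_inv_smul₀ hτ.ne']
        abel
      rw [this, norm_smul, Real.norm_of_nonneg hτ.le, mul_assoc]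
    simp_rw [h1]
    rw [mul_comm (∫ z : V, _), ← integral_one_add_mul_norm_sub hκ (τ⁻¹ • (x - v))]
    refine integral_mono_of_nonneg (Filter.Eventually.of_forall fun z => by positivity)
      (integrable_one_add_mul_norm_sub hκ _ (by linarith)) (Filter.Eventually.of_forall fun z => ?_)
    refine mul_le_of_le_one_left (by positivity)
      (Real.rpow_le_one_of_one_le_of_nonpos ?_ ?_)
    · linarith [norm_nonneg z]
    · have : 0 ≤ d := Nat.cast_nonneg _
      linarith

theorem IsThin.const_mul {ρ : V → ℝ} {l : ℝ} (h : IsThin ρ l) {c : ℝ} (hc : 0 < c) (hc1 : c ≤ 1) :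
    IsThin (fun x => c * ρ x) l where
  nonneg x := mul_nonneg hc.le (h.nonneg x)
  lip x y := by
    have h1 := mul_le_mul_of_nonneg_left (h.lip x y) hc.le
    have h2 := mul_le_of_le_one_left (norm_nonneg (x - y)) hc1
    linarith
  codim_nonneg := h.codim_nonneg
  thin := by
    obtain ⟨M, C, hM, hC, hint⟩ := h.exists_integral_le
    have hl := h.codim_nonneg
    refine ⟨M, C * c ^ (-l), hM, fun x τ ν hτ hν hντ => ?_⟩
    have h1 := hint x τ (ν * c) hτ (by positivity)
    simp_rw [← mul_assoc]
    refine h1.trans ?_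
    rw [mul_assoc C, ← Real.mul_rpow hc.le (by linarith)]
    have hp : 0 < ν * c * τ := by
      have : 0 < ν * τ := by linarith
      calc 0 < c * (ν * τ) := by positivity
        _ = _ := by ring
    have h2 : c * (ν * τ) = ν * c * τ := by ring
    rw [h2]
    refine mul_le_mul_of_nonneg_left ?_ hC.le
    exact Real.rpow_le_rpow_of_nonpos hp (le_max_right _ _) (by linarith)

theorem norm_fst_add_snd_le {n : ℕ} (ξ : R2n n) : ‖ξ.fst + ξ.snd‖ ≤ 2 * ‖ξ‖ := by
  have h1 : ‖ξ.fst‖ ≤ ‖ξ‖ := by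
    rw [WithLp.prod_norm_eq_of_L2]
    exact Real.le_sqrt_of_sq_le (by nlinarith [sq_nonneg ‖ξ.snd‖])
  have h2 : ‖ξ.snd‖ ≤ ‖ξ‖ := by
    rw [WithLp.prod_norm_eq_of_L2]
    exact Real.le_sqrt_of_sq_le (by nlinarith [sq_nonneg ‖ξ.fst‖])
  linarith [norm_add_le ξ.fst ξ.snd]

theorem integral_R2n {n : ℕ} {F : Type*} [NormedAddCommGroup F] [NormedSpace ℝ F] (f : R2n n → F) :
    ∫ ξ, f ξ = ∫ p : Rn n × Rn n, f (WithLp.toLp 2 p) :=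
  ((WithLp.volume_preserving_toLp (Rn n) (Rn n)).integral_comp
    (MeasurableEquiv.toLp 2 (Rn n × Rn n)).measurableEmbedding f).symm

theorem integrable_R2n {n : ℕ} {F : Type*} [NormedAddCommGroup F] {f : R2n n → F} :
    Integrable (fun p : Rn n × Rn n => f (WithLp.toLp 2 p)) ↔ Integrable f :=
  (WithLp.volume_preserving_toLp (Rn n) (Rn n)).integrable_comp_emb
    (MeasurableEquiv.toLp 2 (Rn n × Rn n)).measurableEmbedding

/-- For fixed `z₂` the function depends on `z₁` as the distance to a point of `ℝⁿ`, which gives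
codimension `n`. The factor `1/2` makes it 1-Lipschitz, as `|ξ₁ + ξ₂| ≤ 2|ξ|`. -/
theorem isThin_norm_fst_add_snd {n : ℕ} (a : Rn n) :
    IsThin (fun ξ : R2n n => 2⁻¹ * ‖ξ.fst + ξ.snd - a‖) n := by
  have hlip : ∀ x y : R2n n, 2⁻¹ * ‖x.fst + x.snd - a‖ ≤ 2⁻¹ * ‖y.fst + y.snd - a‖ + ‖x - y‖ := by
    intro x y
    have h1 := norm_add_le (y.fst + y.snd - a) ((x - y).fst + (x - y).snd)
    have h2 := norm_fst_add_snd_le (x - y)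
    have h3 : y.fst + y.snd - a + ((x - y).fst + (x - y).snd) = x.fst + x.snd - a := by
      rw [WithLp.sub_fst, WithLp.sub_snd]
      abel
    rw [h3] at h1
    linarith
  refine ⟨fun ξ => by positivity, hlip, Nat.cast_nonneg _, ?_⟩
  set d : ℝ := ((Module.finrank ℝ (R2n n) : ℕ) : ℝ) with hd
  have hnd : (n : ℝ) ≤ d := by
    rw [hd, LinearEquiv.finrank_eq (WithLp.linearEquiv 2 ℝ (Rn n × Rn n)), Module.finrank_prod,
      finrank_euclideanSpace_fin]
    push_cast
    linarith [Nat.cast_nonneg (α := ℝ) n]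
  set I₁ : ℝ := ∫ z : Rn n, (1 + ‖z‖) ^ (-((n : ℝ) + 1)) with hI₁
  set I₂ : ℝ := ∫ z : Rn n, (1 + ‖z‖) ^ (-(d + 1)) with hI₂
  have hfr : (Module.finrank ℝ (Rn n) : ℝ) = n := by rw [finrank_euclideanSpace_fin]
  refine ⟨d + 1, I₂ * (2⁻¹ ^ (-(n : ℝ)) * I₁), by linarith, fun x τ ν hτ hν hντ => ?_⟩
  have hκ : 0 < ν * τ := by linarith
  have hκ2 : 0 < 2⁻¹ * (ν * τ) := by positivity
  set f : R2n n → ℝ := fun z => (1 + ‖z‖) ^ (-(d + 1)) *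
    (1 + ν * (2⁻¹ * ‖(x - τ • z).fst + (x - τ • z).snd - a‖)) ^ (-((n : ℝ) + 1)) with hf
  have hfi : Integrable f := by
    have h1 : Integrable fun z : R2n n => (1 + ‖z‖) ^ (-(d + 1)) :=
      integrable_one_add_norm (by linarith)
    refine h1.mono' ?_ (Filter.Eventually.of_forall fun z => ?_)
    · refine Continuous.aestronglyMeasurable ?_
      refine Continuous.mul ?_ ?_
      · exact Continuous.rpow_const (by fun_prop) fun z => Or.inl (by positivity)
      · exact Continuous.rpow_const (by fun_prop) fun z => Or.inl (by positivity)
    · rw [hf, Real.norm_of_nonneg (by positivity)]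
      refine mul_le_of_le_one_right (by positivity)
        (Real.rpow_le_one_of_one_le_of_nonpos ?_ (by linarith [Nat.cast_nonneg (α := ℝ) n]))
      have : 0 ≤ ν * (2⁻¹ * ‖(x - τ • z).fst + (x - τ • z).snd - a‖) := by positivity
      linarith
  rw [integral_R2n]
  have hfi' := integrable_R2n.2 hfi
  rw [Measure.volume_eq_prod] at hfi' ⊢
  rw [integral_prod_symm _ hfi']
  -- Only the decay in `z₂` is kept from the polynomial weight; the second factor alone makes the
  -- `z₁`-integral converge.
  have hpt : ∀ z₂ z₁ : Rn n, f (WithLp.toLp 2 (z₁, z₂)) ≤ (1 + ‖z₂‖) ^ (-(d + 1)) *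
      (1 + 2⁻¹ * (ν * τ) * ‖(τ⁻¹ • (x.fst + x.snd - a) - z₂) - z₁‖) ^ (-((n : ℝ) + 1)) := by
    intro z₂ z₁
    have h1 : ‖z₂‖ ≤ ‖WithLp.toLp 2 (z₁, z₂)‖ := by
      rw [WithLp.prod_norm_eq_of_L2]
      exact Real.le_sqrt_of_sq_le (by simp)
    have h2 : ν * (2⁻¹ * ‖(x - τ • WithLp.toLp 2 (z₁, z₂)).fst +
        (x - τ • WithLp.toLp 2 (z₁, z₂)).snd - a‖) =
        2⁻¹ * (ν * τ) * ‖(τ⁻¹ • (x.fst + x.snd - a) - z₂) - z₁‖ := by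
      have h3 : (x - τ • WithLp.toLp 2 (z₁, z₂)).fst +
          (x - τ • WithLp.toLp 2 (z₁, z₂)).snd - a =
          τ • ((τ⁻¹ • (x.fst + x.snd - a) - z₂) - z₁) := by
        rw [smul_sub, smul_sub, smul_inv_smul₀ hτ.ne']
        change x.fst - τ • z₁ + (x.snd - τ • z₂) - a = _
        abel
      rw [h3, norm_smul, Real.norm_of_nonneg hτ.le]
      ring
    simp only [hf]
    rw [h2]
    refine mul_le_mul_of_nonneg_right ?_ (by positivity)
    refine Real.rpow_le_rpow_of_nonpos (by positivity) (by linarith) ?_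
    linarith [Nat.cast_nonneg (α := ℝ) n]
  have hinner : ∀ z₂ : Rn n, ∫ z₁, f (WithLp.toLp 2 (z₁, z₂)) ≤
      (1 + ‖z₂‖) ^ (-(d + 1)) * ((2⁻¹ * (ν * τ)) ^ (-(n : ℝ)) * I₁) := by
    intro z₂
    refine (integral_mono_of_nonneg (Filter.Eventually.of_forall fun z => ?_)
      ((integrable_one_add_mul_norm_sub hκ2 _ (by rw [hfr]; linarith)).const_mul _)
      (Filter.Eventually.of_forall (hpt z₂))).trans (le_of_eq ?_)
    · simp only [hf, Pi.zero_apply]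
      positivity
    · rw [integral_const_mul, integral_one_add_mul_norm_sub hκ2, hfr]
  have hI₂i : Integrable fun z : Rn n => (1 + ‖z‖) ^ (-(d + 1)) :=
    integrable_one_add_norm (by rw [hfr]; linarith)
  refine (integral_mono_of_nonneg (Filter.Eventually.of_forall fun z => ?_)
    (hI₂i.mul_const _) (Filter.Eventually.of_forall hinner)).trans (le_of_eq ?_)
  · refine integral_nonneg fun z => ?_
    simp only [hf, Pi.zero_apply]
    positivity
  · rw [integral_mul_const, Real.mul_rpow (by positivity) hκ.le]
    ring

end Thin

/-! ### Hörmander norms of the test multipliers -/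

section Hormander

variable {E V : Type*} [NormedAddCommGroup E] [InnerProductSpace ℝ E]
  [FiniteDimensional ℝ E] [MeasurableSpace E] [BorelSpace E]
  [NormedAddCommGroup V] [InnerProductSpace ℝ V]

/-- The supports of `m(2^k ·)` and `Θ^` are disjoint for `|k| ≥ 4`, so the supremum runs over seven
values of `k`. -/
theorem hormanderENorm_le {Θ : 𝓢(E, ℂ)} (hΘ : ∀ ξ, (𝓕 Θ) ξ ≠ 0 → 1 / 2 ≤ ‖ξ‖ ∧ ‖ξ‖ ≤ 2)
    (s u : ℝ) (hu : 1 ≤ u) {m : E → ℂ} (hm : ∀ ξ, m ξ ≠ 0 → 1 / 4 ≤ ‖ξ‖ ∧ ‖ξ‖ ≤ 4) {R : ℝ≥0∞}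
    (h : ∀ k ∈ Finset.Icc (-3 : ℤ) 3,
      sobolevENorm s u hu (fun ξ => m ((2 : ℝ) ^ k • ξ) * (𝓕 Θ) ξ) ≤ R) :
    hormanderENorm Θ s u hu m ≤ R := by
  refine iSup_le fun k => ?_
  by_cases hk : k ∈ Finset.Icc (-3 : ℤ) 3
  · exact h k hk
  · have h0 : (fun ξ => m ((2 : ℝ) ^ k • ξ) * (𝓕 Θ) ξ) = ((0 : 𝓢(E, ℂ)) : E → ℂ) := by
      ext ξ
      change m ((2 : ℝ) ^ k • ξ) * (𝓕 Θ) ξ = 0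
      by_contra hne
      obtain ⟨h1, h2⟩ := mul_ne_zero_iff.1 hne
      obtain ⟨h3, h4⟩ := hm _ h1
      obtain ⟨h5, h6⟩ := hΘ _ h2
      have hp : (0 : ℝ) < 2 ^ k := by positivity
      rw [norm_smul, Real.norm_of_nonneg hp.le] at h3 h4
      rw [Finset.mem_Icc, not_and_or, not_le, not_le] at hk
      rcases hk with hk | hk
      · have h7 : (2 : ℝ) ^ k ≤ 2 ^ (-4 : ℤ) := zpow_le_zpow_right₀ one_le_two (by omega)
        norm_num at h7
        nlinarith
      · have h7 : (2 : ℝ) ^ (4 : ℤ) ≤ 2 ^ k := zpow_le_zpow_right₀ one_le_two (by omega)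
        norm_num at h7
        nlinarith
    rw [h0]
    refine (sobolevENorm_le s u hu 0).trans ?_
    have h1 : besselPot s (0 : 𝓢(E, ℂ)) = 0 := map_zero _
    have h2 : ((0 : 𝓢(E, ℂ)) : E → ℂ) = 0 := rfl
    rw [h1, h2, eLpNorm_zero]
    exact zero_le

theorem two_zpow_bounds {k : ℤ} (hk : k ∈ Finset.Icc (-3 : ℤ) 3) :
    (2 : ℝ) ^ k ≤ 8 ∧ 1 / 8 ≤ (2 : ℝ) ^ k := by
  rw [Finset.mem_Icc] at hk
  constructor
  · have h7 : (2 : ℝ) ^ k ≤ 2 ^ (3 : ℤ) := zpow_le_zpow_right₀ one_le_two hk.2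
    norm_num at h7
    exact h7
  · have h7 : (2 : ℝ) ^ (-3 : ℤ) ≤ 2 ^ k := zpow_le_zpow_right₀ one_le_two hk.1
    norm_num at h7
    linarith

/-- The Schwartz function `χ(2^k ·) Θ^`. -/
def dilatedCutoff (Θ χ : 𝓢(E, ℂ)) (k : ℤ) : 𝓢(E, ℂ) :=
  concentrated χ (𝓕 Θ) (ContinuousLinearMap.id ℝ E) 0 ((2 : ℝ) ^ k)

theorem dilatedCutoff_apply (Θ χ : 𝓢(E, ℂ)) (k : ℤ) (ξ : E) :
    dilatedCutoff Θ χ k ξ = χ ((2 : ℝ) ^ k • ξ) * (𝓕 Θ) ξ := by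
  rw [dilatedCutoff, concentrated_apply, ContinuousLinearMap.id_apply, sub_zero]

/-- The lacunary multiplier `∑ c_j φ(2^j (A · - a)) χ`. -/
def lacunary {E : Type*} [NormedAddCommGroup E] [InnerProductSpace ℝ E]
    (φ : 𝓢(V, ℂ)) (χ : 𝓢(E, ℂ)) (A : E →L[ℝ] V) (a : V) (c : ℕ → ℂ) (N : ℕ) : 𝓢(E, ℂ) :=
  ∑ j ∈ Finset.range N, c j • concentrated φ χ A a (2 ^ j)

theorem lacunary_apply {E : Type*} [NormedAddCommGroup E] [InnerProductSpace ℝ E]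
    (φ : 𝓢(V, ℂ)) (χ : 𝓢(E, ℂ)) (A : E →L[ℝ] V) (a : V) (c : ℕ → ℂ) (N : ℕ)
    (ξ : E) : lacunary φ χ A a c N ξ =
      (∑ j ∈ Finset.range N, c j * φ ((2 : ℝ) ^ j • (A ξ - a))) * χ ξ := by
  rw [lacunary, sum_apply, Finset.sum_mul]
  refine Finset.sum_congr rfl fun j _ => ?_
  rw [smul_apply, concentrated_apply, smul_eq_mul, mul_assoc]

/-- Each dilate `m(2^k ·) Θ^` is again a lacunary sum, with `A` replaced by `2^k A` and a new
cutoff, so the lacunary bound applies to each of the finitely many `k`. -/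
theorem hormanderENorm_lacunary_le {Θ : 𝓢(E, ℂ)}
    (hΘ : ∀ ξ, (𝓕 Θ) ξ ≠ 0 → 1 / 2 ≤ ‖ξ‖ ∧ ‖ξ‖ ≤ 2) {s u : ℝ} (hu : 1 < u) (hs : 0 < s)
    (A : E →L[ℝ] V) (a : V) {l c₀ : ℝ} (hl : 0 < l) (hc₁ : c₀ ≤ 1)
    (hthin : ∀ a : V, IsThin (fun ξ => c₀ * ‖A ξ - a‖) l)
    (φ : 𝓢(V, ℂ)) (χ : 𝓢(E, ℂ)) (hχ : ∀ ξ, χ ξ ≠ 0 → 1 / 4 ≤ ‖ξ‖ ∧ ‖ξ‖ ≤ 4) :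
    ∃ C : ℝ, 0 ≤ C ∧ ∀ (N : ℕ) (B : ℝ) (c : ℕ → ℂ), 1 ≤ N → 0 ≤ B →
      (∀ j, ‖c j‖ * ((2 : ℝ) ^ j) ^ s ≤ B * ((2 : ℝ) ^ j) ^ (l / u)) →
      hormanderENorm Θ s u hu.le (lacunary φ χ A a c N) ≤
        ENNReal.ofReal (C * B * (N : ℝ) ^ (1 / u)) := by
  have key : ∀ k ∈ Finset.Icc (-3 : ℤ) 3, ∃ C : ℝ, 0 ≤ C ∧ ∀ (N : ℕ) (B : ℝ) (c : ℕ → ℂ),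
      1 ≤ N → 0 ≤ B → (∀ j, ‖c j‖ * ((2 : ℝ) ^ j) ^ s ≤ B * ((2 : ℝ) ^ j) ^ (l / u)) →
      sobolevENorm s u hu.le (fun ξ => lacunary φ χ A a c N ((2 : ℝ) ^ k • ξ) * (𝓕 Θ) ξ) ≤
        ENNReal.ofReal (C * B * (N : ℝ) ^ (1 / u)) := by
    intro k hk
    obtain ⟨hk8, hk8'⟩ := two_zpow_bounds hk
    have hkp : (0 : ℝ) < 2 ^ k := by positivity
    -- The map `2^k A` takes the value `a` where `A` takes the value `2^(-k) a`. Dividing by `8`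
    -- keeps the prefactor at most one, so `ρ` stays 1-Lipschitz.
    set ρ : E → ℝ := fun ξ => (2 : ℝ) ^ k / 8 * (c₀ * ‖A ξ - ((2 : ℝ) ^ k)⁻¹ • a‖) with hρ
    have hρt : IsThin ρ l := (hthin (((2 : ℝ) ^ k)⁻¹ • a)).const_mul (by positivity) (by linarith)
    obtain ⟨b, hb, hlac⟩ := eLpNorm_besselPot_lacunary_le hρt hl hu hs
    obtain ⟨Q, hQ, hcon⟩ := norm_iteratedFDeriv_concentrated_le φ (dilatedCutoff Θ χ k)
      ((2 : ℝ) ^ k • A) a (2 * l + 1) b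
    obtain ⟨C, hC, hfin⟩ := hlac Q hQ
    refine ⟨C, hC, fun N B c hN hB hc => ?_⟩
    set F : ℕ → 𝓢(E, ℂ) := fun j =>
      concentrated φ (dilatedCutoff Θ χ k) ((2 : ℝ) ^ k • A) a (2 ^ j) with hF
    have h1 : (fun ξ => lacunary φ χ A a c N ((2 : ℝ) ^ k • ξ) * (𝓕 Θ) ξ) =
        ((∑ j ∈ Finset.range N, c j • F j : 𝓢(E, ℂ)) : E → ℂ) := by
      ext ξ
      rw [lacunary_apply, sum_apply, Finset.sum_mul, Finset.sum_mul]
      refine Finset.sum_congr rfl fun j _ => ?_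
      rw [smul_apply, hF, smul_eq_mul, concentrated_apply, dilatedCutoff_apply, A.map_smul,
        smul_apply]
      ring
    rw [h1]
    refine (sobolevENorm_le s u hu.le _).trans (hfin N B c F hN hB hc fun j q x => ?_)
    have h2 : (1 : ℝ) ≤ 2 ^ j := one_le_pow₀ one_le_two
    refine (hcon (2 ^ j) h2 q x).trans ?_
    have hQq := hQ q
    rw [weight]
    have h3 : ρ x ≤ ‖((2 : ℝ) ^ k • A) x - a‖ := by
      have h4 : ((2 : ℝ) ^ k • A) x - a = (2 : ℝ) ^ k • (A x - ((2 : ℝ) ^ k)⁻¹ • a) := by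
        rw [smul_sub, smul_inv_smul₀ hkp.ne', smul_apply]
      rw [h4, norm_smul, Real.norm_of_nonneg hkp.le, hρ]
      have h5 : 0 ≤ (2 : ℝ) ^ k * ‖A x - ((2 : ℝ) ^ k)⁻¹ • a‖ := by positivity
      calc (2 : ℝ) ^ k / 8 * (c₀ * ‖A x - ((2 : ℝ) ^ k)⁻¹ • a‖) =
            c₀ / 8 * ((2 : ℝ) ^ k * ‖A x - ((2 : ℝ) ^ k)⁻¹ • a‖) := by ring
        _ ≤ 1 * ((2 : ℝ) ^ k * ‖A x - ((2 : ℝ) ^ k)⁻¹ • a‖) := by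
            gcongr
            linarith
        _ = _ := one_mul _
    have h6 : 0 < 1 + (2 : ℝ) ^ j * ρ x := by
      linarith [hρt.one_add_pos (ν := (2 : ℝ) ^ j) (by positivity) x]
    refine mul_le_mul_of_nonneg_left (mul_le_mul_of_nonneg_right ?_ (by positivity))
      (by positivity)
    refine Real.rpow_le_rpow_of_nonpos h6 ?_ (by linarith)
    gcongr
  choose! C hC hkey using key
  refine ⟨∑ k ∈ Finset.Icc (-3 : ℤ) 3, C k, Finset.sum_nonneg hC, fun N B c hN hB hc => ?_⟩
  refine hormanderENorm_le hΘ s u hu.le (fun ξ hξ => hχ ξ ?_) fun k hk =>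
    (hkey k hk N B c hN hB hc).trans (ENNReal.ofReal_le_ofReal ?_)
  · rw [lacunary_apply] at hξ
    exact (mul_ne_zero_iff.1 hξ).2
  · have : C k ≤ ∑ k ∈ Finset.Icc (-3 : ℤ) 3, C k := Finset.single_le_sum hC hk
    gcongr

theorem hormanderENorm_oscillating_le {Θ : 𝓢(E, ℂ)}
    (hΘ : ∀ ξ, (𝓕 Θ) ξ ≠ 0 → 1 / 2 ≤ ‖ξ‖ ∧ ‖ξ‖ ≤ 2) {s u : ℝ} (hu : 1 < u) (hs : 0 < s)
    {Φ : E → ℝ} (hΦ : Φ.HasTemperateGrowth)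
    (χ : 𝓢(E, ℂ)) (hχ : ∀ ξ, χ ξ ≠ 0 → 1 / 4 ≤ ‖ξ‖ ∧ ‖ξ‖ ≤ 4) :
    ∃ C : ℝ, 0 ≤ C ∧ ∀ ν : ℝ, 1 ≤ ν →
      hormanderENorm Θ s u hu.le (oscillating Φ χ ν) ≤ ENNReal.ofReal (C * ν ^ s) := by
  have key : ∀ k ∈ Finset.Icc (-3 : ℤ) 3, ∃ C : ℝ, 0 ≤ C ∧ ∀ ν : ℝ, 1 ≤ ν →
      sobolevENorm s u hu.le (fun ξ => oscillating Φ χ ν ((2 : ℝ) ^ k • ξ) * (𝓕 Θ) ξ) ≤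
        ENNReal.ofReal (C * ν ^ s) := by
    intro k _
    have hΦk : (fun ξ => Φ ((2 : ℝ) ^ k • ξ)).HasTemperateGrowth :=
      hΦ.comp (((2 : ℝ) ^ k • ContinuousLinearMap.id ℝ E).hasTemperateGrowth)
    obtain ⟨b, hb, hosc⟩ := eLpNorm_besselPot_oscillating_le (E := E) hu hs
    obtain ⟨Q, hQ, hcon⟩ := norm_iteratedFDeriv_oscillating_le hΦk (dilatedCutoff Θ χ k) b
    obtain ⟨C, hC, hfin⟩ := hosc Q hQ
    refine ⟨C, hC, fun ν hν => ?_⟩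
    have h1 : (fun ξ => oscillating Φ χ ν ((2 : ℝ) ^ k • ξ) * (𝓕 Θ) ξ) =
        (oscillating (fun ξ => Φ ((2 : ℝ) ^ k • ξ)) (dilatedCutoff Θ χ k) ν : E → ℂ) := by
      ext ξ
      rw [oscillating_apply hΦ, oscillating_apply hΦk, dilatedCutoff_apply, mul_assoc]
    rw [h1]
    exact (sobolevENorm_le s u hu.le _).trans (hfin ν _ hν (hcon ν hν))
  choose! C hC hkey using key
  refine ⟨∑ k ∈ Finset.Icc (-3 : ℤ) 3, C k, Finset.sum_nonneg hC, fun ν hν => ?_⟩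
  refine hormanderENorm_le hΘ s u hu.le (fun ξ hξ => hχ ξ ?_) fun k hk =>
    (hkey k hk ν hν).trans (ENNReal.ofReal_le_ofReal ?_)
  · rw [oscillating_apply hΦ] at hξ
    exact (mul_ne_zero_iff.1 hξ).2
  · have : C k ≤ ∑ k ∈ Finset.Icc (-3 : ℤ) 3, C k := Finset.single_le_sum hC hk
    have hν0 : 0 ≤ ν := by linarith
    gcongr

end Hormander

/-! ### Smooth bump functions -/

section Bumps

variable {V : Type*} [NormedAddCommGroup V] [InnerProductSpace ℝ V]
  [FiniteDimensional ℝ V] [MeasurableSpace V] [BorelSpace V]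

theorem exists_schwartz_bump (c : V) {r R : ℝ} (hr : 0 < r) (hrR : r < R) :
    ∃ ψ : 𝓢(V, ℂ), (∀ x, ‖x - c‖ ≤ r → ψ x = 1) ∧ (∀ x, R ≤ ‖x - c‖ → ψ x = 0) ∧
      (∃ g : V → ℝ, (∀ x, ψ x = g x) ∧ ∀ x, g (c + x) = g (c - x)) ∧ ∫ x, ψ x ≠ 0 := by
  set f : ContDiffBump c := ⟨r, R, hr, hrR⟩ with hf
  have hs : HasCompactSupport (fun x => (f x : ℂ)) :=
    f.hasCompactSupport.comp_left (g := fun t : ℝ => (t : ℂ)) Complex.ofReal_zero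
  refine ⟨hs.toSchwartzMap (Complex.ofRealCLM.contDiff.comp f.contDiff), fun x hx => ?_,
    fun x hx => ?_, ⟨f, fun x => rfl, fun x => (f.sub x).symm⟩, ?_⟩
  · have : f x = 1 := f.one_of_mem_closedBall (by rw [Metric.mem_closedBall, dist_eq_norm]; exact hx)
    change (f x : ℂ) = 1
    rw [this, Complex.ofReal_one]
  · have : f x = 0 := f.zero_of_le_dist (by rw [dist_eq_norm]; exact hx)
    change (f x : ℂ) = 0
    rw [this, Complex.ofReal_zero]
  · change ∫ x, (f x : ℂ) ≠ 0
    rw [integral_complex_ofReal, Complex.ofReal_ne_zero]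
    exact f.integral_pos.ne'

end Bumps

/-! ### Two cases in which `T_m` is explicit -/

section Operator

variable {n : ℕ}

/-- The map `(ξ₁, ξ₂) ↦ ξ₁ + ξ₂`. -/
def sumCLM (n : ℕ) : R2n n →L[ℝ] Rn n :=
  WithLp.fstL 2 ℝ (Rn n) (Rn n) + WithLp.sndL 2 ℝ (Rn n) (Rn n)

theorem sumCLM_apply (ξ : R2n n) : sumCLM n ξ = ξ.fst + ξ.snd := rfl

/-- The multiplier is invisible on the frequency supports, and the integral factors into two
inversion formulas. -/
theorem bilinearOp_eq_mul (m : R2n n → ℂ) (f₁ f₂ : 𝓢(Rn n, ℂ))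
    (h : ∀ ξ, 𝓕 f₁ ξ.fst ≠ 0 → 𝓕 f₂ ξ.snd ≠ 0 → m ξ = 1) (x : Rn n) :
    bilinearOp m f₁ f₂ x = f₁ x * f₂ x := by
  rw [bilinearOp, integral_R2n, apply_eq_integral_fourier f₁ x, apply_eq_integral_fourier f₂ x,
    ← integral_prod_mul]
  refine integral_congr_ae (Filter.Eventually.of_forall fun p => ?_)
  have h1 : m (WithLp.toLp 2 p) * 𝓕 f₁ p.1 * 𝓕 f₂ p.2 = 𝓕 f₁ p.1 * 𝓕 f₂ p.2 := by
    by_cases h2 : 𝓕 f₁ p.1 = 0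
    · rw [h2, mul_zero]
    · by_cases h3 : 𝓕 f₂ p.2 = 0
      · rw [h3, mul_zero, mul_zero]
      · rw [h (WithLp.toLp 2 p) h2 h3, one_mul]
  change m (WithLp.toLp 2 p) * 𝓕 f₁ p.1 * 𝓕 f₂ p.2 *
    Complex.exp (2 * Real.pi * Complex.I * (inner ℝ x (p.1 + p.2) : ℝ)) = _
  rw [h1]
  beta_reduce
  rw [mul_mul_mul_comm, ← Complex.exp_add, mul_comm, inner_add_right, real_inner_comm,
    real_inner_comm p.2]
  congr 2
  push_cast
  ring

/-- The character depends only on `ξ₁ + ξ₂`, so translating `ξ₁` by `ξ₂` separates the variables. -/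
theorem bilinearOp_eq_smul (m : R2n n → ℂ) (f₁ f₂ a γ : 𝓢(Rn n, ℂ))
    (h : ∀ ξ, m ξ * 𝓕 f₁ ξ.fst * 𝓕 f₂ ξ.snd = a (ξ.fst + ξ.snd) * γ ξ.snd) (x : Rn n) :
    bilinearOp m f₁ f₂ x = (∫ y, γ y) * 𝓕⁻ a x := by
  set e : Rn n → ℂ := fun η => Complex.exp (↑(2 * Real.pi * inner ℝ η x) * Complex.I) with he
  have hen : ∀ η, ‖e η‖ = 1 := fun η => norm_exp_real_mul_I _
  have h1 : bilinearOp m f₁ f₂ x = ∫ p : Rn n × Rn n, a (p.1 + p.2) * γ p.2 * e (p.1 + p.2) := by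
    rw [bilinearOp, integral_R2n]
    refine integral_congr_ae (Filter.Eventually.of_forall fun p => ?_)
    simp only
    rw [h]
    change a (p.1 + p.2) * γ p.2 *
      Complex.exp (2 * Real.pi * Complex.I * (inner ℝ x (p.1 + p.2) : ℝ)) = _
    simp only [he]
    rw [real_inner_comm x]
    congr 2
    push_cast
    ring
  have hi : Integrable (fun p : Rn n × Rn n => a (p.1 + p.2) * γ p.2 * e (p.1 + p.2))
      ((volume : Measure (Rn n)).prod volume) := by
    have hc : Continuous fun p : Rn n × Rn n => a (p.1 + p.2) * γ p.2 * e (p.1 + p.2) := by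
      fun_prop
    rw [integrable_prod_iff' hc.aestronglyMeasurable]
    have hn : ∀ y z : Rn n, ‖a (z + y) * γ y * e (z + y)‖ = ‖a (z + y)‖ * ‖γ y‖ := fun y z => by
      rw [norm_mul, norm_mul, hen, mul_one]
    refine ⟨Filter.Eventually.of_forall fun y => ?_, ?_⟩
    · have h2 : Integrable fun z => ‖a (z + y)‖ * ‖γ y‖ :=
        (a.integrable.comp_add_right y).norm.mul_const _
      refine h2.mono' (hc.comp (Continuous.prodMk_left y)).aestronglyMeasurable
        (Filter.Eventually.of_forall fun z => (hn y z).le)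
    · simp only [hn]
      have h3 : ∀ y : Rn n, ∫ z, ‖a (z + y)‖ * ‖γ y‖ = (∫ z, ‖a z‖) * ‖γ y‖ := fun y => by
        rw [integral_mul_const, integral_add_right_eq_self (fun z => ‖a z‖) y]
      simp only [h3]
      exact γ.integrable.norm.const_mul _
  rw [h1, Measure.volume_eq_prod, integral_prod_symm _ hi]
  have h4 : ∀ y : Rn n, ∫ z, a (z + y) * γ y * e (z + y) = γ y * 𝓕⁻ a x := by
    intro y
    have h5 : ∀ z, a (z + y) * γ y * e (z + y) = γ y * (e (z + y) * a (z + y)) := fun z => by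
      ring
    simp_rw [h5]
    rw [integral_const_mul, integral_add_right_eq_self (fun z => e z * a z) y, SchwartzMap.fourierInv_coe,
      Real.fourierInv_eq']
    rfl
  simp_rw [h4]
  exact integral_mul_const _ _

end Operator

/-! ### Scaling and the reduction to real inequalities -/

section Testing

theorem le_of_forall_mul_rpow_le {c K X Y : ℝ} (hc : 0 < c)
    (h : ∀ N : ℕ, 1 ≤ N → c * (N : ℝ) ^ X ≤ K * (N : ℝ) ^ Y) : X ≤ Y := by
  by_contra! hlt
  have ht : Filter.Tendsto (fun N : ℕ => K * (N : ℝ) ^ (-(X - Y))) Filter.atTop (nhds (K * 0)) :=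
    ((tendsto_rpow_neg_atTop (by linarith : 0 < X - Y)).comp tendsto_natCast_atTop_atTop).const_mul K
  rw [mul_zero] at ht
  obtain ⟨N, hN1, hN⟩ := ((Filter.eventually_ge_atTop 1).and (ht.eventually_lt_const hc)).exists
  have hNp : (0 : ℝ) < N := by exact_mod_cast hN1
  have h1 := h N hN1
  have h2 : (N : ℝ) ^ Y = (N : ℝ) ^ (-(X - Y)) * (N : ℝ) ^ X := by
    rw [← Real.rpow_add hNp]
    ring_nf
  rw [h2, ← mul_assoc] at h1
  exact absurd (le_of_mul_le_mul_right h1 (by positivity)) (not_le.2 hN)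

theorem exists_unit_vector {n : ℕ} (hn : 0 < n) : ∃ e : Rn n, ‖e‖ = 1 :=
  ⟨EuclideanSpace.single ⟨0, hn⟩ 1, by simp⟩

theorem eLpNorm_comp_inv_smul {n : ℕ} {p R : ℝ} (hp : 0 < p) (hR : 0 < R) {g : Rn n → ℂ}
    (hg : Continuous g) : eLpNorm (fun x => g (R⁻¹ • x)) (ENNReal.ofReal p) volume =
      ENNReal.ofReal (R ^ (n / p)) * eLpNorm g (ENNReal.ofReal p) volume := by
  have hR' : R⁻¹ ≠ 0 := by positivity
  have h1 := eLpNorm_map_measure (μ := (volume : Measure (Rn n))) (p := ENNReal.ofReal p)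
    (f := fun x : Rn n => R⁻¹ • x) (g := g) hg.aestronglyMeasurable
    (measurable_const_smul R⁻¹).aemeasurable
  have h2 : (g ∘ fun x : Rn n => R⁻¹ • x) = fun x => g (R⁻¹ • x) := rfl
  rw [← h2, ← h1, Measure.map_addHaar_smul volume hR', finrank_euclideanSpace_fin,
    eLpNorm_smul_measure_of_ne_top ENNReal.ofReal_ne_top, smul_eq_mul]
  congr 1
  rw [ENNReal.toReal_div, ENNReal.toReal_one, ENNReal.toReal_ofReal hp.le,
    ENNReal.ofReal_rpow_of_nonneg (abs_nonneg _) (by positivity)]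
  congr 1
  rw [abs_of_pos (by positivity), inv_pow, inv_inv, ← Real.rpow_natCast, ← Real.rpow_mul hR.le]
  congr 1
  ring

theorem eLpNorm_of_norm_eq_scaled {n : ℕ} {p R c : ℝ} (hp : 0 < p) (hR : 0 < R) (hc : 0 ≤ c)
    {g f : Rn n → ℂ} (hg : Continuous g) (h : ∀ x, ‖f x‖ = c * ‖g (R⁻¹ • x)‖) :
    eLpNorm f (ENNReal.ofReal p) volume =
      ENNReal.ofReal (c * R ^ (n / p)) * eLpNorm g (ENNReal.ofReal p) volume := by
  have h1 : eLpNorm f (ENNReal.ofReal p) volume =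
      eLpNorm (c • fun x => g (R⁻¹ • x)) (ENNReal.ofReal p) volume := by
    refine eLpNorm_congr_norm_ae (Filter.Eventually.of_forall fun x => ?_)
    rw [h, Pi.smul_apply, norm_smul, Real.norm_of_nonneg hc]
  rw [h1, eLpNorm_const_smul, eLpNorm_comp_inv_smul hp hR hg, ENNReal.ofReal_mul hc, mul_assoc,
    Real.enorm_of_nonneg hc]

/-- The cutoff `h` is one on the support, so this is a translated and dilated `ψ`: dilation gives
`R^(-n)`, translation a factor of modulus one. -/
theorem fourierInv_concentrated {n : ℕ} (ψ h : 𝓢(Rn n, ℂ)) (e : Rn n) {R : ℝ} (hR : 0 < R)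
    (hh : ∀ η, ψ (R • (η - e)) ≠ 0 → h η = 1) (x : Rn n) :
    𝓕⁻ (concentrated ψ h (ContinuousLinearMap.id ℝ (Rn n)) e R) x =
      ((R ^ (-(n : ℝ)) : ℝ) : ℂ) * Complex.exp (↑(2 * Real.pi * inner ℝ e x) * Complex.I) *
        𝓕⁻ ψ (R⁻¹ • x) := by
  set G : Rn n → ℂ := fun ζ => Complex.exp (↑(2 * Real.pi * inner ℝ ζ (R⁻¹ • x)) * Complex.I) * ψ ζ
    with hG
  have h1 : ∀ η, Complex.exp (↑(2 * Real.pi * inner ℝ η x) * Complex.I) *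
      concentrated ψ h (ContinuousLinearMap.id ℝ (Rn n)) e R η =
      Complex.exp (↑(2 * Real.pi * inner ℝ e x) * Complex.I) * G (R • (η - e)) := by
    intro η
    have h2 : concentrated ψ h (ContinuousLinearMap.id ℝ (Rn n)) e R η = ψ (R • (η - e)) := by
      rw [concentrated_apply, ContinuousLinearMap.id_apply]
      by_cases h3 : ψ (R • (η - e)) = 0
      · rw [h3, zero_mul]
      · rw [hh η h3, mul_one]
    rw [h2, hG]
    beta_reduce
    rw [← mul_assoc, ← Complex.exp_add, real_inner_smul_left, real_inner_smul_right,
      mul_inv_cancel_left₀ hR.ne', inner_sub_left]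
    congr 2
    push_cast
    ring
  have h4 : ∀ (f : 𝓢(Rn n, ℂ)) (y : Rn n), 𝓕⁻ f y =
      ∫ η, Complex.exp (↑(2 * Real.pi * inner ℝ η y) * Complex.I) * f η := fun f y => by
    rw [SchwartzMap.fourierInv_coe, Real.fourierInv_eq']
    rfl
  rw [h4, h4 ψ]
  simp_rw [h1]
  rw [integral_const_mul, integral_sub_right_eq_self (fun η => G (R • η)) e,
    Measure.integral_comp_smul, finrank_euclideanSpace_fin, Complex.real_smul,
    abs_of_pos (by positivity), Real.rpow_neg hR.le, Real.rpow_natCast]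
  ring

theorem norm_fst_le {n : ℕ} (ξ : R2n n) : ‖ξ.fst‖ ≤ ‖ξ‖ := by
  rw [WithLp.prod_norm_eq_of_L2]
  exact Real.le_sqrt_of_sq_le (by nlinarith [sq_nonneg ‖ξ.snd‖])

theorem norm_le_fst_add_snd {n : ℕ} (ξ : R2n n) : ‖ξ‖ ≤ ‖ξ.fst‖ + ‖ξ.snd‖ := by
  rw [WithLp.prod_norm_eq_of_L2]
  refine Real.sqrt_le_iff.2 ⟨by positivity, ?_⟩
  nlinarith [mul_nonneg (norm_nonneg ξ.fst) (norm_nonneg ξ.snd)]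

/-- The multiplier estimate of the theorem, in terms of real numbers and Schwartz multipliers. -/
def MultiplierBound {n : ℕ} (p₁ p₂ p u s : ℝ) (hu : 1 ≤ u) (Θ : 𝓢(R2n n, ℂ)) (C : ℝ) : Prop :=
  ∀ (m : 𝓢(R2n n, ℂ)) (f₁ f₂ : 𝓢(Rn n, ℂ)) (α h β₁ β₂ : ℝ), 0 ≤ h → 0 ≤ β₁ → 0 ≤ β₂ →
    hormanderENorm Θ s u hu m ≤ ENNReal.ofReal h →
    eLpNorm f₁ (ENNReal.ofReal p₁) volume ≤ ENNReal.ofReal β₁ →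
    eLpNorm f₂ (ENNReal.ofReal p₂) volume ≤ ENNReal.ofReal β₂ →
    ENNReal.ofReal α ≤ eLpNorm (bilinearOp m f₁ f₂) (ENNReal.ofReal p) volume →
    α ≤ C * h * β₁ * β₂

/-- A Schwartz multiplier is bounded and measurable, and the assumed real bound `h` makes its
Hörmander norm finite, so the hypothesis applies to it. -/
theorem exists_multiplierBound {n : ℕ} {p₁ p₂ p u s : ℝ} (hu : 1 ≤ u) (Θ : 𝓢(R2n n, ℂ))
    (hbdd : ∃ C : ℝ≥0, ∀ m : R2n n → ℂ, Measurable m → (∃ B : ℝ, ∀ ξ, ‖m ξ‖ ≤ B) →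
      hormanderENorm Θ s u hu m < ∞ → ∀ f₁ f₂ : 𝓢(Rn n, ℂ),
        eLpNorm (bilinearOp m f₁ f₂) (ENNReal.ofReal p) volume ≤
          C * hormanderENorm Θ s u hu m *
            eLpNorm f₁ (ENNReal.ofReal p₁) volume * eLpNorm f₂ (ENNReal.ofReal p₂) volume) :
    ∃ C : ℝ, MultiplierBound p₁ p₂ p u s hu Θ C := by
  obtain ⟨C, hC⟩ := hbdd
  refine ⟨C, fun m f₁ f₂ α h β₁ β₂ hh hβ₁ hβ₂ hm h1 h2 hα => ?_⟩
  have hB : ∃ B : ℝ, ∀ ξ, ‖m ξ‖ ≤ B := by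
    obtain ⟨B, -, hB⟩ := exists_norm_iteratedFDeriv_le m 0 0
    refine ⟨B, fun ξ => ?_⟩
    simpa using hB 0 le_rfl ξ
  have h3 := hC m m.continuous.measurable hB (hm.trans_lt ENNReal.ofReal_lt_top) f₁ f₂
  have h4 : ENNReal.ofReal α ≤ ENNReal.ofReal (C * h * β₁ * β₂) := by
    refine hα.trans (h3.trans ?_)
    rw [ENNReal.ofReal_mul (by positivity), ENNReal.ofReal_mul (by positivity),
      ENNReal.ofReal_mul (by positivity), ENNReal.ofReal_coe_nnreal]
    gcongr
  exact (ENNReal.ofReal_le_ofReal_iff (by positivity)).1 h4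

theorem exists_eLpNorm_le {n : ℕ} (f : 𝓢(Rn n, ℂ)) (p : ℝ) :
    ∃ κ : ℝ, 0 ≤ κ ∧ eLpNorm f (ENNReal.ofReal p) volume ≤ ENNReal.ofReal κ := by
  have hf : MemLp f (ENNReal.ofReal p) (volume : Measure (Rn n)) := f.memLp _ _
  exact ⟨_, ENNReal.toReal_nonneg, (ENNReal.ofReal_toReal hf.2.ne).ge⟩

theorem exists_le_eLpNorm {n : ℕ} {p : ℝ} (hp : 0 < p) {f : Rn n → ℂ} (hf : Continuous f)
    (hf0 : f ≠ 0) : ∃ κ : ℝ, 0 < κ ∧ ENNReal.ofReal κ ≤ eLpNorm f (ENNReal.ofReal p) volume := by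
  have h0 : eLpNorm f (ENNReal.ofReal p) volume ≠ 0 := by
    rw [Ne, eLpNorm_eq_zero_iff hf.aestronglyMeasurable (by simpa using hp)]
    exact fun h => hf0 (hf.ae_eq_iff_eq volume continuous_zero |>.1 h)
  obtain ⟨κ, hκ, hκ'⟩ := ENNReal.lt_iff_exists_nnreal_btwn.1 (pos_iff_ne_zero.2 h0)
  refine ⟨κ, by exact_mod_cast hκ, ?_⟩
  rw [ENNReal.ofReal_coe_nnreal]
  exact hκ'.le

theorem fourierInv_ne_zero {n : ℕ} {ψ : 𝓢(Rn n, ℂ)} (h : ψ ≠ 0) : (𝓕⁻ ψ : 𝓢(Rn n, ℂ)) ≠ 0 := by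
  intro h0
  have h1 : 𝓕 (𝓕⁻ ψ) = ψ := FourierTransform.fourier_fourierInv_eq ψ
  rw [h0] at h1
  refine h (h1.symm.trans ?_)
  exact (SchwartzMap.fourierTransformCLM ℂ).map_zero

end Testing

/-! ### Necessity of `s/n > 2/u`: concentration at a point -/

section Concentration

variable {n : ℕ} {p₁ p₂ p u s : ℝ} {Θ : 𝓢(R2n n, ℂ)}

/-- The test multiplier is an average of `N` dyadic bumps around `ξ₀ = (e, 0)`. It acts as the
identity symbol on the chosen inputs, but its norm is `O(N^(1/u - 1))`. -/
theorem two_div_lt_of_multiplierBound (hn : 0 < n) (hp₁ : 1 < p₁) (hp₂ : 1 < p₂)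
    (hp : 1 / p = 1 / p₁ + 1 / p₂) (hu : 1 < u) (hs : 0 < s)
    (hΘ : ∀ ξ, (𝓕 Θ) ξ ≠ 0 → 1 / 2 ≤ ‖ξ‖ ∧ ‖ξ‖ ≤ 2) {C : ℝ}
    (hC : MultiplierBound p₁ p₂ p u s hu.le Θ C) : 2 / u < s / n := by
  by_contra! hle
  have hnp : (0 : ℝ) < n := by exact_mod_cast hn
  have hp0 : 0 < p := by
    have : 0 < 1 / p := by rw [hp]; positivity
    exact one_div_pos.1 this
  have hsl : s ≤ 2 * n / u := by
    rw [div_le_iff₀ hnp] at hle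
    linarith [show 2 / u * n = 2 * n / u by ring]
  obtain ⟨e, he⟩ := exists_unit_vector hn
  set ξ₀ : R2n n := WithLp.toLp 2 (e, 0) with hξ₀
  have hξ₀n : ‖ξ₀‖ = 1 := by
    rw [hξ₀, WithLp.prod_norm_eq_of_L2]
    simp [he]
  obtain ⟨χ, hχ1, hχ0, -, -⟩ := exists_schwartz_bump ξ₀ (r := 1 / 4) (R := 1 / 2) (by norm_num)
    (by norm_num)
  obtain ⟨φ, hφ1, -, -, -⟩ := exists_schwartz_bump (0 : R2n n) (r := 1) (R := 2) (by norm_num)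
    (by norm_num)
  obtain ⟨ψ, hψ1, hψ0, -, -⟩ := exists_schwartz_bump (0 : Rn n) (r := 1 / 2) (R := 1) (by norm_num)
    (by norm_num)
  have hχs : ∀ ξ, χ ξ ≠ 0 → 1 / 4 ≤ ‖ξ‖ ∧ ‖ξ‖ ≤ 4 := by
    intro ξ hξ
    have h1 : ‖ξ - ξ₀‖ < 1 / 2 := by
      by_contra! h
      exact hξ (hχ0 ξ h)
    have h2 := abs_norm_sub_norm_le ξ ξ₀
    rw [hξ₀n, abs_le] at h2
    constructor <;> linarith
  have hfin : (Module.finrank ℝ (R2n n) : ℝ) = 2 * n := by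
    rw [LinearEquiv.finrank_eq (WithLp.linearEquiv 2 ℝ (Rn n × Rn n)), Module.finrank_prod,
      finrank_euclideanSpace_fin]
    push_cast
    ring
  obtain ⟨C', hC', hlac⟩ := hormanderENorm_lacunary_le hΘ hu hs
    (ContinuousLinearMap.id ℝ (R2n n)) ξ₀ (l := 2 * n) (c₀ := 1) (by positivity) le_rfl
    (fun a => by simpa [hfin] using isThin_norm_sub a) φ χ hχs
  set η : 𝓢(Rn n, ℂ) := 𝓕⁻ ψ with hη
  have hψne : ψ ≠ 0 := fun h => by
    have := hψ1 0 (by simp)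
    rw [h] at this
    simp at this
  have hηne : η ≠ 0 := fourierInv_ne_zero hψne
  obtain ⟨κ, hκ, hκ'⟩ := exists_le_eLpNorm hp0 (f := fun x => η x * η x) (by fun_prop) (by
    intro h
    refine hηne (SchwartzMap.ext fun x => ?_)
    simpa using congrFun h x)
  obtain ⟨κ₁, hκ₁, hκ₁'⟩ := exists_eLpNorm_le η p₁
  obtain ⟨κ₂, hκ₂, hκ₂'⟩ := exists_eLpNorm_le η p₂
  have hfinal : ∀ N : ℕ, 1 ≤ N →
      κ * (N : ℝ) ^ (0 : ℝ) ≤ (C * C' * κ₁ * κ₂) * (N : ℝ) ^ (1 / u - 1) := by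
    intro N hN
    have hNp : (0 : ℝ) < N := by exact_mod_cast hN
    -- Frequencies of `f₁, f₂` lie within `1/R` of `e` and `0`, so `|ξ - ξ₀| ≤ 2/R`. Then `2^j |ξ -
    -- ξ₀| ≤ 1` for every `j < N`, where `φ = 1`, and `2/R ≤ 1/4`, where `χ = 1`.
    set R : ℝ := 2 ^ (N + 2) with hR
    have hRp : 0 < R := by positivity
    have hR1 : 1 ≤ R := one_le_pow₀ one_le_two
    have hψs : ∀ (c η : Rn n), ψ (R • (η - c)) ≠ 0 → R * ‖η - c‖ < 1 := by
      intro c η h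
      by_contra! h1
      refine h (hψ0 _ ?_)
      rwa [sub_zero, norm_smul, Real.norm_of_nonneg hRp.le]
    have hex : ∀ c : Rn n, ∃ f : 𝓢(Rn n, ℂ), (∀ ξ, 𝓕 f ξ ≠ 0 → R * ‖ξ - c‖ < 1) ∧
        ∀ x, ‖f x‖ = R ^ (-(n : ℝ)) * ‖η (R⁻¹ • x)‖ := by
      intro c
      obtain ⟨g, hg1, -, -, -⟩ := exists_schwartz_bump c (r := 1) (R := 2) (by norm_num)
        (by norm_num)
      refine ⟨𝓕⁻ (concentrated ψ g (ContinuousLinearMap.id ℝ (Rn n)) c R), fun ξ hξ => ?_,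
        fun x => ?_⟩
      · rw [FourierTransform.fourier_fourierInv_eq, concentrated_apply] at hξ
        exact hψs c ξ (mul_ne_zero_iff.1 hξ).1
      · rw [fourierInv_concentrated ψ g c hRp (fun ξ hξ => hg1 ξ ?_), norm_mul, norm_mul,
          norm_exp_real_mul_I, mul_one, Complex.norm_real, Real.norm_of_nonneg (by positivity)]
        have h1 := hψs c ξ hξ
        nlinarith [norm_nonneg (ξ - c)]
    obtain ⟨f₁, hf₁, hf₁n⟩ := hex e
    obtain ⟨f₂, hf₂, hf₂n⟩ := hex 0
    set m := lacunary φ χ (ContinuousLinearMap.id ℝ (R2n n)) ξ₀ (fun _ => (N : ℂ)⁻¹) N with hm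
    have hmH := hlac N (N : ℝ)⁻¹ (fun _ => (N : ℂ)⁻¹) hN (by positivity) (fun j => by
      rw [norm_inv, Complex.norm_natCast]
      have h2 : (1 : ℝ) ≤ 2 ^ j := one_le_pow₀ one_le_two
      gcongr)
    have hT : ∀ x, bilinearOp m f₁ f₂ x = f₁ x * f₂ x := by
      refine bilinearOp_eq_mul m f₁ f₂ fun ξ h1 h2 => ?_
      have h3 := hf₁ _ h1
      have h4 := hf₂ _ h2
      have h5 : R * ‖ξ - ξ₀‖ ≤ 2 := by
        have h6 := mul_le_mul_of_nonneg_left (norm_le_fst_add_snd (ξ - ξ₀)) hRp.le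
        change R * ‖ξ - ξ₀‖ ≤ R * (‖ξ.fst - e‖ + ‖ξ.snd - 0‖) at h6
        linarith
      rw [hm, lacunary_apply]
      have h7 : χ ξ = 1 := by
        refine hχ1 ξ ?_
        have h8 : (8 : ℝ) ≤ R := by
          calc (8 : ℝ) = 2 ^ 3 := by norm_num
            _ ≤ R := pow_le_pow_right₀ one_le_two (by omega)
        nlinarith [norm_nonneg (ξ - ξ₀)]
      have h9 : ∀ j ∈ Finset.range N, (N : ℂ)⁻¹ *
          φ ((2 : ℝ) ^ j • ((ContinuousLinearMap.id ℝ (R2n n)) ξ - ξ₀)) = (N : ℂ)⁻¹ := by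
        intro j hj
        rw [hφ1, mul_one]
        rw [sub_zero, ContinuousLinearMap.id_apply, norm_smul, Real.norm_of_nonneg (by positivity)]
        have h10 : 2 * (2 : ℝ) ^ j ≤ R := by
          rw [← pow_succ']
          exact pow_le_pow_right₀ one_le_two (by
            have := Finset.mem_range.1 hj
            omega)
        nlinarith [norm_nonneg (ξ - ξ₀)]
      rw [h7, Finset.sum_congr rfl h9, Finset.sum_const, Finset.card_range, nsmul_eq_mul, mul_one,
        mul_inv_cancel₀ (by exact_mod_cast hNp.ne')]
    have hα : ENNReal.ofReal (R ^ (-(n : ℝ)) * R ^ (-(n : ℝ)) * R ^ (n / p) * κ) ≤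
        eLpNorm (bilinearOp m f₁ f₂) (ENNReal.ofReal p) volume := by
      rw [eLpNorm_of_norm_eq_scaled (R := R) (c := R ^ (-(n : ℝ)) * R ^ (-(n : ℝ)))
        (g := fun x => η x * η x) hp0 hRp (by positivity) (by fun_prop) (fun x => by
          rw [hT, norm_mul, hf₁n, hf₂n, norm_mul]
          ring), ENNReal.ofReal_mul (by positivity)]
      exact mul_le_mul' le_rfl hκ'
    have hβ : ∀ (f : 𝓢(Rn n, ℂ)) (q κ : ℝ), 0 < q → (∀ x, ‖f x‖ = R ^ (-(n : ℝ)) * ‖η (R⁻¹ • x)‖) →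
        eLpNorm η (ENNReal.ofReal q) volume ≤ ENNReal.ofReal κ →
        eLpNorm f (ENNReal.ofReal q) volume ≤
          ENNReal.ofReal (R ^ (-(n : ℝ)) * R ^ (n / q) * κ) := by
      intro f q κ hq hf hκ
      rw [eLpNorm_of_norm_eq_scaled (R := R) hq hRp (by positivity) η.continuous hf,
        ENNReal.ofReal_mul (p := R ^ (-(n : ℝ)) * R ^ (n / q)) (by positivity)]
      exact mul_le_mul' le_rfl hκ
    have h1 := hC m f₁ f₂ _ _ _ _ (by positivity) (by positivity) (by positivity) hmH
      (hβ f₁ p₁ κ₁ (by linarith) hf₁n hκ₁') (hβ f₂ p₂ κ₂ (by linarith) hf₂n hκ₂') hα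
    -- The Hölder relation cancels all powers of `R`, leaving only powers of `N`.
    have h2 : R ^ (n / p) = R ^ (n / p₁) * R ^ (n / p₂) := by
      rw [← Real.rpow_add hRp]
      congr 1
      rw [div_eq_mul_one_div, hp]
      ring
    have h3 : (N : ℝ) ^ (1 / u - 1) = (N : ℝ)⁻¹ * (N : ℝ) ^ (1 / u) := by
      rw [Real.rpow_sub_one hNp.ne']
      ring
    rw [h2] at h1
    rw [h3, Real.rpow_zero, mul_one]
    refine le_of_mul_le_mul_left (a := R ^ (-(n : ℝ)) * R ^ (-(n : ℝ)) *
      (R ^ (n / p₁) * R ^ (n / p₂))) ?_ (by positivity)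
    linarith
  have := le_of_forall_mul_rpow_le hκ hfinal
  have h2 : 1 / u < 1 := by
    rw [div_lt_one (by linarith)]
    exact hu
  linarith

end Concentration

/-! ### Lower bound for sums of dyadic dilates -/

section LowerBounds

theorem le_eLpNorm_of_le_lintegral {X : Type*} [MeasurableSpace X] {μ : Measure X} {p B : ℝ}
    (hp : 0 < p) (hB : 0 ≤ B) {f : X → ℂ} (h : ENNReal.ofReal B ≤ ∫⁻ x, ‖f x‖ₑ ^ p ∂μ) :
    ENNReal.ofReal (B ^ (1 / p)) ≤ eLpNorm f (ENNReal.ofReal p) μ := by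
  rw [eLpNorm_eq_lintegral_rpow_enorm_toReal (by simpa using hp) ENNReal.ofReal_ne_top,
    ENNReal.toReal_ofReal hp.le, ← ENNReal.ofReal_rpow_of_nonneg hB (by positivity)]
  exact ENNReal.rpow_le_rpow h (by positivity)

/-- The dyadic shell `{2^j δ / 2 ≤ ‖x‖ < 2^j δ}`. -/
def dyadicShell (n : ℕ) (δ : ℝ) (j : ℕ) : Set (Rn n) :=
  (fun x => ‖x‖) ⁻¹' Set.Ico (2 ^ j * (δ / 2)) (2 ^ (j + 1) * (δ / 2))

theorem measurableSet_dyadicShell (n : ℕ) (δ : ℝ) (j : ℕ) : MeasurableSet (dyadicShell n δ j) :=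
  measurable_norm measurableSet_Ico

theorem pairwise_disjoint_dyadicShell (n : ℕ) {δ : ℝ} (hδ : 0 < δ) :
    Pairwise (Function.onFun Disjoint (dyadicShell n δ)) := by
  have hm : Monotone fun j : ℕ => (2 : ℝ) ^ j * (δ / 2) := fun i j hij =>
    mul_le_mul_of_nonneg_right (pow_le_pow_right₀ one_le_two hij) (by positivity)
  exact fun i j hij => (hm.pairwise_disjoint_on_Ico_succ hij).preimage _

open scoped Pointwise in
theorem volume_dyadicShell (n : ℕ) (δ : ℝ) (j : ℕ) :
    volume (dyadicShell n δ j) = ENNReal.ofReal (((2 : ℝ) ^ j) ^ n) * volume (dyadicShell n δ 0) := by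
  have h2 : (0 : ℝ) < 2 ^ j := by positivity
  have h1 : dyadicShell n δ j = (2 : ℝ) ^ j • dyadicShell n δ 0 := by
    ext x
    rw [Set.mem_smul_set_iff_inv_smul_mem₀ h2.ne']
    simp only [dyadicShell, Set.mem_preimage, Set.mem_Ico, norm_smul, norm_inv,
      Real.norm_of_nonneg h2.le, pow_zero, zero_add, pow_one, one_mul]
    rw [le_inv_mul_iff₀ h2, inv_mul_lt_iff₀ h2, pow_succ, mul_assoc]
  rw [h1, Measure.addHaar_smul, finrank_euclideanSpace_fin, abs_of_pos (by positivity)]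

theorem volume_dyadicShell_zero_pos {n : ℕ} (hn : 0 < n) {δ : ℝ} (hδ : 0 < δ) :
    0 < volume (dyadicShell n δ 0) := by
  obtain ⟨e, he⟩ := exists_unit_vector hn
  have ho : IsOpen ((fun x : Rn n => ‖x‖) ⁻¹' Set.Ioo (δ / 2) δ) := isOpen_Ioo.preimage continuous_norm
  have hne : ((fun x : Rn n => ‖x‖) ⁻¹' Set.Ioo (δ / 2) δ).Nonempty := by
    refine ⟨(3 / 4 * δ) • e, ?_⟩
    rw [Set.mem_preimage, norm_smul, he, mul_one, Real.norm_of_nonneg (by positivity)]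
    constructor <;> linarith
  refine (ho.measure_pos volume hne).trans_le (measure_mono fun x hx => ?_)
  rw [dyadicShell, Set.mem_preimage, pow_zero, one_mul, zero_add, pow_one, mul_div_cancel₀ _ two_ne_zero]
  exact ⟨hx.1.le, hx.2⟩

theorem volume_dyadicShell_zero_ne_top (n : ℕ) (δ : ℝ) : volume (dyadicShell n δ 0) ≠ ∞ := by
  refine ((measure_mono fun x hx => ?_).trans_lt (measure_ball_lt_top (x := (0 : Rn n)) (r := δ))).ne
  rw [dyadicShell, Set.mem_preimage, zero_add, pow_one, mul_div_cancel₀ _ two_ne_zero] at hx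
  rw [mem_ball_zero_iff]
  exact hx.2

/-- Dyadic dilates of a nonnegative profile, normalised in `L^p`, are essentially disjoint. -/
theorem exists_le_eLpNorm_sum_dyadic {n : ℕ} (hn : 0 < n) {p : ℝ} (hp : 0 < p) {r : Rn n → ℝ}
    (hr : Continuous r) (hr0 : ∀ x, 0 ≤ r x) (hr1 : 0 < r 0) :
    ∃ c : ℝ, 0 < c ∧ ∀ (N : ℕ) (f : Rn n → ℂ),
      (∀ x, ‖f x‖ = ∑ j ∈ Finset.range N, ((2 : ℝ) ^ j) ^ (-(n / p)) * r (((2 : ℝ) ^ j)⁻¹ • x)) →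
      ENNReal.ofReal (c * (N : ℝ) ^ (1 / p)) ≤ eLpNorm f (ENNReal.ofReal p) volume := by
  -- The profile exceeds `κ` on a ball of radius `δ`, so the `j`-th summand is large on the shell
  -- `|x| ~ 2^j δ`. The shells are disjoint and each contributes the same amount to `∫ |f|^p`. The
  -- other summands only help, being nonnegative.
  set κ := r 0 / 2 with hκ
  have hκ0 : 0 < κ := by positivity
  obtain ⟨δ, hδ, hball⟩ := Metric.eventually_nhds_iff.1
    (hr.continuousAt.eventually (lt_mem_nhds (show κ < r 0 by linarith)))
  set v := (volume (dyadicShell n δ 0)).toReal with hv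
  have hv0 : 0 < v := ENNReal.toReal_pos (volume_dyadicShell_zero_pos hn hδ).ne'
    (volume_dyadicShell_zero_ne_top n δ)
  have hvE : volume (dyadicShell n δ 0) = ENNReal.ofReal v :=
    (ENNReal.ofReal_toReal (volume_dyadicShell_zero_ne_top n δ)).symm
  refine ⟨(κ ^ p * v) ^ (1 / p), by positivity, fun N f hf => ?_⟩
  rw [← Real.mul_rpow (by positivity) (by positivity)]
  refine le_eLpNorm_of_le_lintegral hp (by positivity) ?_
  have hshell : ∀ j ∈ Finset.range N, ENNReal.ofReal (κ ^ p * v) ≤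
      ∫⁻ x in dyadicShell n δ j, ‖f x‖ₑ ^ p := by
    intro j hj
    have h2 : (0 : ℝ) < 2 ^ j := by positivity
    have hlow : ∀ x ∈ dyadicShell n δ j,
        ENNReal.ofReal (((2 : ℝ) ^ j) ^ (-(n : ℝ)) * κ ^ p) ≤ ‖f x‖ₑ ^ p := by
      intro x hx
      have h3 : κ ≤ r (((2 : ℝ) ^ j)⁻¹ • x) := by
        refine (hball ?_).le
        rw [dist_zero_right, norm_smul, norm_inv, Real.norm_of_nonneg h2.le, inv_mul_lt_iff₀ h2]
        refine hx.2.trans_le (le_of_eq ?_)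
        rw [pow_succ]
        ring
      have h4 : ((2 : ℝ) ^ j) ^ (-(n / p)) * κ ≤ ‖f x‖ := by
        rw [hf]
        refine le_trans ?_ (Finset.single_le_sum (f := fun j => ((2 : ℝ) ^ j) ^ (-(n / p)) *
          r (((2 : ℝ) ^ j)⁻¹ • x)) (fun i _ => mul_nonneg (by positivity) (hr0 _)) hj)
        exact mul_le_mul_of_nonneg_left h3 (by positivity)
      have h5 : ((2 : ℝ) ^ j) ^ (-(n : ℝ)) * κ ^ p = (((2 : ℝ) ^ j) ^ (-(n / p)) * κ) ^ p := by
        rw [Real.mul_rpow (by positivity) hκ0.le, ← Real.rpow_mul h2.le]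
        congr 2
        field_simp
      rw [h5, ← ofReal_norm, ENNReal.ofReal_rpow_of_nonneg (norm_nonneg _) hp.le]
      exact ENNReal.ofReal_le_ofReal (Real.rpow_le_rpow (by positivity) h4 hp.le)
    calc ENNReal.ofReal (κ ^ p * v)
        = ∫⁻ _ in dyadicShell n δ j, ENNReal.ofReal (((2 : ℝ) ^ j) ^ (-(n : ℝ)) * κ ^ p) := by
          rw [setLIntegral_const, volume_dyadicShell, hvE, ← ENNReal.ofReal_mul (by positivity),
            ← ENNReal.ofReal_mul (by positivity), Real.rpow_neg h2.le, Real.rpow_natCast]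
          congr 1
          field_simp
      _ ≤ _ := setLIntegral_mono' (measurableSet_dyadicShell n δ j) hlow
  calc ENNReal.ofReal (κ ^ p * v * N)
      = ∑ _j ∈ Finset.range N, ENNReal.ofReal (κ ^ p * v) := by
        rw [Finset.sum_const, Finset.card_range, nsmul_eq_mul, mul_comm,
          ENNReal.ofReal_mul (by positivity), ENNReal.ofReal_natCast]
    _ ≤ ∑ j ∈ Finset.range N, ∫⁻ x in dyadicShell n δ j, ‖f x‖ₑ ^ p := Finset.sum_le_sum hshell
    _ = ∫⁻ x in ⋃ j ∈ Finset.range N, dyadicShell n δ j, ‖f x‖ₑ ^ p := by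
        rw [lintegral_biUnion_finset ((pairwise_disjoint_dyadicShell n hδ).set_pairwise _)
          fun j _ => measurableSet_dyadicShell n δ j]
    _ ≤ ∫⁻ x, ‖f x‖ₑ ^ p := setLIntegral_le_lintegral _ _

end LowerBounds

/-! ### Cutoffs adapted to `ξ₁ + ξ₂` -/

section SumCutoff

/-- A nonzero bump with small support whose inverse Fourier transform is nonnegative. -/
theorem exists_bump_fourierInv_nonneg (n : ℕ) {ε : ℝ} (hε : 0 < ε) :
    ∃ (φ : 𝓢(Rn n, ℂ)) (r : Rn n → ℝ), (∀ x, φ x ≠ 0 → ‖x‖ < ε) ∧ (∀ x, 𝓕⁻ φ x = r x) ∧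
      (∀ x, 0 ≤ r x) ∧ 0 < r 0 := by
  obtain ⟨h, -, h0, ⟨g, hg, heven⟩, hint⟩ := exists_schwartz_bump (0 : Rn n) (r := ε / 4) (R := ε / 2)
    (by positivity) (by linarith)
  simp only [sub_zero, zero_add, zero_sub] at h0 heven
  have hF : ∀ x, 𝓕 h x = ∫ v, Complex.exp (↑(-2 * Real.pi * inner ℝ v x) * Complex.I) * h v :=
    fun x => by
      rw [SchwartzMap.fourier_coe, Real.fourier_eq']
      rfl
  -- A real even function has a real transform.
  have hreal : ∀ x, 𝓕 h x = ((𝓕 h x).re : ℂ) := by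
    intro x
    refine (Complex.conj_eq_iff_re.1 ?_).symm
    rw [hF, ← integral_conj, ← integral_neg_eq_self]
    congr 1
    ext v
    rw [map_mul, ← Complex.exp_conj, map_mul, Complex.conj_ofReal, Complex.conj_I, hg, hg,
      Complex.conj_ofReal, ← heven, inner_neg_left]
    congr 2
    push_cast
    ring
  -- For `φ = h * h` the inverse transform is the square of a real function, nonzero at the origin
  -- because `∫ h ≠ 0`; the support radius doubles from `ε/2` to `ε`.
  refine ⟨SchwartzMap.convolution (ContinuousLinearMap.mul ℂ ℂ) h h,
    fun x => (𝓕 h (-x)).re ^ 2, fun x hx => ?_, fun x => ?_, fun x => sq_nonneg _, ?_⟩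
  · rw [SchwartzMap.convolution_apply] at hx
    obtain ⟨a, ha, b, hb, rfl⟩ := support_convolution_subset_swap _ hx
    have h1 : ∀ a, h a ≠ 0 → ‖a‖ < ε / 2 := fun a ha => by
      by_contra! hc
      exact ha (h0 a hc)
    exact (norm_add_le _ _).trans_lt (by linarith [h1 a ha, h1 b hb])
  · rw [SchwartzMap.fourierInv_coe, Real.fourierInv_eq_fourier_neg, ← SchwartzMap.fourier_coe,
      SchwartzMap.fourier_convolution, SchwartzMap.pairing_apply_apply, ContinuousLinearMap.mul_apply',
      Complex.ofReal_pow, ← hreal, sq]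
  · have h1 : 𝓕 h 0 ≠ 0 := by
      rw [hF]
      simpa using hint
    rw [hreal, Complex.ofReal_ne_zero] at h1
    simp only [neg_zero]
    positivity

/-- A cutoff to a region where `ξ₁ + ξ₂` is near `e` and `ξ₂` is near `0`. -/
structure SumCutoff {n : ℕ} (e : Rn n) (χ : 𝓢(R2n n, ℂ)) (β γ ψ₁ ψ₂ : 𝓢(Rn n, ℂ)) : Prop where
  annulus : ∀ ξ, χ ξ ≠ 0 → 1 / 4 ≤ ‖ξ‖ ∧ ‖ξ‖ ≤ 4
  eq_mul : ∀ ξ, χ ξ = β (ξ.fst + ξ.snd) * γ ξ.snd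
  left : ∀ ξ, χ ξ ≠ 0 → ψ₁ ξ.fst = 1
  right : ∀ ξ, χ ξ ≠ 0 → ψ₂ ξ.snd = 1
  eq_one : ∀ η, ‖η - e‖ ≤ 1 / 8 → β η = 1
  integral_ne_zero : ∫ η, γ η ≠ 0
  bounded : ∀ η, β η ≠ 0 → ‖η‖ ≤ 2
  bounded_left : ∀ η, ψ₁ η ≠ 0 → ‖η‖ ≤ 2
  bounded_right : ∀ η, ψ₂ η ≠ 0 → ‖η‖ ≤ 2

/-- The supports of `β` and `γ` force `|ξ₂| < 1/8` and `|ξ₁ - e| < 1/4 + 1/8`, inside the balls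
where `ψ₁` and `ψ₂` are one. -/
theorem exists_sumCutoff {n : ℕ} {e : Rn n} (he : ‖e‖ = 1) :
    ∃ χ β γ ψ₁ ψ₂, SumCutoff e χ β γ ψ₁ ψ₂ := by
  obtain ⟨β, hβ1, hβ0, -, -⟩ := exists_schwartz_bump e (r := 1 / 8) (R := 1 / 4) (by norm_num)
    (by norm_num)
  obtain ⟨γ, -, hγ0, -, hγ⟩ := exists_schwartz_bump (0 : Rn n) (r := 1 / 16) (R := 1 / 8)
    (by norm_num) (by norm_num)
  obtain ⟨ψ₁, hψ1, hψ1', -, -⟩ := exists_schwartz_bump e (r := 1 / 2) (R := 1) (by norm_num)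
    (by norm_num)
  obtain ⟨ψ₂, hψ2, hψ2', -, -⟩ := exists_schwartz_bump (0 : Rn n) (r := 1 / 2) (R := 1)
    (by norm_num) (by norm_num)
  simp only [sub_zero] at hγ0 hψ2 hψ2'
  set X : R2n n → ℂ := fun ξ => β (ξ.fst + ξ.snd) * γ ξ.snd with hX
  have hsupp : ∀ ξ, X ξ ≠ 0 → ‖ξ.fst - e‖ < 3 / 8 ∧ ‖ξ.snd‖ < 1 / 8 := by
    intro ξ hξ
    obtain ⟨h1, h2⟩ := mul_ne_zero_iff.1 hξ
    have h3 : ‖ξ.fst + ξ.snd - e‖ < 1 / 4 := by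
      by_contra! h
      exact h1 (hβ0 _ h)
    have h4 : ‖ξ.snd‖ < 1 / 8 := by
      by_contra! h
      exact h2 (hγ0 _ h)
    refine ⟨?_, h4⟩
    have h5 := norm_sub_le (ξ.fst + ξ.snd - e) ξ.snd
    rw [show ξ.fst + ξ.snd - e - ξ.snd = ξ.fst - e by abel] at h5
    linarith
  have hnear : ∀ (c x : Rn n) {R : ℝ}, ‖x - c‖ < R → ‖c‖ - R ≤ ‖x‖ ∧ ‖x‖ ≤ ‖c‖ + R := by
    intro c x R h
    have h2 := abs_norm_sub_norm_le x c
    rw [abs_le] at h2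
    constructor <;> linarith
  have hann : ∀ ξ, X ξ ≠ 0 → 1 / 4 ≤ ‖ξ‖ ∧ ‖ξ‖ ≤ 4 := by
    intro ξ hξ
    obtain ⟨h1, h2⟩ := hsupp ξ hξ
    obtain ⟨h3, h4⟩ := hnear e _ h1
    rw [he] at h3 h4
    exact ⟨by linarith [norm_fst_le ξ], by linarith [norm_le_fst_add_snd ξ]⟩
  have hcs : HasCompactSupport X := by
    refine HasCompactSupport.intro (isCompact_closedBall (0 : R2n n) 4) fun ξ hξ => ?_
    by_contra h
    exact hξ (by rw [mem_closedBall_zero_iff]; exact (hann ξ h).2)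
  have hsm : ContDiff ℝ (⊤ : ℕ∞) X :=
    ((β.smooth _).comp (sumCLM n).contDiff).mul
      ((γ.smooth _).comp (WithLp.sndL 2 ℝ (Rn n) (Rn n)).contDiff)
  have hbd : ∀ (c : Rn n) {R : ℝ} (ψ : 𝓢(Rn n, ℂ)), ‖c‖ + R ≤ 2 → (∀ x, R ≤ ‖x - c‖ → ψ x = 0) →
      ∀ η, ψ η ≠ 0 → ‖η‖ ≤ 2 := by
    intro c R ψ hc hψ η hη
    have h : ‖η - c‖ < R := by
      by_contra! h
      exact hη (hψ η h)
    exact (hnear c η h).2.trans hc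
  refine ⟨hcs.toSchwartzMap hsm, β, γ, ψ₁, ψ₂, ⟨hann, fun ξ => rfl, fun ξ hξ => hψ1 _ ?_,
    fun ξ hξ => hψ2 _ ?_, hβ1, hγ, hbd e (R := 1 / 4) β (by linarith) hβ0,
    hbd e ψ₁ (by linarith) hψ1', hbd 0 (R := 1) ψ₂ (by norm_num) (by simpa using hψ2')⟩⟩
  · linarith [(hsupp ξ hξ).1]
  · linarith [(hsupp ξ hξ).2]

end SumCutoff

/-! ### Necessity of `s/n > 1/p - 1/u'`: concentration on a subspace -/

section LacunaryTest

variable {n : ℕ} {p₁ p₂ p u s : ℝ} {Θ : 𝓢(R2n n, ℂ)}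

/-- All pieces carry the same modulation `exp(2πi⟨e, x⟩)` and are otherwise nonnegative, so nothing
cancels. -/
theorem norm_fourierInv_lacunary {φ β : 𝓢(Rn n, ℂ)} {e : Rn n} {r : Rn n → ℝ}
    (hφ : ∀ x, φ x ≠ 0 → ‖x‖ < 1 / 8) (hr : ∀ x, 𝓕⁻ φ x = r x) (hr0 : ∀ x, 0 ≤ r x)
    (hβ : ∀ η, ‖η - e‖ ≤ 1 / 8 → β η = 1) {c : ℕ → ℝ} (hc : ∀ j, 0 ≤ c j) (N : ℕ) (x : Rn n) :
    ‖𝓕⁻ (lacunary φ β (ContinuousLinearMap.id ℝ (Rn n)) e (fun j => (c j : ℂ)) N) x‖ =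
      ∑ j ∈ Finset.range N, c j * ((2 : ℝ) ^ j) ^ (-(n : ℝ)) * r (((2 : ℝ) ^ j)⁻¹ • x) := by
  have hsum : 𝓕⁻ (lacunary φ β (ContinuousLinearMap.id ℝ (Rn n)) e (fun j => (c j : ℂ)) N) =
      ∑ j ∈ Finset.range N, (c j : ℂ) •
        𝓕⁻ (concentrated φ β (ContinuousLinearMap.id ℝ (Rn n)) e (2 ^ j)) := by
    change FourierTransform.fourierInvCLM ℂ 𝓢(Rn n, ℂ) _ = _
    rw [lacunary, map_sum]
    exact Finset.sum_congr rfl fun j _ => map_smul _ _ _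
  have hterm : ∀ j, 𝓕⁻ (concentrated φ β (ContinuousLinearMap.id ℝ (Rn n)) e (2 ^ j)) x =
      ((((2 : ℝ) ^ j) ^ (-(n : ℝ)) : ℝ) : ℂ) *
        Complex.exp (↑(2 * Real.pi * inner ℝ e x) * Complex.I) * r (((2 : ℝ) ^ j)⁻¹ • x) := by
    intro j
    rw [← hr, fourierInv_concentrated φ β e (by positivity)]
    intro η hη
    refine hβ η ?_
    have h1 := hφ _ hη
    have h2 : (1 : ℝ) ≤ 2 ^ j := one_le_pow₀ one_le_two
    rw [norm_smul, Real.norm_of_nonneg (by positivity)] at h1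
    nlinarith [norm_nonneg (η - e)]
  have hx : 𝓕⁻ (lacunary φ β (ContinuousLinearMap.id ℝ (Rn n)) e (fun j => (c j : ℂ)) N) x =
      Complex.exp (↑(2 * Real.pi * inner ℝ e x) * Complex.I) * ((∑ j ∈ Finset.range N,
        c j * ((2 : ℝ) ^ j) ^ (-(n : ℝ)) * r (((2 : ℝ) ^ j)⁻¹ • x) : ℝ) : ℂ) := by
    rw [hsum, sum_apply, Complex.ofReal_sum, Finset.mul_sum]
    refine Finset.sum_congr rfl fun j _ => ?_
    rw [smul_apply, hterm, smul_eq_mul]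
    push_cast
    ring
  rw [hx, norm_mul, norm_exp_real_mul_I, one_mul, Complex.norm_real, Real.norm_of_nonneg]
  exact Finset.sum_nonneg fun j _ =>
    mul_nonneg (mul_nonneg (hc j) (by positivity)) (hr0 _)

/-- If the inequality fails, the estimate reads `N^(1/p) ≲ N^(1/u)`, which is impossible for `p <
u`. -/
theorem one_div_sub_lt_of_multiplierBound (hn : 0 < n)
    (hp0 : 0 < p) (hpu : p < u) (hu : 1 < u) (hs : 0 < s)
    (hΘ : ∀ ξ, (𝓕 Θ) ξ ≠ 0 → 1 / 2 ≤ ‖ξ‖ ∧ ‖ξ‖ ≤ 2) {C : ℝ}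
    (hC : MultiplierBound p₁ p₂ p u s hu.le Θ C) : 1 / p - (1 - 1 / u) < s / n := by
  by_contra! hle
  have hnp : (0 : ℝ) < n := by exact_mod_cast hn
  have hsl : n - n / p + s ≤ n / u := by
    rw [div_le_iff₀ hnp] at hle
    have : (1 / p - (1 - 1 / u)) * n = n / p - n + n / u := by ring
    linarith
  obtain ⟨e, he⟩ := exists_unit_vector hn
  obtain ⟨χ, β, γ, ψ₁, ψ₂, H⟩ := exists_sumCutoff he
  obtain ⟨φ, r, hφ, hr, hr0, hr1⟩ := exists_bump_fourierInv_nonneg n (ε := 1 / 8) (by norm_num)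
  obtain ⟨C', hC', hlac⟩ := hormanderENorm_lacunary_le hΘ hu hs (sumCLM n) e (l := n)
    (c₀ := 1 / 2) hnp (by norm_num)
    (fun a => by simpa [sumCLM_apply] using isThin_norm_fst_add_snd a) φ χ H.annulus
  have hrc : Continuous r := by
    have : r = fun x => (𝓕⁻ φ x).re := funext fun x => by rw [hr, Complex.ofReal_re]
    rw [this]
    fun_prop
  obtain ⟨κ, hκ, hlow⟩ := exists_le_eLpNorm_sum_dyadic hn hp0 hrc hr0 hr1
  obtain ⟨κ₁, hκ₁, hκ₁'⟩ := exists_eLpNorm_le (𝓕⁻ ψ₁ : 𝓢(Rn n, ℂ)) p₁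
  obtain ⟨κ₂, hκ₂, hκ₂'⟩ := exists_eLpNorm_le (𝓕⁻ ψ₂ : 𝓢(Rn n, ℂ)) p₂
  set I : ℂ := ∫ y, γ y with hI
  have hI0 : 0 < ‖I‖ := norm_pos_iff.2 H.integral_ne_zero
  -- Combined with the factor `2^(-jn)` from the inverse transform this leaves `2^(-jn/p)`, the
  -- `L^p` normalisation of a dilate by `2^j`.
  set c : ℕ → ℝ := fun j => ((2 : ℝ) ^ j) ^ (n - n / p : ℝ) with hc
  have hfinal : ∀ N : ℕ, 1 ≤ N →
      (‖I‖ * κ) * (N : ℝ) ^ (1 / p) ≤ (C * C' * κ₁ * κ₂) * (N : ℝ) ^ (1 / u) := by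
    intro N hN
    set m := lacunary φ χ (sumCLM n) e (fun j => (c j : ℂ)) N with hm
    set a := lacunary φ β (ContinuousLinearMap.id ℝ (Rn n)) e (fun j => (c j : ℂ)) N with ha
    have hmH := hlac N 1 (fun j => (c j : ℂ)) hN zero_le_one (fun j => by
      have h2 : (1 : ℝ) ≤ 2 ^ j := one_le_pow₀ one_le_two
      rw [Complex.norm_real, Real.norm_of_nonneg (by positivity), hc, one_mul,
        ← Real.rpow_add (by positivity)]
      exact Real.rpow_le_rpow_of_exponent_le h2 hsl)
    have hT : bilinearOp m (𝓕⁻ ψ₁) (𝓕⁻ ψ₂) = I • fun x => 𝓕⁻ a x := by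
      ext x
      refine bilinearOp_eq_smul m _ _ a γ (fun ξ => ?_) x
      rw [FourierTransform.fourier_fourierInv_eq, FourierTransform.fourier_fourierInv_eq, hm, ha,
        lacunary_apply, lacunary_apply, ContinuousLinearMap.id_apply, sumCLM_apply,
        mul_assoc _ (β _), ← H.eq_mul]
      by_cases h : χ ξ = 0
      · simp [h]
      · rw [H.left ξ h, H.right ξ h, mul_one, mul_one]
    have hα : ENNReal.ofReal (‖I‖ * (κ * (N : ℝ) ^ (1 / p))) ≤
        eLpNorm (bilinearOp m (𝓕⁻ ψ₁) (𝓕⁻ ψ₂)) (ENNReal.ofReal p) volume := by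
      rw [hT, eLpNorm_const_smul, ENNReal.ofReal_mul (norm_nonneg _), ofReal_norm]
      refine mul_le_mul' le_rfl (hlow N _ fun x => ?_)
      rw [norm_fourierInv_lacunary hφ hr hr0 H.eq_one (fun j => by positivity)]
      refine Finset.sum_congr rfl fun j _ => ?_
      rw [hc]
      beta_reduce
      rw [← Real.rpow_add (by positivity)]
      congr 2
      ring
    have h1 := hC m _ _ _ _ _ _ (by positivity) hκ₁ hκ₂ hmH hκ₁' hκ₂' hα
    linarith
  have h1 := le_of_forall_mul_rpow_le (by positivity) hfinal
  have h2 : 1 / u < 1 / p := one_div_lt_one_div_of_lt hp0 hpu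
  linarith

end LacunaryTest

/-! ### Dispersive estimates for quadratic phases -/

section Dispersion

variable {n : ℕ}

theorem hasTemperateGrowth_quadratic (θ : ℝ) :
    (fun η : Rn n => θ * ‖η‖ ^ 2).HasTemperateGrowth :=
  (Function.HasTemperateGrowth.const θ).mul (Function.hasTemperateGrowth_norm_sq _)

/-- Write `exp(iν|η|²) β = exp(-(1 - iν)|η|²) · exp(|η|²) β`. The transform of the complex Gaussian
is at most `(π/ν)^(n/2)`, and the second factor is Schwartz by compact support, so its inverse
transform is in `L¹`. -/
theorem exists_norm_fourierInv_oscillating_le {β : 𝓢(Rn n, ℂ)} {R : ℝ}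
    (hβ : ∀ η, β η ≠ 0 → ‖η‖ ≤ R) :
    ∃ D : ℝ, 0 < D ∧ ∀ ν : ℝ, 0 < ν → ∀ x,
      ‖𝓕⁻ (oscillating (fun η => 1 * ‖η‖ ^ 2) β ν) x‖ ≤ D * ν ^ (-(n / 2 : ℝ)) := by
  have hcs : HasCompactSupport fun η => ((Real.exp (‖η‖ ^ 2) : ℝ) : ℂ) * β η := by
    refine HasCompactSupport.intro (isCompact_closedBall (0 : Rn n) R) fun η hη => ?_
    have h : β η = 0 := by
      by_contra h
      exact hη (by rw [mem_closedBall_zero_iff]; exact hβ η h)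
    rw [h, mul_zero]
  have hsm : ContDiff ℝ (⊤ : ℕ∞) fun η => ((Real.exp (‖η‖ ^ 2) : ℝ) : ℂ) * β η :=
    (Complex.ofRealCLM.contDiff.comp (contDiff_norm_sq ℝ).exp).mul (β.smooth _)
  set B : 𝓢(Rn n, ℂ) := hcs.toSchwartzMap hsm with hB
  set G : 𝓢(Rn n, ℂ) := 𝓕⁻ B with hG
  have hGF : 𝓕 G = B := FourierTransform.fourier_fourierInv_eq B
  refine ⟨Real.pi ^ (n / 2 : ℝ) * ((∫ y, ‖G y‖) + 1), by
    have : 0 ≤ ∫ y, ‖G y‖ := integral_nonneg fun _ => norm_nonneg _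
    positivity, fun ν hν x => ?_⟩
  set b : ℂ := 1 - ν * Complex.I with hb
  have hre : b.re = 1 := by simp [hb]
  have him : b.im = -ν := by simp [hb]
  have hb0 : 0 < b.re := by rw [hre]; exact one_pos
  set g : Rn n → ℂ := fun η => Complex.exp (-b * ‖η‖ ^ 2 +
    2 * Real.pi * Complex.I * (inner ℝ x η : ℝ)) with hg
  have hgi : Integrable g := GaussianFourier.integrable_cexp_neg_mul_sq_norm_add hb0 _ x
  have h1 : ∫ y, 𝓕 g y * G y = ∫ η, g η * 𝓕 (G : Rn n → ℂ) η := by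
    simpa using! VectorFourier.integral_bilin_fourierIntegral_eq_flip
      (ContinuousLinearMap.mul ℂ ℂ) (L := innerₗ (Rn n))
      Real.continuous_fourierChar continuous_inner hgi G.integrable
  have h2 : 𝓕⁻ (oscillating (fun η => 1 * ‖η‖ ^ 2) β ν) x = ∫ y, 𝓕 g y * G y := by
    rw [h1, ← SchwartzMap.fourier_coe, hGF, SchwartzMap.fourierInv_coe, Real.fourierInv_eq']
    congr 1
    ext η
    rw [oscillating_apply (hasTemperateGrowth_quadratic 1), smul_eq_mul, ← mul_assoc, ← Complex.exp_add]
    change _ = g η * (((Real.exp (‖η‖ ^ 2) : ℝ) : ℂ) * β η)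
    rw [hg]
    beta_reduce
    rw [← mul_assoc (Complex.exp _) (Complex.ofReal _), Complex.ofReal_exp, ← Complex.exp_add,
      real_inner_comm, hb]
    congr 2
    push_cast
    ring
  have h3 : ∀ y, ‖𝓕 g y‖ ≤ Real.pi ^ (n / 2 : ℝ) * ν ^ (-(n / 2 : ℝ)) := by
    intro y
    have hbn : ν ≤ ‖b‖ := by
      have := Complex.abs_im_le_norm b
      rwa [him, abs_neg, abs_of_pos hν] at this
    have h4 : ‖Complex.exp (-Real.pi ^ 2 * ‖x - y‖ ^ 2 / b)‖ ≤ 1 := by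
      rw [Complex.norm_exp, Real.exp_le_one_iff]
      have h5 : (-(Real.pi : ℂ) ^ 2 * (‖x - y‖ : ℂ) ^ 2 / b).re =
          -(Real.pi ^ 2 * ‖x - y‖ ^ 2) * b⁻¹.re := by
        rw [div_eq_mul_inv, ← Complex.re_ofReal_mul]
        congr 2
        push_cast
        ring
      rw [h5, Complex.inv_re, hre]
      have : 0 ≤ Real.pi ^ 2 * ‖x - y‖ ^ 2 * (1 / Complex.normSq b) := by
        have := Complex.normSq_nonneg b
        positivity
      linarith
    have h6 : (Module.finrank ℝ (Rn n) / 2 : ℂ) = ((n / 2 : ℝ) : ℂ) := by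
      rw [finrank_euclideanSpace_fin]
      push_cast
      rfl
    rw [hg, fourier_gaussian_innerProductSpace' hb0, norm_mul, h6, Complex.norm_cpow_real, norm_div,
      Complex.norm_real, Real.norm_of_nonneg Real.pi_pos.le]
    calc (Real.pi / ‖b‖) ^ (n / 2 : ℝ) * ‖Complex.exp (-Real.pi ^ 2 * ‖x - y‖ ^ 2 / b)‖
        ≤ (Real.pi / ν) ^ (n / 2 : ℝ) * 1 := by
          have := Real.pi_pos
          gcongr
      _ = _ := by rw [mul_one, Real.div_rpow Real.pi_pos.le hν.le, Real.rpow_neg hν.le]; rfl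
  rw [h2]
  calc ‖∫ y, 𝓕 g y * G y‖ ≤ ∫ y, Real.pi ^ (n / 2 : ℝ) * ν ^ (-(n / 2 : ℝ)) * ‖G y‖ := by
        refine norm_integral_le_of_norm_le (G.integrable.norm.const_mul _)
          (Filter.Eventually.of_forall fun y => ?_)
        rw [norm_mul]
        exact mul_le_mul_of_nonneg_right (h3 y) (norm_nonneg _)
    _ = Real.pi ^ (n / 2 : ℝ) * (∫ y, ‖G y‖) * ν ^ (-(n / 2 : ℝ)) := by
        rw [integral_const_mul]
        ring
    _ ≤ _ := by
        gcongr
        linarith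

theorem integral_norm_sq_fourierInv_oscillating {Φ : Rn n → ℝ} (hΦ : Φ.HasTemperateGrowth)
    (β : 𝓢(Rn n, ℂ)) (ν : ℝ) :
    ∫ x, ‖𝓕⁻ (oscillating Φ β ν) x‖ ^ 2 = ∫ η, ‖β η‖ ^ 2 := by
  rw [← SchwartzMap.integral_norm_sq_fourier, FourierTransform.fourier_fourierInv_eq]
  congr 1
  ext η
  rw [oscillating_apply hΦ, norm_mul, norm_exp_real_mul_I, one_mul]

theorem oscillating_zero_mul (β : 𝓢(Rn n, ℂ)) (ν : ℝ) :
    oscillating (fun η : Rn n => 0 * ‖η‖ ^ 2) β ν = β := by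
  ext η
  rw [oscillating_apply (hasTemperateGrowth_quadratic 0)]
  simp

theorem integrable_norm_sq (f : 𝓢(Rn n, ℂ)) : Integrable fun x => ‖f x‖ ^ 2 := by
  have h : MemLp f 2 (volume : Measure (Rn n)) := f.memLp _ _
  exact h.integrable_norm_pow two_ne_zero

/-- For `q > 2`, interpolate between the dispersive sup bound and conservation of the `L²` norm. For
`q ≤ 2` no gain is claimed and `θ = 0` removes the phase. -/
theorem exists_phase_eLpNorm_le {ψ : 𝓢(Rn n, ℂ)} {R : ℝ} (hψ : ∀ η, ψ η ≠ 0 → ‖η‖ ≤ R)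
    {q : ℝ} (hq : 0 < q) :
    ∃ θ K : ℝ, 0 ≤ K ∧ ∀ ν : ℝ, 0 < ν →
      eLpNorm (𝓕⁻ (oscillating (fun η => θ * ‖η‖ ^ 2) ψ ν) : 𝓢(Rn n, ℂ)) (ENNReal.ofReal q)
        volume ≤ ENNReal.ofReal (K * ν ^ (-(n * max (1 / 2 - 1 / q) 0))) := by
  rcases le_or_gt q 2 with h | h
  · obtain ⟨K, hK, hle⟩ := exists_eLpNorm_le (𝓕⁻ ψ : 𝓢(Rn n, ℂ)) q
    refine ⟨0, K, hK, fun ν hν => ?_⟩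
    rw [oscillating_zero_mul, max_eq_right, mul_zero, neg_zero, Real.rpow_zero, mul_one]
    · exact hle
    · rw [sub_nonpos]
      exact one_div_le_one_div_of_le hq h
  · obtain ⟨D, hD, hdisp⟩ := exists_norm_fourierInv_oscillating_le hψ
    set M := ∫ η, ‖ψ η‖ ^ 2 with hM
    have hM0 : 0 ≤ M := integral_nonneg fun _ => by positivity
    refine ⟨1, (D ^ (q - 2) * M) ^ (1 / q), by positivity, fun ν hν => ?_⟩
    set f : 𝓢(Rn n, ℂ) := 𝓕⁻ (oscillating (fun η => 1 * ‖η‖ ^ 2) ψ ν) with hf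
    have hmax : max (1 / 2 - 1 / q) 0 = 1 / 2 - 1 / q := by
      rw [max_eq_left]
      rw [sub_nonneg]
      exact one_div_le_one_div_of_le two_pos h.le
    have heq : (D ^ (q - 2) * M) ^ (1 / q) * ν ^ (-(n * max (1 / 2 - 1 / q) 0)) =
        ((D * ν ^ (-(n / 2 : ℝ))) ^ (q - 2) * M) ^ (1 / q) := by
      rw [hmax, Real.mul_rpow hD.le (by positivity), Real.mul_rpow (by positivity) hM0,
        Real.mul_rpow (by positivity) hM0, Real.mul_rpow (by positivity) (by positivity),
        ← Real.rpow_mul hν.le, ← Real.rpow_mul hν.le]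
      have : -(n / 2 : ℝ) * (q - 2) * (1 / q) = -(n * (1 / 2 - 1 / q)) := by
        field_simp
      rw [this]
      ring
    rw [heq]
    refine eLpNorm_le_of_norm_rpow_le hq (g := fun x => (D * ν ^ (-(n / 2 : ℝ))) ^ (q - 2) * ‖f x‖ ^ 2)
      ((integrable_norm_sq f).const_mul _) (fun x => ?_) ?_
    · have h1 : ‖f x‖ ^ q = ‖f x‖ ^ (q - 2) * ‖f x‖ ^ 2 := by
        rw [← Real.rpow_natCast, ← Real.rpow_add' (norm_nonneg _)] <;> norm_num
        exact hq.ne'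
      rw [h1]
      gcongr
      exact hdisp ν hν x
    · rw [integral_const_mul, hf, integral_norm_sq_fourierInv_oscillating (hasTemperateGrowth_quadratic 1)]

/-- For `q < 2`, the conserved mass satisfies `∫ |f|² ≤ (sup |f|)^(2 - q) ∫ |f|^q`, so a small
supremum forces a large `L^q` norm. For `q ≥ 2` the phase is switched off. -/
theorem exists_phase_le_eLpNorm {β : 𝓢(Rn n, ℂ)} {R : ℝ} (hβ : ∀ η, β η ≠ 0 → ‖η‖ ≤ R)
    (hβ0 : β ≠ 0) {q : ℝ} (hq : 0 < q) :
    ∃ θ κ : ℝ, 0 < κ ∧ ∀ ν : ℝ, 0 < ν →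
      ENNReal.ofReal (κ * ν ^ (n * max (1 / q - 1 / 2) 0)) ≤
        eLpNorm (𝓕⁻ (oscillating (fun η => θ * ‖η‖ ^ 2) β ν) : 𝓢(Rn n, ℂ)) (ENNReal.ofReal q)
          volume := by
  rcases le_or_gt 2 q with h | h
  · have hne := fourierInv_ne_zero hβ0
    obtain ⟨κ, hκ, hle⟩ := exists_le_eLpNorm hq (𝓕⁻ β : 𝓢(Rn n, ℂ)).continuous
      (fun h0 => hne (SchwartzMap.ext fun x => congrFun h0 x))
    refine ⟨0, κ, hκ, fun ν hν => ?_⟩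
    rw [oscillating_zero_mul, max_eq_right, mul_zero, Real.rpow_zero, mul_one]
    · exact hle
    · rw [sub_nonpos]
      exact one_div_le_one_div_of_le two_pos h
  · obtain ⟨D, hD, hdisp⟩ := exists_norm_fourierInv_oscillating_le hβ
    set M := ∫ η, ‖β η‖ ^ 2 with hM
    have hM0 : 0 < M := by
      obtain ⟨η, hη⟩ : ∃ η, β η ≠ 0 := by
        by_contra! hz
        exact hβ0 (SchwartzMap.ext hz)
      have hc : Continuous fun η => ‖β η‖ ^ 2 := by fun_prop
      exact hc.integral_pos_of_hasCompactSupport_nonneg_nonzero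
        (HasCompactSupport.intro (isCompact_closedBall (0 : Rn n) R) fun x hx => by
          have h0 : β x = 0 := by
            by_contra h0
            exact hx (by rw [mem_closedBall_zero_iff]; exact hβ x h0)
          simp [h0]) (fun x => by positivity) (x := η) (by simpa using hη)
    refine ⟨1, (M / D ^ (2 - q)) ^ (1 / q), by positivity, fun ν hν => ?_⟩
    set f : 𝓢(Rn n, ℂ) := 𝓕⁻ (oscillating (fun η => 1 * ‖η‖ ^ 2) β ν) with hf
    have hmax : max (1 / q - 1 / 2) 0 = 1 / q - 1 / 2 := by
      rw [max_eq_left]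
      rw [sub_nonneg]
      exact one_div_le_one_div_of_le hq h.le
    set A := (D * ν ^ (-(n / 2 : ℝ))) ^ (2 - q) with hA
    have hA0 : 0 < A := by positivity
    have heq : (M / D ^ (2 - q)) ^ (1 / q) * ν ^ (n * max (1 / q - 1 / 2) 0) =
        (M / A) ^ (1 / q) := by
      have h1 : M / A = M / D ^ (2 - q) * ν ^ ((n / 2 : ℝ) * (2 - q)) := by
        rw [hA, Real.mul_rpow hD.le (by positivity), ← Real.rpow_mul hν.le, neg_mul,
          Real.rpow_neg hν.le]
        field_simp
      rw [hmax, h1, Real.mul_rpow (by positivity) (by positivity), ← Real.rpow_mul hν.le]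
      congr 2
      field_simp
    rw [heq]
    refine le_eLpNorm_of_le_lintegral hq (by positivity) ?_
    have h2 : ENNReal.ofReal M ≤ ENNReal.ofReal A * ∫⁻ x, ‖f x‖ₑ ^ q := by
      have h3 : M = ∫ x, ‖f x‖ ^ 2 :=
        (integral_norm_sq_fourierInv_oscillating (hasTemperateGrowth_quadratic 1) β ν).symm
      rw [h3, ofReal_integral_eq_lintegral_ofReal (integrable_norm_sq f)
        (Filter.Eventually.of_forall fun x => by positivity),
        ← lintegral_const_mul' _ _ ENNReal.ofReal_ne_top]
      refine lintegral_mono fun x => ?_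
      rw [← ofReal_norm, ENNReal.ofReal_rpow_of_nonneg (norm_nonneg _) hq.le,
        ← ENNReal.ofReal_mul hA0.le]
      refine ENNReal.ofReal_le_ofReal ?_
      have h1 : ‖f x‖ ^ 2 = ‖f x‖ ^ (2 - q) * ‖f x‖ ^ q := by
        rw [← Real.rpow_add' (norm_nonneg _)] <;> norm_num
      rw [h1, hA]
      have h4 : 0 ≤ 2 - q := by linarith
      gcongr
      exact hdisp ν hν x
    rw [ENNReal.ofReal_div_of_pos hA0]
    exact ENNReal.div_le_of_le_mul' h2

end Dispersion

/-! ### Necessity of the last inequality: oscillating multipliers -/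

section OscillationTest

variable {n : ℕ} {p₁ p₂ p u s : ℝ} {Θ : 𝓢(R2n n, ℂ)}

/-- The multiplier costs `ν^s`, the inputs gain `ν^(-nX₁)` and `ν^(-nX₂)`, and the output is at
least of size `ν^(nX)`; let `ν = N → ∞`. -/
theorem add_le_of_multiplierBound (hn : 0 < n) (hp₁ : 0 < p₁) (hp₂ : 0 < p₂)
    (hp0 : 0 < p) (hu : 1 < u) (hs : 0 < s)
    (hΘ : ∀ ξ, (𝓕 Θ) ξ ≠ 0 → 1 / 2 ≤ ‖ξ‖ ∧ ‖ξ‖ ≤ 2) {C : ℝ}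
    (hC : MultiplierBound p₁ p₂ p u s hu.le Θ C) :
    max (1 / p - 1 / 2) 0 + (max (1 / 2 - 1 / p₁) 0 + max (1 / 2 - 1 / p₂) 0) ≤ s / n := by
  have hnp : (0 : ℝ) < n := by exact_mod_cast hn
  obtain ⟨e, he⟩ := exists_unit_vector hn
  obtain ⟨χ, β, γ, ψ₁, ψ₂, H⟩ := exists_sumCutoff he
  have hβ0 : β ≠ 0 := fun h => by
    have := H.eq_one e (by simp)
    rw [h] at this
    simp at this
  obtain ⟨θ, κ, hκ, hlow⟩ := exists_phase_le_eLpNorm H.bounded hβ0 hp0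
  obtain ⟨θ₁, κ₁, hκ₁, hup₁⟩ := exists_phase_eLpNorm_le H.bounded_left hp₁
  obtain ⟨θ₂, κ₂, hκ₂, hup₂⟩ := exists_phase_eLpNorm_le H.bounded_right hp₂
  -- The subtracted terms cancel the phases of the inputs, and what remains depends on `ξ₁ + ξ₂`
  -- alone, apart from the cutoff.
  set Φ : R2n n → ℝ := fun ξ => θ * ‖sumCLM n ξ‖ ^ 2 -
    (θ₁ * ‖WithLp.fstL 2 ℝ (Rn n) (Rn n) ξ‖ ^ 2 + θ₂ * ‖WithLp.sndL 2 ℝ (Rn n) (Rn n) ξ‖ ^ 2)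
    with hΦdef
  have hΦ : Φ.HasTemperateGrowth :=
    ((hasTemperateGrowth_quadratic θ).comp (sumCLM n).hasTemperateGrowth).sub
      (((hasTemperateGrowth_quadratic θ₁).comp (WithLp.fstL 2 ℝ (Rn n) (Rn n)).hasTemperateGrowth).add
        ((hasTemperateGrowth_quadratic θ₂).comp (WithLp.sndL 2 ℝ (Rn n) (Rn n)).hasTemperateGrowth))
  obtain ⟨C', hC', hosc⟩ := hormanderENorm_oscillating_le hΘ hu hs hΦ χ H.annulus
  set I : ℂ := ∫ y, γ y with hI
  have hI0 : 0 < ‖I‖ := norm_pos_iff.2 H.integral_ne_zero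
  set X := max (1 / p - 1 / 2) 0
  set X₁ := max (1 / 2 - 1 / p₁) 0
  set X₂ := max (1 / 2 - 1 / p₂) 0
  have hfinal : ∀ N : ℕ, 1 ≤ N →
      (‖I‖ * κ) * (N : ℝ) ^ (n * X) ≤ (C * C' * κ₁ * κ₂) * (N : ℝ) ^ (s - n * X₁ - n * X₂) := by
    intro N hN
    have hN1 : (1 : ℝ) ≤ N := by exact_mod_cast hN
    have hN0 : (0 : ℝ) < N := by linarith
    set m := oscillating Φ χ N with hm
    set f₁ : 𝓢(Rn n, ℂ) := 𝓕⁻ (oscillating (fun η => θ₁ * ‖η‖ ^ 2) ψ₁ N) with hf₁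
    set f₂ : 𝓢(Rn n, ℂ) := 𝓕⁻ (oscillating (fun η => θ₂ * ‖η‖ ^ 2) ψ₂ N) with hf₂
    set a := oscillating (fun η => θ * ‖η‖ ^ 2) β N with ha
    have hT : bilinearOp m f₁ f₂ = I • fun x => 𝓕⁻ a x := by
      ext x
      refine bilinearOp_eq_smul m _ _ a γ (fun ξ => ?_) x
      rw [hf₁, hf₂, FourierTransform.fourier_fourierInv_eq, FourierTransform.fourier_fourierInv_eq,
        hm, ha, oscillating_apply hΦ, oscillating_apply (hasTemperateGrowth_quadratic θ),
        oscillating_apply (hasTemperateGrowth_quadratic θ₁),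
        oscillating_apply (hasTemperateGrowth_quadratic θ₂), mul_assoc _ (β _), ← H.eq_mul]
      by_cases h : χ ξ = 0
      · simp [h]
      · rw [H.left ξ h, H.right ξ h, mul_one, mul_one, mul_assoc (_ * χ ξ), ← Complex.exp_add,
          mul_right_comm, ← Complex.exp_add, ← add_assoc]
        congr 2
        rw [hΦdef]
        change _ = ((N * (θ * ‖sumCLM n ξ‖ ^ 2) : ℝ) : ℂ) * Complex.I
        change ((N * (θ * ‖sumCLM n ξ‖ ^ 2 - (θ₁ * ‖ξ.fst‖ ^ 2 + θ₂ * ‖ξ.snd‖ ^ 2)) : ℝ) : ℂ) *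
          Complex.I + _ + _ = _
        push_cast
        ring
    have hα : ENNReal.ofReal (‖I‖ * (κ * (N : ℝ) ^ (n * X))) ≤
        eLpNorm (bilinearOp m f₁ f₂) (ENNReal.ofReal p) volume := by
      rw [hT, eLpNorm_const_smul, ENNReal.ofReal_mul (norm_nonneg _), ofReal_norm]
      exact mul_le_mul' le_rfl (hlow N hN0)
    have h1 := hC m f₁ f₂ _ _ _ _ (by positivity) (by positivity) (by positivity) (hosc N hN1)
      (hup₁ N hN0) (hup₂ N hN0) hα
    have h2 : (N : ℝ) ^ (s - n * X₁ - n * X₂) =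
        (N : ℝ) ^ s * (N : ℝ) ^ (-(n * X₁)) * (N : ℝ) ^ (-(n * X₂)) := by
      rw [← Real.rpow_add hN0, ← Real.rpow_add hN0]
      congr 1
    rw [h2]
    linarith
  have h1 := le_of_forall_mul_rpow_le (by positivity) hfinal
  rw [le_div_iff₀ hnp]
  linarith

end OscillationTest

end BilinearMultiplier

end

theorem theorem6p4 (n : ℕ) (hn : 0 < n) (p₁ p₂ p u s : ℝ)
    (hp₁ : 1 < p₁) (hp₂ : 1 < p₂) (hp : 1 / p = 1 / p₁ + 1 / p₂) (hu : 1 < u) (hs : 0 < s)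
    (Θ : 𝓢(BilinearMultiplier.R2n n, ℂ))
    (hΘ : ∀ ξ, (𝓕 Θ) ξ ≠ 0 → 1 / 2 ≤ ‖ξ‖ ∧ ‖ξ‖ ≤ 2)
    (hbdd : ∃ C : ℝ≥0, ∀ m : BilinearMultiplier.R2n n → ℂ,
      Measurable m → (∃ B : ℝ, ∀ ξ, ‖m ξ‖ ≤ B) →
      BilinearMultiplier.hormanderENorm Θ s u hu.le m < ∞ →
      ∀ f₁ f₂ : 𝓢(BilinearMultiplier.Rn n, ℂ),
        eLpNorm (BilinearMultiplier.bilinearOp m f₁ f₂) (ENNReal.ofReal p) volume ≤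
          C * BilinearMultiplier.hormanderENorm Θ s u hu.le m *
            eLpNorm f₁ (ENNReal.ofReal p₁) volume * eLpNorm f₂ (ENNReal.ofReal p₂) volume) :
    max (2 / u) (1 / p - (1 - 1 / u)) < s / n ∧
      max (1 / 2 - (1 - 1 / p)) 0 + (max (1 / 2 - 1 / p₁) 0 + max (1 / 2 - 1 / p₂) 0) ≤ s / n := by
  obtain ⟨C, hC⟩ := BilinearMultiplier.exists_multiplierBound hu.le Θ hbdd
  have hp0 : 0 < p := by
    have : 0 < 1 / p := by rw [hp]; positivity
    exact one_div_pos.1 this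
  have hA := BilinearMultiplier.two_div_lt_of_multiplierBound hn hp₁ hp₂ hp hu hs hΘ hC
  refine ⟨max_lt hA ?_, ?_⟩
  -- For `p ≥ u` one has `1/p - 1 + 1/u ≤ 2/u`, so the first condition already suffices.
  · rcases lt_or_ge p u with h | h
    · exact BilinearMultiplier.one_div_sub_lt_of_multiplierBound hn hp0 h hu hs hΘ hC
    · refine lt_of_le_of_lt ?_ hA
      have h1 : 1 / p ≤ 1 / u := one_div_le_one_div_of_le (by linarith) h
      have h2 : 1 / u ≤ 1 := (div_le_one (by linarith)).2 hu.le
      have h3 : 2 / u = 1 / u + 1 / u := by ring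
      linarith
  · have h1 : 1 / 2 - (1 - 1 / p) = 1 / p - 1 / 2 := by ring
    rw [h1]
    exact BilinearMultiplier.add_le_of_multiplierBound hn (by linarith) (by linarith) hp0 hu hs hΘ hC
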